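/- Consider the differential equation $$x'x'''=xx''-2x''^2+x'^2+x^2 \qquad (1)$$ for $C^\infty$ functions $x:\mathbb R\to\mathbb R$. There is a constant $T>0$ with the following properties. (a) For every $\tau\in[0,T]$ there is exactly one $C^\infty$ function $x_\tau:\mathbb R\to\mathbb R$ which satisfies (1) on all of $\mathbb R$ and $x_\tau(0)=0$, $x_\tau'(0)=1$, $x_\tau''(0)=\tau$. (b) Every $C^\infty$ solution $x:\mathbb R\to\mathbb R$ of (1) on all of $\mathbb R$ has the form $x(t)=\alpha\, y(\pm t+t_0)$, with constants $\alpha,t_0\in\mathbb R$ and one choice of the sign, where $y(t)=\exp t$, or $y(t)=\cosh t$, or $y=x_\tau$ for some $\tau\in[0,T]$. (The value $\alpha=0$ gives the solution $x\equiv0$.) (c) For every $\tau\in[0,T]$ there are functions $\xi_\tau,\zeta_\tau,\mu_\tau,\nu_\tau:[0,\infty)\to\mathbb R$, which are $C^\infty$ on $[0,\infty)$ (including the end point $0$), such that for all $t\in\mathbb R$ $$x_\tau'(t)=e^{-t}\,\xi_\tau(e^{2t})=e^{t}\,\zeta_\tau(e^{-2t}),$$ $$(x_\tau''(t)-x_\tau(t))\,x_\tau'(t)^2=e^{t}\,\mu_\tau(e^{2t})=e^{-t}\,\nu_\tau(e^{-2t}).$$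 (d) For $\tau\in[0,T]$, one has $x_\tau'(t)>0$ for all $t\in\mathbb R$ if and only if $\tau<T$; and there is exactly one $t_0\in\mathbb R$ with $x_T'(t_0)=0$. -/

import Mathlib

open scoped ContDiff

/-- `x : ℝ → ℝ` is a smooth solution, defined on the whole real line, of
`x' x''' = x x'' - 2 x''² + x'² + x²`. -/
def IsSmoothSolution (x : ℝ → ℝ) : Prop :=
  ContDiff ℝ ∞ x ∧
    ∀ t : ℝ, deriv x t * iteratedDeriv 3 x t =
      x t * iteratedDeriv 2 x t - 2 * (iteratedDeriv 2 x t) ^ 2 + (deriv x t) ^ 2 + (x t) ^ 2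

/-- `x` is a smooth solution on the whole real line of the initial value problem
`x(0) = 0`, `x'(0) = 1`, `x''(0) = τ`. -/
def SolvesIVP (τ : ℝ) (x : ℝ → ℝ) : Prop :=
  IsSmoothSolution x ∧ x 0 = 0 ∧ deriv x 0 = 1 ∧ iteratedDeriv 2 x 0 = τ

/-- `x` is obtained from `y` by a scaling `y ↦ α y` and a change of time `t ↦ ± t + t₀`. -/
def ObtainedFrom (x y : ℝ → ℝ) : Prop :=
  ∃ α ε t₀ : ℝ, (ε = 1 ∨ ε = -1) ∧ ∀ t : ℝ, x t = α * y (ε * t + t₀)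

/-- `f` is smooth on the closed half-line `[0, ∞)`, the end point `0` included. -/
def SmoothOnHalfLine (f : ℝ → ℝ) : Prop :=
  ContDiffOn ℝ ∞ f (Set.Ici 0)

open Set Filter Topology

/-! Put u = x' and w = x'' - x. The equation becomes u w' = -w (3x + 2w), which is singular only
where u = 0, and it implies (w u²)' = -x u w everywhere. For a nonzero solution, u has at most one
zero, and w vanishes identically or nowhere (`SystemOn.critical_points`,
`SystemOn.w_zero_or_ne_zero`). If w = 0, then x'' = x, which yields exp, cosh and sinh up to scaling
and change of time; sinh is the solution with τ = 0. If w has no zero, the symmetries x ↦ -x and t ↦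
-t lead to a point where x = 0, u > 0 and w > 0. Translation and scaling then give the initial value
problem with τ = w/u at that point.

It remains to see which τ > 0 occur. The ratios p = x/u and r = w/u solve a planar polynomial system
whose forward solutions from (0, τ) stay bounded. For the past, take n = -x/w and m = u/w in
reversed time: m' = 4n - 3 and n' = m + n(3n - 2)/m. After multiplication of the field by m, the
point (2/3, 0) is a saddle, and it corresponds to a critical point of x. By a comparison argument
(`RatioOn.comparison`) all trajectories that leave n = 0 and end in the saddle have the same m(0),
which is 1/T. For τ < T the trajectory stays above this separatrix, enters n > 2/3, where r is
bounded, and lives for all time. For τ > T, m would have to be negative by the time at which the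
separatrix reaches the saddle, which is impossible for a global solution.

The separatrix itself comes from a power series x = w(-2/3 + m² φ(m²)), whose coefficients are
dominated by Catalan numbers. It is smooth through m = 0, so it gives a solution on both sides of
the critical point (`exists_separatrix_solution`). Standard uniqueness fails at the critical point.
It is replaced by a symmetry: the reflected solution is again a separatrix, hence by uniqueness of T
it is the same solution (`CriticalSolution.reflection`).

For the expansions, e^t(u - x), e^(-t)u and e^t w u² satisfy in the variable s = e^(-2t) a system
that is smooth up to s = 0 as long as the second function is nonzero. It therefore suffices to show
that u ≥ c e^t and that w u² is bounded (`SystemOn.hasAsymptotics`). Time reversal, or the symmetry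
about the critical point, handles the other end. -/

theorem exists_primitive_on_Icc {d : ℝ → ℝ} {a b : ℝ} (hab : a ≤ b)
    (hd : ContinuousOn d (Icc a b)) :
    ∃ D : ℝ → ℝ, Continuous D ∧ D a = 0 ∧ ∀ t ∈ Ioo a b, HasDerivAt D (d t) t := by
  have hc : Continuous (IccExtend hab ((Icc a b).domRestrict d)) :=
    (continuousOn_iff_continuous_domRestrict.1 hd).Icc_extend'
  have hD : ∀ t, HasDerivAt (fun t => ∫ s in a..t, IccExtend hab ((Icc a b).domRestrict d) s)
      (IccExtend hab ((Icc a b).domRestrict d) t) t := fun t =>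
    intervalIntegral.integral_hasDerivAt_right (hc.intervalIntegrable _ _)
      (hc.stronglyMeasurableAtFilter _ _) hc.continuousAt
  refine ⟨_, continuous_iff_continuousAt.2 fun t => (hD t).continuousAt, by simp, fun t ht => ?_⟩
  have := hD t
  rwa [IccExtend_of_mem hab _ (Ioo_subset_Icc_self ht)] at this

/-! ### Linear differential inequalities -/

section Linear

variable {f A d : ℝ → ℝ} {a b : ℝ}

theorem exists_integrating_factor (hab : a ≤ b) (hf : ContinuousOn f (Icc a b))
    (hd : ContinuousOn d (Icc a b))
    (hf' : ∀ t ∈ Ioo a b, HasDerivAt f (A t + d t * f t) t) :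
    ∃ E : ℝ → ℝ, (∀ t, 0 < E t) ∧ ContinuousOn (fun t => f t * E t) (Icc a b) ∧
      ∀ t ∈ Ioo a b, HasDerivAt (fun t => f t * E t) (A t * E t) t := by
  obtain ⟨D, hDc, -, hD⟩ := exists_primitive_on_Icc hab hd
  refine ⟨fun t => Real.exp (-D t), fun t => Real.exp_pos _,
    hf.mul (Real.continuous_exp.comp hDc.neg).continuousOn, fun t ht => ?_⟩
  refine ((hf' t ht).mul (hD t ht).fun_neg.exp).congr_deriv ?_
  ring

theorem monotoneOn_integrating_factor (hab : a ≤ b) (hf : ContinuousOn f (Icc a b))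
    (hd : ContinuousOn d (Icc a b))
    (hf' : ∀ t ∈ Ioo a b, HasDerivAt f (A t + d t * f t) t) (hA : ∀ t ∈ Ioo a b, 0 ≤ A t) :
    ∃ E : ℝ → ℝ, (∀ t, 0 < E t) ∧ f a * E a ≤ f b * E b := by
  obtain ⟨E, hE, hc, hder⟩ := exists_integrating_factor hab hf hd hf'
  refine ⟨E, hE, ?_⟩
  have : MonotoneOn (fun t => f t * E t) (Icc a b) := by
    refine monotoneOn_of_deriv_nonneg (convex_Icc a b) hc ?_ ?_
    · intro t ht
      rw [interior_Icc] at ht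
      exact (hder t ht).differentiableAt.differentiableWithinAt
    · intro t ht
      rw [interior_Icc] at ht
      rw [(hder t ht).deriv]
      exact mul_nonneg (hA t ht) (hE t).le
  exact this (left_mem_Icc.2 hab) (right_mem_Icc.2 hab) hab

theorem nonneg_of_linear_ineq (hab : a ≤ b) (hf : ContinuousOn f (Icc a b))
    (hd : ContinuousOn d (Icc a b))
    (hf' : ∀ t ∈ Ioo a b, HasDerivAt f (A t + d t * f t) t) (hA : ∀ t ∈ Ioo a b, 0 ≤ A t)
    (h0 : 0 ≤ f a) : 0 ≤ f b := by
  obtain ⟨E, hE, h⟩ := monotoneOn_integrating_factor hab hf hd hf' hA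
  exact nonneg_of_mul_nonneg_left ((mul_nonneg h0 (hE a).le).trans h) (hE b)

theorem pos_of_linear_ineq (hab : a ≤ b) (hf : ContinuousOn f (Icc a b))
    (hd : ContinuousOn d (Icc a b))
    (hf' : ∀ t ∈ Ioo a b, HasDerivAt f (A t + d t * f t) t) (hA : ∀ t ∈ Ioo a b, 0 ≤ A t)
    (h0 : 0 < f a) : 0 < f b := by
  obtain ⟨E, hE, h⟩ := monotoneOn_integrating_factor hab hf hd hf' hA
  exact pos_of_mul_pos_left ((mul_pos h0 (hE a)).trans_le h) (hE b).le

theorem pos_of_linear_strict_ineq (hab : a < b) (hf : ContinuousOn f (Icc a b))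
    (hd : ContinuousOn d (Icc a b))
    (hf' : ∀ t ∈ Ioo a b, HasDerivAt f (A t + d t * f t) t) (hA : ∀ t ∈ Ioo a b, 0 < A t)
    (h0 : 0 ≤ f a) : 0 < f b := by
  obtain ⟨E, hE, hc, hder⟩ := exists_integrating_factor hab.le hf hd hf'
  have : StrictMonoOn (fun t => f t * E t) (Icc a b) := by
    refine strictMonoOn_of_deriv_pos (convex_Icc a b) hc ?_
    intro t ht
    rw [interior_Icc] at ht
    rw [(hder t ht).deriv]
    exact mul_pos (hA t ht) (hE t)
  have h := this (left_mem_Icc.2 hab.le) (right_mem_Icc.2 hab.le) hab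
  exact pos_of_mul_pos_left ((mul_nonneg h0 (hE a).le).trans_lt h) (hE b).le

theorem eq_zero_iff_of_linear (hab : a ≤ b) (hf : ContinuousOn f (Icc a b))
    (hd : ContinuousOn d (Icc a b)) (hf' : ∀ t ∈ Ioo a b, HasDerivAt f (d t * f t) t) :
    f a = 0 ↔ f b = 0 := by
  have h1 : ∀ t ∈ Ioo a b, HasDerivAt f ((fun _ => (0 : ℝ)) t + d t * f t) t := fun t ht => by
    simpa using hf' t ht
  have h2 : ∀ t ∈ Ioo a b, HasDerivAt (fun t => -f t) ((fun _ => (0 : ℝ)) t + d t * (-f t)) t :=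
    fun t ht => by simpa using (hf' t ht).fun_neg
  constructor
  · intro h
    have h3 := nonneg_of_linear_ineq hab hf hd h1 (fun _ _ => le_rfl) h.ge
    have h4 := nonneg_of_linear_ineq hab hf.fun_neg hd h2 (fun _ _ => le_rfl) (by simp [h])
    linarith
  · intro h
    by_contra h0
    rcases lt_or_gt_of_ne h0 with h0 | h0
    · have h4 := pos_of_linear_ineq hab hf.fun_neg hd h2 (fun _ _ => le_rfl) (by simpa using h0)
      linarith
    · have h3 := pos_of_linear_ineq hab hf hd h1 (fun _ _ => le_rfl) h0
      linarith

/-- If the derivative of `f` is nonpositive wherever `f ≥ K`, then `f` cannot rise above `K`. -/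
theorem le_of_deriv_nonpos_above {f' : ℝ → ℝ} {K : ℝ} (hab : a ≤ b)
    (hf : ContinuousOn f (Icc a b)) (hf' : ∀ t ∈ Ioo a b, HasDerivAt f (f' t) t)
    (hK : ∀ t ∈ Ioo a b, K ≤ f t → f' t ≤ 0) (h0 : f a ≤ K) : f b ≤ K := by
  by_contra hb
  push Not at hb
  have hclosed : IsCompact (Icc a b ∩ f ⁻¹' Iic K) :=
    isCompact_Icc.of_isClosed_subset (hf.preimage_isClosed_of_isClosed isClosed_Icc isClosed_Iic)
      inter_subset_left
  obtain ⟨c, ⟨hc, hcK⟩, hmax⟩ := hclosed.exists_isGreatest ⟨a, left_mem_Icc.2 hab, h0⟩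
  have hcb : c < b := lt_of_le_of_ne hc.2 (by rintro rfl; exact absurd hcK (not_le.2 hb))
  have habove : ∀ t ∈ Ioo c b, K ≤ f t := fun t ht => by
    by_contra h
    exact absurd (hmax ⟨⟨hc.1.trans ht.1.le, ht.2.le⟩, (not_le.1 h).le⟩) (not_le.2 ht.1)
  have hanti : AntitoneOn f (Icc c b) := by
    have hmem : ∀ t ∈ Ioo c b, t ∈ Ioo a b := fun t ht => ⟨hc.1.trans_lt ht.1, ht.2⟩
    refine antitoneOn_of_deriv_nonpos (convex_Icc c b) (hf.mono (Icc_subset_Icc_left hc.1)) ?_ ?_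
    · intro t ht
      rw [interior_Icc] at ht
      exact (hf' t (hmem t ht)).differentiableAt.differentiableWithinAt
    · intro t ht
      rw [interior_Icc] at ht
      rw [(hf' t (hmem t ht)).deriv]
      exact hK t (hmem t ht) (habove t ht)
  have := hanti (left_mem_Icc.2 hcb.le) (right_mem_Icc.2 hcb.le) hcb.le
  have h2 : f c ≤ K := hcK
  linarith

end Linear

/-- Solutions of a smooth differential equation are smooth. -/
theorem contDiffOn_of_hasDerivWithinAt {E : Type*} [NormedAddCommGroup E] [NormedSpace ℝ E]
    {f : ℝ → E} {F : ℝ × E → E} {S : Set ℝ} {U : Set (ℝ × E)} (hS : UniqueDiffOn ℝ S)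
    (hF : ContDiffOn ℝ ∞ F U) (hU : ∀ t ∈ S, (t, f t) ∈ U)
    (h : ∀ t ∈ S, HasDerivWithinAt f (F (t, f t)) S t) : ContDiffOn ℝ ∞ f S := by
  rw [contDiffOn_infty]
  intro n
  induction n with
  | zero =>
    rw [Nat.cast_zero, contDiffOn_zero]
    exact fun t ht => (h t ht).continuousWithinAt
  | succ n ih =>
    rw [Nat.cast_succ, contDiffOn_succ_iff_derivWithin hS]
    refine ⟨fun t ht => (h t ht).differentiableWithinAt, by simp, ?_⟩
    have h1 : ContDiffOn ℝ n (fun t => F (t, f t)) S :=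
      (hF.of_le (mod_cast le_top)).comp (contDiffOn_id.prodMk ih) hU
    exact h1.congr fun t ht => (h t ht).derivWithin (hS t ht)

/-! ### Planar systems: uniqueness, and global existence from a priori bounds -/

section Global

variable {F : ℝ × ℝ → ℝ × ℝ}

theorem exists_lipschitzOnWith_closedBall (hF : ContDiff ℝ 1 F) (R : ℝ) :
    ∃ K, LipschitzOnWith K F (Metric.closedBall 0 R) :=
  hF.contDiffOn.exists_lipschitzOnWith one_ne_zero (convex_closedBall 0 R)
    (isCompact_closedBall 0 R)

theorem eqOn_of_hasDerivWithinAt (hF : ContDiff ℝ 1 F) {b : ℝ} {f g : ℝ → ℝ × ℝ}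
    (hf : ∀ t ∈ Icc 0 b, HasDerivWithinAt f (F (f t)) (Icc 0 b) t)
    (hg : ∀ t ∈ Icc 0 b, HasDerivWithinAt g (F (g t)) (Icc 0 b) t) (h0 : f 0 = g 0) :
    EqOn f g (Icc 0 b) := by
  have hfc : ContinuousOn f (Icc 0 b) := fun t ht => (hf t ht).continuousWithinAt
  have hgc : ContinuousOn g (Icc 0 b) := fun t ht => (hg t ht).continuousWithinAt
  obtain ⟨R₁, h1⟩ := (isCompact_Icc.image_of_continuousOn hfc).isBounded.subset_closedBall 0
  obtain ⟨R₂, h2⟩ := (isCompact_Icc.image_of_continuousOn hgc).isBounded.subset_closedBall 0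
  obtain ⟨K, hK⟩ := exists_lipschitzOnWith_closedBall hF (max R₁ R₂)
  have hd : ∀ {f : ℝ → ℝ × ℝ}, (∀ t ∈ Icc 0 b, HasDerivWithinAt f (F (f t)) (Icc 0 b) t) →
      ∀ t ∈ Ico 0 b, HasDerivWithinAt f (F (f t)) (Ici t) t := fun hf t ht =>
    (hf t (Ico_subset_Icc_self ht)).mono_of_mem_nhdsWithin (Icc_mem_nhdsGE_of_mem ht)
  refine ODE_solution_unique_of_mem_Icc_right (v := fun _ => F)
    (s := fun _ => Metric.closedBall 0 (max R₁ R₂)) (K := K) (fun _ _ => hK)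
    hfc (hd hf) (fun t ht => ?_) hgc (hd hg) (fun t ht => ?_) h0
  · exact Metric.closedBall_subset_closedBall (le_max_left _ _)
      (h1 (mem_image_of_mem _ (Ico_subset_Icc_self ht)))
  · exact Metric.closedBall_subset_closedBall (le_max_right _ _)
      (h2 (mem_image_of_mem _ (Ico_subset_Icc_self ht)))

theorem exists_solution_Icc_of_bounded_lipschitz {G : ℝ × ℝ → ℝ × ℝ} {K M : NNReal}
    (hG : LipschitzWith K G) (hM : ∀ z, ‖G z‖ ≤ M) (x₀ : ℝ × ℝ) {b : ℝ} (hb : 0 ≤ b) :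
    ∃ f : ℝ → ℝ × ℝ, f 0 = x₀ ∧ ∀ t ∈ Icc 0 b, HasDerivWithinAt f (G (f t)) (Icc 0 b) t := by
  have : IsPicardLindelof (fun _ => G) (⟨0, left_mem_Icc.2 hb⟩ : Icc (0 : ℝ) b) x₀
      (M * ⟨b, hb⟩) 0 M K :=
    { lipschitzOnWith := fun _ _ => hG.lipschitzOnWith
      continuousOn := fun _ _ => continuousOn_const
      norm_le := fun _ _ z _ => hM z
      mul_max_le := by simp [hb]; rfl }
  exact this.exists_eq_forall_mem_Icc_hasDerivWithinAt₀

theorem exists_solution_Icc_of_apriori_bound (hF : ContDiff ℝ 1 F) (x₀ : ℝ × ℝ) {β C : ℝ}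
    (hβ : 0 ≤ β)
    (H : ∀ b ∈ Ioc 0 β, ∀ f : ℝ → ℝ × ℝ, f 0 = x₀ → ContinuousOn f (Icc 0 b) →
      (∀ t ∈ Ioo 0 b, HasDerivAt f (F (f t)) t) → ‖f b‖ ≤ C) :
    ∃ f : ℝ → ℝ × ℝ, f 0 = x₀ ∧ ∀ t ∈ Icc 0 β, HasDerivWithinAt f (F (f t)) (Icc 0 β) t := by
  -- The field is frozen outside the box of radius `R` to make it globally Lipschitz. The extra 1
  -- makes the a priori bound strict, so the truncated solution never meets the boundary and solves
  -- the original equation.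
  set R : ℝ := max C ‖x₀‖ + 1 with hR
  have hR0 : 0 ≤ R := by positivity
  obtain ⟨K, hK⟩ := exists_lipschitzOnWith_closedBall hF R
  let c : ℝ → ℝ := fun z => max (-R) (min R z)
  have hc : LipschitzWith 1 c := (LipschitzWith.id.const_min R).const_max (-R)
  let cl : ℝ × ℝ → ℝ × ℝ := Prod.map c c
  have hcl : LipschitzWith 1 cl := by
    have := (hc.comp LipschitzWith.prod_fst).prodMk (hc.comp LipschitzWith.prod_snd)
    rwa [mul_one, max_self] at this
  have habs : ∀ z, |c z| ≤ R := fun z => by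
    simp only [c, abs_le]
    exact ⟨le_max_left _ _, max_le (by linarith) (min_le_left _ _)⟩
  have hclmem : ∀ z, cl z ∈ Metric.closedBall (0 : ℝ × ℝ) R := fun z => by
    rw [mem_closedBall_zero_iff, Prod.norm_def]
    exact max_le (habs _) (habs _)
  have hclid : ∀ z : ℝ × ℝ, ‖z‖ ≤ R → cl z = z := fun z hz => by
    rw [Prod.norm_def] at hz
    have h1 := abs_le.1 ((le_max_left _ _).trans hz)
    have h2 := abs_le.1 ((le_max_right _ _).trans hz)
    ext
    · simp [cl, c, min_eq_right h1.2, max_eq_right h1.1]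
    · simp [cl, c, min_eq_right h2.2, max_eq_right h2.1]
  have hLip : LipschitzWith (K * 1) (F ∘ cl) := by
    rw [← lipschitzOnWith_univ]
    exact hK.comp hcl.lipschitzOnWith fun z _ => hclmem z
  obtain ⟨M, hM⟩ := ((isCompact_closedBall (0 : ℝ × ℝ) R).image hF.continuous).isBounded.exists_norm_le
  obtain ⟨h, h0, hh⟩ := exists_solution_Icc_of_bounded_lipschitz (M := M.toNNReal) hLip
    (fun z => (hM _ (mem_image_of_mem F (hclmem z))).trans (Real.le_coe_toNNReal M)) x₀ hβ
  have hhc : ContinuousOn h (Icc 0 β) := fun t ht => (hh t ht).continuousWithinAt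
  have hbound : ∀ t ∈ Icc 0 β, ‖h t‖ < R := by
    by_contra hcon
    push Not at hcon
    obtain ⟨t₁, ht₁, hlt⟩ := hcon
    have hcomp : IsCompact (Icc 0 β ∩ (fun t => ‖h t‖) ⁻¹' Ici R) :=
      isCompact_Icc.of_isClosed_subset
        (hhc.norm.preimage_isClosed_of_isClosed isClosed_Icc isClosed_Ici) inter_subset_left
    obtain ⟨t₂, ⟨ht₂, ht₂R⟩, hmin⟩ := hcomp.exists_isLeast ⟨t₁, ht₁, hlt⟩
    have ht₂R : R ≤ ‖h t₂‖ := ht₂R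
    have hpos : 0 < t₂ := by
      refine lt_of_le_of_ne ht₂.1 ?_
      rintro rfl
      rw [h0] at ht₂R
      have := le_max_right C ‖x₀‖
      linarith
    have := H t₂ ⟨hpos, ht₂.2⟩ h h0 (hhc.mono (Icc_subset_Icc_right ht₂.2)) fun t ht => by
      have h1 := (hh t ⟨ht.1.le, ht.2.le.trans ht₂.2⟩).hasDerivAt
        (Icc_mem_nhds ht.1 (ht.2.trans_le ht₂.2))
      have h2 : ‖h t‖ ≤ R := by
        by_contra hc
        exact absurd (hmin ⟨⟨ht.1.le, ht.2.le.trans ht₂.2⟩, (not_le.1 hc).le⟩) (not_le.2 ht.2)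
      simpa [Function.comp, hclid _ h2] using h1
    have := le_max_left C ‖x₀‖
    linarith
  refine ⟨h, h0, fun t ht => ?_⟩
  have := hh t ht
  rwa [Function.comp, hclid _ (hbound t ht).le] at this

theorem exists_forward_solution (hF : ContDiff ℝ 1 F) (x₀ : ℝ × ℝ)
    (H : ∀ β > 0, ∃ C, ∀ b ∈ Ioc 0 β, ∀ f : ℝ → ℝ × ℝ, f 0 = x₀ → ContinuousOn f (Icc 0 b) →
      (∀ t ∈ Ioo 0 b, HasDerivAt f (F (f t)) t) → ‖f b‖ ≤ C) :
    ∃ f : ℝ → ℝ × ℝ, f 0 = x₀ ∧ ∀ t ≥ 0, HasDerivWithinAt f (F (f t)) (Ici 0) t := by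
  have hex : ∀ β : ℝ, ∃ f : ℝ → ℝ × ℝ, 0 < β → (f 0 = x₀ ∧
      ∀ t ∈ Icc 0 β, HasDerivWithinAt f (F (f t)) (Icc 0 β) t) := fun β => by
    by_cases hβ : 0 < β
    · obtain ⟨C, hC⟩ := H β hβ
      obtain ⟨f, hf⟩ := exists_solution_Icc_of_apriori_bound hF x₀ hβ.le hC
      exact ⟨f, fun _ => hf⟩
    · exact ⟨fun _ => 0, fun h => absurd h hβ⟩
  choose g hg using hex
  have huniq : ∀ β γ, 0 < β → β ≤ γ → EqOn (g β) (g γ) (Icc 0 β) := fun β γ hβ hγ =>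
    eqOn_of_hasDerivWithinAt hF (hg β hβ).2
      (fun t ht => ((hg γ (hβ.trans_le hγ)).2 t ⟨ht.1, ht.2.trans hγ⟩).mono
        (Icc_subset_Icc_right hγ))
      ((hg β hβ).1.trans (hg γ (hβ.trans_le hγ)).1.symm)
  have heq : ∀ t ≥ 0, ∀ s ∈ Ico 0 (t + 1), g (s + 1) s = g (t + 2) s := fun t _ s hs =>
    huniq (s + 1) (t + 2) (by linarith [hs.1]) (by linarith [hs.2]) ⟨hs.1, by linarith⟩
  refine ⟨fun t => g (t + 1) t, ?_, fun t ht => ?_⟩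
  · simpa using (hg 1 one_pos).1
  · have h1 := (hg (t + 2) (by linarith)).2 t ⟨ht, by linarith⟩
    have hnhds : Ico 0 (t + 1) ∈ 𝓝[Ici 0] t := by
      rw [← Ici_inter_Iio]
      exact inter_mem self_mem_nhdsWithin (mem_nhdsWithin_of_mem_nhds (Iio_mem_nhds (by linarith)))
    have h2 : HasDerivWithinAt (g (t + 2)) (F (g (t + 2) t)) (Ico 0 (t + 1)) t :=
      h1.mono fun s hs => ⟨hs.1, by linarith [hs.2]⟩
    have h3 := h2.congr (f₁ := fun t => g (t + 1) t) (fun s hs => heq t ht s hs)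
      (heq t ht t ⟨ht, by linarith⟩)
    have h4 := h3.mono_of_mem_nhdsWithin hnhds
    rwa [← heq t ht t ⟨ht, by linarith⟩] at h4

end Global

/-! ### The system for x, u, w, and the zeros of u and w -/

/-- The equation written as a system for `x`, `u = x'` and `w = x'' - x`. -/
structure SystemOn (S : Set ℝ) (x u w w' : ℝ → ℝ) : Prop where
  hx : ∀ t ∈ S, HasDerivAt x (u t) t
  hu : ∀ t ∈ S, HasDerivAt u (x t + w t) t
  hw : ∀ t ∈ S, HasDerivAt w (w' t) t
  eqn : ∀ t ∈ S, u t * w' t = -w t * (3 * x t + 2 * w t)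

theorem IsSmoothSolution.systemOn {x : ℝ → ℝ} (h : IsSmoothSolution x) :
    SystemOn univ x (deriv x) (fun t => iteratedDeriv 2 x t - x t)
      (fun t => iteratedDeriv 3 x t - deriv x t) := by
  obtain ⟨hc, he⟩ := h
  have hx : ∀ t, HasDerivAt x (deriv x t) t := fun t =>
    (hc.differentiable (by simp) t).hasDerivAt
  have hn : ∀ n : ℕ, ∀ t, HasDerivAt (iteratedDeriv n x) (iteratedDeriv (n + 1) x t) t :=
    fun n t => by
      rw [iteratedDeriv_succ]
      exact (hc.differentiable_iteratedDeriv n (by exact_mod_cast WithTop.coe_lt_top _) t).hasDerivAt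
  refine ⟨fun t _ => hx t, fun t _ => ?_, fun t _ => (hn 2 t).sub (hx t), fun t _ => ?_⟩
  · have := hn 1 t
    rw [iteratedDeriv_one] at this
    simpa using this
  · have := he t
    linear_combination this

namespace SystemOn

variable {S : Set ℝ} {x u w w' : ℝ → ℝ}

theorem deriv_eq (h : SystemOn univ x u w w') : deriv x = u :=
  funext fun t => (h.hx t trivial).deriv

theorem iteratedDeriv_two_eq (h : SystemOn univ x u w w') :
    iteratedDeriv 2 x = fun t => x t + w t := by
  rw [iteratedDeriv_succ, iteratedDeriv_one, h.deriv_eq]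
  exact funext fun t => (h.hu t trivial).deriv

theorem isSmoothSolution (h : SystemOn univ x u w w') (hc : ContDiff ℝ ∞ x) : IsSmoothSolution x := by
  refine ⟨hc, fun t => ?_⟩
  have h3 : iteratedDeriv 3 x t = u t + w' t := by
    rw [iteratedDeriv_succ, h.iteratedDeriv_two_eq]
    exact ((h.hx t trivial).add (h.hw t trivial)).deriv
  rw [h3, h.deriv_eq, h.iteratedDeriv_two_eq]
  have := h.eqn t trivial
  simp only
  linear_combination this

theorem neg (h : SystemOn S x u w w') :
    SystemOn S (fun t => -x t) (fun t => -u t) (fun t => -w t) (fun t => -w' t) := by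
  refine ⟨fun t ht => (h.hx t ht).fun_neg, fun t ht => ?_, fun t ht => (h.hw t ht).fun_neg,
    fun t ht => ?_⟩
  · exact (h.hu t ht).fun_neg.congr_deriv (by ring)
  · linear_combination h.eqn t ht

theorem const_mul (h : SystemOn S x u w w') (c : ℝ) :
    SystemOn S (fun t => c * x t) (fun t => c * u t) (fun t => c * w t) (fun t => c * w' t) := by
  refine ⟨fun t ht => (h.hx t ht).const_mul c, fun t ht => ?_, fun t ht => (h.hw t ht).const_mul c,
    fun t ht => ?_⟩
  · exact ((h.hu t ht).const_mul c).congr_deriv (by ring)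
  · linear_combination c ^ 2 * h.eqn t ht

theorem comp_neg (h : SystemOn S x u w w') :
    SystemOn (Neg.neg ⁻¹' S) (fun t => x (-t)) (fun t => -u (-t)) (fun t => w (-t))
      (fun t => -w' (-t)) := by
  have hn : ∀ {f : ℝ → ℝ} {f' t : ℝ}, HasDerivAt f f' (-t) →
      HasDerivAt (fun t => f (-t)) (-f') t := fun {f f' t} hf => by
    simpa [Function.comp_def] using HasDerivAt.scomp t hf (hasDerivAt_neg t)
  refine ⟨fun t ht => hn (h.hx _ ht), fun t ht => ?_, fun t ht => hn (h.hw _ ht), fun t ht => ?_⟩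
  · exact (hn (h.hu _ ht)).fun_neg.congr_deriv (by ring)
  · linear_combination h.eqn _ ht

theorem comp_add (h : SystemOn univ x u w w') (c : ℝ) :
    SystemOn univ (fun t => x (t + c)) (fun t => u (t + c)) (fun t => w (t + c))
      (fun t => w' (t + c)) :=
  ⟨fun t _ => (h.hx _ trivial).comp_add_const t c, fun t _ => (h.hu _ trivial).comp_add_const t c,
    fun t _ => (h.hw _ trivial).comp_add_const t c, fun _ _ => h.eqn _ trivial⟩

theorem continuous_x (h : SystemOn univ x u w w') : Continuous x :=
  continuous_iff_continuousAt.2 fun _ => (h.hx _ trivial).continuousAt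

theorem continuous_u (h : SystemOn univ x u w w') : Continuous u :=
  continuous_iff_continuousAt.2 fun _ => (h.hu _ trivial).continuousAt

theorem continuous_w (h : SystemOn univ x u w w') : Continuous w :=
  continuous_iff_continuousAt.2 fun _ => (h.hw _ trivial).continuousAt

theorem w'_eq (h : SystemOn S x u w w') {t : ℝ} (ht : t ∈ S) (hu : u t ≠ 0) :
    w' t = -(3 * x t + 2 * w t) / u t * w t := by
  field_simp
  linear_combination h.eqn t ht

/-- The factor u² absorbs the singular coefficient of the equation for w, so this identity needs no
condition u ≠ 0 and survives critical points. -/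
theorem hasDerivAt_v (h : SystemOn S x u w w') {t : ℝ} (ht : t ∈ S) :
    HasDerivAt (fun t => w t * u t ^ 2) (-(x t * u t * w t)) t := by
  refine ((h.hw t ht).mul ((h.hu t ht).pow 2)).congr_deriv ?_
  simp only [Pi.pow_apply]
  push_cast
  linear_combination u t * h.eqn t ht

theorem w_eq_zero_iff (h : SystemOn univ x u w w') {a b : ℝ} (hab : a ≤ b)
    (hu : ∀ t ∈ Icc a b, u t ≠ 0) : w a = 0 ↔ w b = 0 := by
  refine eq_zero_iff_of_linear (d := fun t => -(3 * x t + 2 * w t) / u t) hab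
    h.continuous_w.continuousOn ?_ fun t ht => ?_
  · exact ContinuousOn.div (by have := h.continuous_x; have := h.continuous_w; fun_prop)
      h.continuous_u.continuousOn hu
  · rw [← h.w'_eq trivial (hu t (Ioo_subset_Icc_self ht))]
    exact h.hw t trivial

theorem eq_or_of_u_eq_zero (h : SystemOn univ x u w w') {a : ℝ} (hu : u a = 0) :
    w a = 0 ∨ 3 * x a + 2 * w a = 0 := by
  have := h.eqn a trivial
  rw [hu, zero_mul] at this
  rcases mul_eq_zero.1 this.symm with h1 | h1
  · exact Or.inl (neg_eq_zero.1 h1)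
  · exact Or.inr h1

theorem x_add_w_ne_zero (h : SystemOn univ x u w w') {a : ℝ} (hu : u a = 0) (hx : x a ≠ 0) :
    x a + w a ≠ 0 := by
  rcases h.eq_or_of_u_eq_zero hu with h1 | h1
  · rwa [h1, add_zero]
  · intro h2
    apply hx
    linarith

/-- If x and u both vanished at a, then x > 0 to the right of a, so (w u²)² would be nonincreasing
from the value 0. This forces w = 0, then u = x, then x' = x with x(a) = 0, against x > 0. -/
theorem x_ne_zero_of_u_pos (h : SystemOn univ x u w w') {a b : ℝ} (hab : a < b)
    (hu : ∀ t ∈ Ioc a b, 0 < u t) (ha : u a = 0) : x a ≠ 0 := by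
  intro hxa
  have hmono : StrictMonoOn x (Icc a b) := by
    refine strictMonoOn_of_deriv_pos (convex_Icc a b) h.continuous_x.continuousOn fun t ht => ?_
    rw [interior_Icc] at ht
    rw [(h.hx t trivial).deriv]
    exact hu t (Ioo_subset_Ioc_self ht)
  have hxpos : ∀ t ∈ Ioc a b, 0 < x t := fun t ht => by
    have := hmono (left_mem_Icc.2 hab.le) (Ioc_subset_Icc_self ht) ht.1
    rwa [hxa] at this
  have hanti : AntitoneOn (fun t => (w t * u t ^ 2) ^ 2) (Icc a b) := by
    have hd : ∀ t, HasDerivAt (fun t => (w t * u t ^ 2) ^ 2)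
        (-(2 * (x t * u t ^ 3 * w t ^ 2))) t := fun t => by
      refine ((h.hasDerivAt_v (mem_univ t)).pow 2).congr_deriv ?_
      push_cast
      ring
    refine antitoneOn_of_deriv_nonpos (convex_Icc a b)
      (fun t _ => (hd t).continuousAt.continuousWithinAt)
      (fun t _ => (hd t).differentiableAt.differentiableWithinAt) fun t ht => ?_
    rw [interior_Icc] at ht
    rw [(hd t).deriv]
    have h1 := hxpos t (Ioo_subset_Ioc_self ht)
    have h2 := hu t (Ioo_subset_Ioc_self ht)
    have : 0 ≤ x t * u t ^ 3 * w t ^ 2 := by positivity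
    linarith
  have hw : ∀ t ∈ Ioc a b, w t = 0 := fun t ht => by
    have h1 := hanti (left_mem_Icc.2 hab.le) (Ioc_subset_Icc_self ht) ht.1.le
    simp only [ha] at h1
    have h2 : (w t * u t ^ 2) ^ 2 = 0 := le_antisymm (by simpa using h1) (sq_nonneg _)
    have h3 := hu t ht
    have h4 := pow_eq_zero_iff (two_ne_zero) |>.1 h2
    rcases mul_eq_zero.1 h4 with h5 | h5
    · exact h5
    · exact absurd h5 (by positivity)
  have hux : ∀ t ∈ Ioc a b, u t = x t := fun t ht => by
    have := (eq_zero_iff_of_linear (f := fun t => u t - x t) (d := fun _ => -1) ht.1.le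
      (by have := h.continuous_x; have := h.continuous_u; fun_prop) continuousOn_const
      fun s hs => ?_).1 (by simp [ha, hxa])
    · linarith
    · refine ((h.hu s trivial).sub (h.hx s trivial)).congr_deriv ?_
      rw [hw s ⟨hs.1, hs.2.le.trans ht.2⟩]
      ring
  have := (eq_zero_iff_of_linear (f := x) (d := fun _ => 1) hab.le h.continuous_x.continuousOn
    continuousOn_const fun s hs => by
      rw [one_mul, ← hux s (Ioo_subset_Ioc_self hs)]
      exact h.hx s trivial).1 hxa
  exact absurd this (hxpos b (right_mem_Ioc.2 hab)).ne'

theorem sign_of_ne_zero {f : ℝ → ℝ} {s : Set ℝ} (hs : s.OrdConnected) (hf : ContinuousOn f s)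
    (h0 : ∀ t ∈ s, f t ≠ 0) : (∀ t ∈ s, 0 < f t) ∨ ∀ t ∈ s, f t < 0 := by
  by_contra hcon
  push Not at hcon
  obtain ⟨⟨p, hp, hp'⟩, q, hq, hq'⟩ := hcon
  obtain ⟨c, hc, hc0⟩ := hs.isPreconnected.intermediate_value hp hq hf ⟨hp', hq'⟩
  exact h0 c hc hc0

theorem x_ne_zero_of_right (h : SystemOn univ x u w w') {a b : ℝ} (hab : a < b)
    (hu : ∀ t ∈ Ioc a b, u t ≠ 0) (ha : u a = 0) : x a ≠ 0 := by
  rcases sign_of_ne_zero ordConnected_Ioc h.continuous_u.continuousOn hu with h1 | h1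
  · exact h.x_ne_zero_of_u_pos hab h1 ha
  · have := h.neg.x_ne_zero_of_u_pos hab (fun t ht => neg_pos.2 (h1 t ht)) (by simp [ha])
    simpa using this

theorem comp_neg_univ (h : SystemOn univ x u w w') :
    SystemOn univ (fun t => x (-t)) (fun t => -u (-t)) (fun t => w (-t)) (fun t => -w' (-t)) := by
  simpa using h.comp_neg

theorem x_ne_zero_of_left (h : SystemOn univ x u w w') {a b : ℝ} (hab : a < b)
    (hu : ∀ t ∈ Ico a b, u t ≠ 0) (hb : u b = 0) : x b ≠ 0 := by
  have := h.comp_neg_univ.x_ne_zero_of_right (a := -b) (b := -a) (by linarith)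
    (fun t ht => neg_ne_zero.2 (hu (-t) ⟨by linarith [ht.2], by linarith [ht.1]⟩)) (by simp [hb])
  simpa using this

/-- Near a both 3x + 2w and x + w = u' have the sign of x(a). Hence on the right of a, u has this
sign too, and (w²)' = -2w²(3x + 2w)/u ≤ 0. -/
theorem w_eq_zero_right (h : SystemOn univ x u w w') {a : ℝ} (hu : u a = 0) (hx : x a ≠ 0)
    (hw : w a = 0) : ∃ b > a, ∀ t ∈ Icc a b, w t = 0 := by
  have hxc := h.continuous_x
  have hwc := h.continuous_w
  have huc := h.continuous_u
  have hx2 : 0 < x a * x a := mul_self_pos.2 hx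
  have h1 : ∀ᶠ t in 𝓝 a, 0 < x a * (3 * x t + 2 * w t) := by
    have : Continuous fun t => x a * (3 * x t + 2 * w t) := by fun_prop
    exact this.continuousAt.eventually_const_lt (by simp only [hw]; linarith)
  have h2 : ∀ᶠ t in 𝓝 a, 0 < x a * (x t + w t) := by
    have : Continuous fun t => x a * (x t + w t) := by fun_prop
    exact this.continuousAt.eventually_const_lt (by simp only [hw]; linarith)
  obtain ⟨ε, hε, hball⟩ := Metric.eventually_nhds_iff_ball.1 (h1.and h2)
  have hin : ∀ t ∈ Icc a (a + ε / 2), t ∈ Metric.ball a ε := fun t ht => by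
    rw [Real.ball_eq_Ioo]
    exact ⟨by linarith [ht.1], by linarith [ht.2]⟩
  have hab : a < a + ε / 2 := by linarith
  have humono : StrictMonoOn (fun t => x a * u t) (Icc a (a + ε / 2)) := by
    refine strictMonoOn_of_deriv_pos (convex_Icc _ _) (by fun_prop) fun t ht => ?_
    rw [interior_Icc] at ht
    rw [((h.hu t trivial).const_mul (x a)).deriv]
    exact (hball t (hin t (Ioo_subset_Icc_self ht))).2
  have hupos : ∀ t ∈ Ioc a (a + ε / 2), 0 < x a * u t := fun t ht => by
    have := humono (left_mem_Icc.2 hab.le) (Ioc_subset_Icc_self ht) ht.1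
    simpa [hu] using this
  have hanti : AntitoneOn (fun t => w t ^ 2) (Icc a (a + ε / 2)) := by
    have hd : ∀ t, HasDerivAt (fun t => w t ^ 2) (2 * w t * w' t) t := fun t => by
      refine ((h.hw t trivial).pow 2).congr_deriv ?_
      push_cast
      ring
    refine antitoneOn_of_deriv_nonpos (convex_Icc _ _) (by fun_prop)
      (fun t _ => (hd t).differentiableAt.differentiableWithinAt) fun t ht => ?_
    rw [interior_Icc] at ht
    rw [(hd t).deriv]
    have h3 := hupos t (Ioo_subset_Ioc_self ht)
    have h4 := (hball t (hin t (Ioo_subset_Icc_self ht))).1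
    by_contra hcon
    push Not at hcon
    have h6 : 0 < (x a * u t) * (2 * w t * w' t) := mul_pos h3 hcon
    have h7 : (x a * u t) * (2 * w t * w' t) = -(2 * w t ^ 2 * (x a * (3 * x t + 2 * w t))) := by
      linear_combination 2 * x a * w t * h.eqn t trivial
    have h8 : 0 ≤ 2 * w t ^ 2 * (x a * (3 * x t + 2 * w t)) := by positivity
    linarith
  refine ⟨a + ε / 2, hab, fun t ht => ?_⟩
  have := hanti (left_mem_Icc.2 hab.le) ht ht.1
  simp only [hw] at this
  nlinarith [sq_nonneg (w t)]

theorem w_eq_zero_left (h : SystemOn univ x u w w') {a : ℝ} (hu : u a = 0) (hx : x a ≠ 0)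
    (hw : w a = 0) : ∃ b < a, ∀ t ∈ Icc b a, w t = 0 := by
  obtain ⟨b, hb, hb'⟩ := h.comp_neg_univ.w_eq_zero_right (a := -a) (by simp [hu]) (by simpa)
    (by simpa)
  refine ⟨-b, by linarith, fun t ht => ?_⟩
  simpa using hb' (-t) ⟨by linarith [ht.2], by linarith [ht.1]⟩

theorem w_eq_zero_of_Ioo (h : SystemOn univ x u w w') {a b c : ℝ} (hu : ∀ t ∈ Ioo a b, u t ≠ 0)
    (hc : c ∈ Ioo a b) (hw : w c = 0) : ∀ t ∈ Ioo a b, w t = 0 := by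
  intro t ht
  rcases le_total t c with htc | htc
  · exact (h.w_eq_zero_iff htc fun s hs => hu s ⟨ht.1.trans_le hs.1, hs.2.trans_lt hc.2⟩).2 hw
  · exact (h.w_eq_zero_iff htc fun s hs => hu s ⟨hc.1.trans_le hs.1, hs.2.trans_lt ht.2⟩).1 hw

/-- Suppose u ≠ 0 in between. If w vanishes somewhere there, it vanishes throughout and (ux)' = x² +
u² > 0, although ux is 0 at both ends. Otherwise 3x + 2w = 0 at both ends, so u' = w/3 has the same
sign at both ends, which is impossible for consecutive zeros. -/
theorem exists_u_eq_zero_between (h : SystemOn univ x u w w') {a b : ℝ} (hab : a < b) (ha : u a = 0)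
    (hb : u b = 0) : ∃ t ∈ Ioo a b, u t = 0 := by
  by_contra hcon
  push Not at hcon
  have hab2 : a < (a + b) / 2 ∧ (a + b) / 2 < b := ⟨by linarith, by linarith⟩
  have hxa : x a ≠ 0 := h.x_ne_zero_of_right hab2.1
    (fun t ht => hcon t ⟨ht.1, ht.2.trans_lt hab2.2⟩) ha
  have hxb : x b ≠ 0 := h.x_ne_zero_of_left hab2.2
    (fun t ht => hcon t ⟨hab2.1.trans_le ht.1, ht.2⟩) hb
  have hxc := h.continuous_x
  have hwc := h.continuous_w
  have huc := h.continuous_u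
  by_cases hex : ∃ c ∈ Ioo a b, w c = 0
  · obtain ⟨c, hc, hwc0⟩ := hex
    have hw := h.w_eq_zero_of_Ioo hcon hc hwc0
    have : StrictMonoOn (fun t => u t * x t) (Icc a b) := by
      refine strictMonoOn_of_deriv_pos (convex_Icc _ _) (by fun_prop) fun t ht => ?_
      rw [interior_Icc] at ht
      rw [((h.hu t trivial).fun_mul (h.hx t trivial)).deriv, hw t ht]
      have := hcon t ht
      have : 0 < u t * u t := mul_self_pos.2 this
      nlinarith [mul_self_nonneg (x t)]
    have := this (left_mem_Icc.2 hab.le) (right_mem_Icc.2 hab.le) hab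
    simp [ha, hb] at this
  · push Not at hex
    have hwa : 3 * x a + 2 * w a = 0 := by
      refine (h.eq_or_of_u_eq_zero ha).resolve_left fun hwa => ?_
      obtain ⟨c, hc, hc'⟩ := h.w_eq_zero_right ha hxa hwa
      obtain ⟨d, hd, hd'⟩ := exists_between (lt_min hc hab)
      exact hex d ⟨hd, hd'.trans_le (min_le_right _ _)⟩
        (hc' d ⟨hd.le, hd'.le.trans (min_le_left _ _)⟩)
    have hwb : 3 * x b + 2 * w b = 0 := by
      refine (h.eq_or_of_u_eq_zero hb).resolve_left fun hwb => ?_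
      obtain ⟨c, hc, hc'⟩ := h.w_eq_zero_left hb hxb hwb
      obtain ⟨d, hd, hd'⟩ := exists_between (max_lt hc hab)
      exact hex d ⟨(le_max_right _ _).trans_lt hd, hd'⟩
        (hc' d ⟨(le_max_left _ _).trans hd.le, hd'.le⟩)
    have hwI : ∀ t ∈ Icc a b, w t ≠ 0 := fun t ht => by
      rcases eq_or_lt_of_le ht.1 with rfl | h1
      · intro h0; apply hxa; linarith
      · rcases eq_or_lt_of_le ht.2 with rfl | h2
        · intro h0; apply hxb; linarith
        · exact hex t ⟨h1, h2⟩
    have key : ∀ {x u w w' : ℝ → ℝ}, SystemOn univ x u w w' → u a = 0 → u b = 0 →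
        3 * x a + 2 * w a = 0 → 3 * x b + 2 * w b = 0 →
        (∀ t ∈ Ioo a b, 0 < u t) → (∀ t ∈ Icc a b, w t ≠ 0) → False := by
      intro x u w w' h ha hb hwa hwb hu hw
      have h1 : 0 ≤ x a + w a := by
        by_contra hneg
        have := (h.hu a trivial).hasDerivWithinAt (s := Ioi a)
        have h3 := (hasDerivWithinAt_iff_tendsto_slope' (by simp)).1 this
        have h4 := h3.eventually_lt_const (not_le.1 hneg)
        obtain ⟨t, ht1, ht2⟩ := (h4.and (Ioo_mem_nhdsGT hab)).exists
        rw [slope_def_field, ha, sub_zero] at ht1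
        exact absurd ht1 (not_lt.2 (div_nonneg (hu t ht2).le (by linarith [ht2.1])))
      have h2 : x b + w b ≤ 0 := by
        by_contra hneg
        have := (h.hu b trivial).hasDerivWithinAt (s := Iio b)
        have h3 := (hasDerivWithinAt_iff_tendsto_slope' (by simp)).1 this
        have h4 := h3.eventually_const_lt (not_le.1 hneg)
        obtain ⟨t, ht1, ht2⟩ := (h4.and (Ioo_mem_nhdsLT hab)).exists
        rw [slope_def_field, hb, sub_zero] at ht1
        exact absurd ht1 (not_lt.2 (div_nonpos_of_nonneg_of_nonpos (hu t ht2).le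
          (by linarith [ht2.2])))
      rcases sign_of_ne_zero ordConnected_Icc h.continuous_w.continuousOn hw with h3 | h3
      · have := h3 b (right_mem_Icc.2 hab.le)
        linarith
      · have := h3 a (left_mem_Icc.2 hab.le)
        linarith
    rcases sign_of_ne_zero ordConnected_Ioo h.continuous_u.continuousOn hcon with h1 | h1
    · exact key h ha hb hwa hwb h1 hwI
    · exact key h.neg (by simp [ha]) (by simp [hb]) (by linarith) (by linarith)
        (fun t ht => neg_pos.2 (h1 t ht)) fun t ht => neg_ne_zero.2 (hwI t ht)

/-- The zero at a is simple, so a further zero would produce a next one, contrary to the existence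
of a zero between any two. -/
theorem u_ne_zero_right (h : SystemOn univ x u w w') {a : ℝ} (ha : u a = 0) (hx : x a ≠ 0) :
    ∀ t > a, u t ≠ 0 := by
  intro b hb hub
  have hev := (h.hu a trivial).eventually_ne (c := 0) (h.x_add_w_ne_zero ha hx)
  have hev' : ∀ᶠ t in 𝓝[>] a, u t ≠ 0 := nhdsWithin_mono a (fun t ht => ne_of_gt ht) hev
  obtain ⟨c, hc, hc'⟩ := mem_nhdsGT_iff_exists_Ioo_subset.1 hev'
  have hc : a < c := hc
  have hcb : c ≤ b := by
    by_contra hcon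
    exact hc' ⟨hb, not_le.1 hcon⟩ hub
  have hcomp : IsCompact (Icc c b ∩ u ⁻¹' {0}) :=
    isCompact_Icc.inter_right (isClosed_singleton.preimage h.continuous_u)
  obtain ⟨d, ⟨hd, hd0⟩, hmin⟩ := hcomp.exists_isLeast ⟨b, right_mem_Icc.2 hcb, hub⟩
  obtain ⟨t, ht, ht0⟩ := h.exists_u_eq_zero_between (hc.trans_le hd.1) ha hd0
  rcases lt_or_ge t c with htc | htc
  · exact hc' ⟨ht.1, htc⟩ ht0
  · exact absurd (hmin ⟨⟨htc, ht.2.le.trans hd.2⟩, ht0⟩) (not_le.2 ht.2)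

theorem u_ne_zero_left (h : SystemOn univ x u w w') {a : ℝ} (ha : u a = 0) (hx : x a ≠ 0) :
    ∀ t < a, u t ≠ 0 := by
  intro t ht
  have := h.comp_neg_univ.u_ne_zero_right (a := -a) (by simp [ha]) (by simpa) (-t) (by linarith)
  simpa using this

/-- The critical points of a nonzero solution: there is at most one. -/
theorem critical_points (h : SystemOn univ x u w w') (hx : ∃ t, x t ≠ 0) :
    (∀ t, u t ≠ 0) ∨ ∃ a, u a = 0 ∧ x a ≠ 0 ∧ ∀ t, t ≠ a → u t ≠ 0 := by
  have key : ∀ a, u a = 0 → x a ≠ 0 → ∀ t, t ≠ a → u t ≠ 0 := fun a ha hxa t ht => by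
    rcases lt_or_gt_of_ne ht with h1 | h1
    · exact h.u_ne_zero_left ha hxa t h1
    · exact h.u_ne_zero_right ha hxa t h1
  have hne : ∃ t, u t ≠ 0 := by
    by_contra hcon
    push Not at hcon
    obtain ⟨t, ht⟩ := hx
    have h1 : x t + w t = 0 := by
      have := h.hu t trivial
      rw [show u = fun _ => 0 from funext hcon] at this
      exact this.unique (hasDerivAt_const t 0)
    have h2 := h.eqn t trivial
    rw [hcon t, zero_mul] at h2
    have h3 : w t = -x t := by linarith
    rw [h3] at h2
    apply ht
    have : x t * x t = 0 := by linarith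
    exact mul_self_eq_zero.1 this
  obtain ⟨c, hc⟩ := hne
  by_contra hcon
  push Not at hcon
  obtain ⟨⟨d, hd⟩, hcon⟩ := hcon
  have hdc : d ≠ c := fun hdc => hc (hdc ▸ hd)
  -- The zero of `u` nearest to `c` on the side of `d` borders a zero-free interval, which forces `x
  -- ≠ 0` there.
  rcases lt_or_gt_of_ne hdc with hlt | hlt
  · have hcomp : IsCompact (Icc d c ∩ u ⁻¹' {0}) :=
      isCompact_Icc.inter_right (isClosed_singleton.preimage h.continuous_u)
    obtain ⟨a, ⟨ha, ha0⟩, hmax⟩ := hcomp.exists_isGreatest ⟨d, left_mem_Icc.2 hlt.le, hd⟩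
    have hac : a < c := lt_of_le_of_ne ha.2 fun h' => hc (h' ▸ ha0)
    have hxa := h.x_ne_zero_of_right hac (fun t ht h0 =>
      absurd (hmax ⟨⟨ha.1.trans ht.1.le, ht.2⟩, h0⟩) (not_le.2 ht.1)) ha0
    obtain ⟨t, ht, ht0⟩ := hcon a ha0 hxa
    exact key a ha0 hxa t ht ht0
  · have hcomp : IsCompact (Icc c d ∩ u ⁻¹' {0}) :=
      isCompact_Icc.inter_right (isClosed_singleton.preimage h.continuous_u)
    obtain ⟨a, ⟨ha, ha0⟩, hmin⟩ := hcomp.exists_isLeast ⟨d, right_mem_Icc.2 hlt.le, hd⟩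
    have hac : c < a := lt_of_le_of_ne ha.1 fun h' => hc (h' ▸ ha0)
    have hxa := h.x_ne_zero_of_left hac (fun t ht h0 =>
      absurd (hmin ⟨⟨ht.1, ht.2.le.trans ha.2⟩, h0⟩) (not_le.2 ht.2)) ha0
    obtain ⟨t, ht, ht0⟩ := hcon a ha0 hxa
    exact key a ha0 hxa t ht ht0

/-- Away from the critical point w solves a homogeneous linear equation. Across it, vanishing passes
to a by continuity and from a to a neighbourhood by the one-sided lemmas. -/
theorem w_zero_or_ne_zero (h : SystemOn univ x u w w') (hx : ∃ t, x t ≠ 0) :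
    (∀ t, w t = 0) ∨ ∀ t, w t ≠ 0 := by
  rcases h.critical_points hx with hu | ⟨a, ha, hxa, hu⟩
  · by_cases hex : ∃ c, w c = 0
    · obtain ⟨c, hc⟩ := hex
      refine Or.inl fun t => ?_
      rcases le_total t c with htc | htc
      · exact (h.w_eq_zero_iff htc fun s _ => hu s).2 hc
      · exact (h.w_eq_zero_iff htc fun s _ => hu s).1 hc
    · push Not at hex
      exact Or.inr hex
  · have hright : ∀ c > a, w c = 0 → w a = 0 := fun c hc hwc => by
      have hcl : IsClosed {t | w t = 0} := isClosed_eq h.continuous_w continuous_const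
      have hsub : Ioc a c ⊆ {t | w t = 0} := fun t ht =>
        (h.w_eq_zero_iff ht.2 fun s hs => hu s (ht.1.trans_le hs.1).ne').2 hwc
      have := closure_minimal hsub hcl
      rw [closure_Ioc hc.ne] at this
      exact this (left_mem_Icc.2 hc.le)
    have hleft : ∀ c < a, w c = 0 → w a = 0 := fun c hc hwc => by
      have hcl : IsClosed {t | w t = 0} := isClosed_eq h.continuous_w continuous_const
      have hsub : Ico c a ⊆ {t | w t = 0} := fun t ht =>
        (h.w_eq_zero_iff ht.1 fun s hs => hu s (hs.2.trans_lt ht.2).ne).1 hwc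
      have := closure_minimal hsub hcl
      rw [closure_Ico hc.ne] at this
      exact this (right_mem_Icc.2 hc.le)
    by_cases hwa : w a = 0
    · refine Or.inl fun t => ?_
      rcases lt_trichotomy t a with h1 | rfl | h1
      · obtain ⟨b, hb, hb'⟩ := h.w_eq_zero_left ha hxa hwa
        rcases le_total b t with hbt | hbt
        · exact hb' t ⟨hbt, h1.le⟩
        · exact (h.w_eq_zero_iff hbt fun s hs => hu s (hs.2.trans_lt hb).ne).2
            (hb' b ⟨le_rfl, hb.le⟩)
      · exact hwa
      · obtain ⟨b, hb, hb'⟩ := h.w_eq_zero_right ha hxa hwa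
        rcases le_total t b with hbt | hbt
        · exact hb' t ⟨h1.le, hbt⟩
        · exact (h.w_eq_zero_iff hbt fun s hs => hu s (hb.trans_le hs.1).ne').1
            (hb' b ⟨hb.le, le_rfl⟩)
    · refine Or.inr fun t ht => ?_
      rcases lt_trichotomy t a with h1 | rfl | h1
      · exact hwa (hleft t h1 ht)
      · exact hwa ht
      · exact hwa (hright t h1 ht)

end SystemOn

/-! ### Comparison of trajectories of the ratios n = -x/w and m = u/w -/

theorem le_of_hasDerivAt_nonneg {f f' : ℝ → ℝ} {a b : ℝ} (hab : a ≤ b)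
    (hf : ContinuousOn f (Icc a b)) (hf' : ∀ t ∈ Ioo a b, HasDerivAt f (f' t) t)
    (h0 : ∀ t ∈ Ioo a b, 0 ≤ f' t) : f a ≤ f b := by
  have := nonneg_of_linear_ineq (f := fun t => f t - f a) (A := f') (d := fun _ => 0) hab
    (by fun_prop) continuousOn_const
    (fun t ht => by simpa using (hf' t ht).sub_const (f a)) h0 (by simp)
  linarith

/-- The ratios `n = -x/w` and `m = u/w`, in reversed time. -/
structure RatioOn (b : ℝ) (n m : ℝ → ℝ) : Prop where
  cn : ContinuousOn n (Icc 0 b)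
  cm : ContinuousOn m (Icc 0 b)
  m_pos : ∀ t ∈ Ico 0 b, 0 < m t
  hm : ∀ t ∈ Ioo 0 b, HasDerivAt m (4 * n t - 3) t
  hn : ∀ t ∈ Ioo 0 b, HasDerivAt n (m t + n t * (3 * n t - 2) / m t) t

namespace RatioOn

variable {b : ℝ} {n m n₁ m₁ n₂ m₂ : ℝ → ℝ}

theorem mono (h : RatioOn b n m) {c : ℝ} (hc : c ≤ b) : RatioOn c n m :=
  ⟨h.cn.mono (Icc_subset_Icc_right hc), h.cm.mono (Icc_subset_Icc_right hc),
    fun t ht => h.m_pos t ⟨ht.1, ht.2.trans_le hc⟩, fun t ht => h.hm t ⟨ht.1, ht.2.trans_le hc⟩,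
    fun t ht => h.hn t ⟨ht.1, ht.2.trans_le hc⟩⟩

/-- The differential inequality behind the comparison of two solutions. -/
theorem exists_linear (h₁ : RatioOn b n₁ m₁) (h₂ : RatioOn b n₂ m₂)
    (hcase : (0 < m₁ b ∧ ∀ t ∈ Ioo 0 b, 0 ≤ n₂ t ∧ n₂ t ≤ 2 / 3) ∨
      (0 < m₂ b ∧ ∀ t ∈ Ioo 0 b, 0 ≤ n₁ t ∧ n₁ t ≤ 2 / 3)) :
    ∃ c d : ℝ → ℝ, ContinuousOn d (Icc 0 b) ∧ (∀ t ∈ Ioo 0 b, 0 < c t) ∧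
      ∀ t ∈ Ioo 0 b, HasDerivAt (fun t => n₁ t - n₂ t)
        (c t * (m₁ t - m₂ t) + d t * (n₁ t - n₂ t)) t := by
  have hn₁ := h₁.cn
  have hn₂ := h₂.cn
  have hpos : ∀ {m : ℝ → ℝ}, (∀ t ∈ Ico 0 b, 0 < m t) → 0 < m b → ∀ t ∈ Icc 0 b, m t ≠ 0 :=
    fun hm hb t ht => by
      rcases eq_or_lt_of_le ht.2 with rfl | h
      · exact hb.ne'
      · exact (hm t ⟨ht.1, h⟩).ne'
  have hc : ∀ {n : ℝ → ℝ}, (∀ t ∈ Ioo 0 b, 0 ≤ n t ∧ n t ≤ 2 / 3) →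
      ∀ t ∈ Ioo 0 b, 0 < 1 - n t * (3 * n t - 2) / (m₁ t * m₂ t) := fun {n} hn t ht => by
    have h1 := h₁.m_pos t (Ioo_subset_Ico_self ht)
    have h2 := h₂.m_pos t (Ioo_subset_Ico_self ht)
    have h3 := hn t ht
    have := div_nonpos_of_nonpos_of_nonneg
      (mul_nonpos_of_nonneg_of_nonpos h3.1 (by linarith : 3 * n t - 2 ≤ 0)) (mul_pos h1 h2).le
    linarith
  -- The quotient difference can be split with either denominator in `d`. The chosen `m` must be
  -- positive at `b` as well, to make `d` continuous on the closed interval, and the other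
  -- trajectory must have 0 ≤ n ≤ 2/3, to make `c` positive.
  rcases hcase with ⟨hb, hn⟩ | ⟨hb, hn⟩
  · refine ⟨_, fun t => (3 * (n₁ t + n₂ t) - 2) / m₁ t,
      ContinuousOn.div (by fun_prop) h₁.cm (hpos h₁.m_pos hb), hc hn, fun t ht => ?_⟩
    refine ((h₁.hn t ht).sub (h₂.hn t ht)).congr_deriv ?_
    have h1 := (h₁.m_pos t (Ioo_subset_Ico_self ht)).ne'
    have h2 := (h₂.m_pos t (Ioo_subset_Ico_self ht)).ne'
    field_simp
    ring
  · refine ⟨_, fun t => (3 * (n₁ t + n₂ t) - 2) / m₂ t,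
      ContinuousOn.div (by fun_prop) h₂.cm (hpos h₂.m_pos hb), hc hn, fun t ht => ?_⟩
    refine ((h₁.hn t ht).sub (h₂.hn t ht)).congr_deriv ?_
    have h1 := (h₁.m_pos t (Ioo_subset_Ico_self ht)).ne'
    have h2 := (h₂.m_pos t (Ioo_subset_Ico_self ht)).ne'
    field_simp
    ring

/-- As long as m₁ > m₂, the linear inequality gives n₁ > n₂. Then (m₁ - m₂)' = 4(n₁ - n₂) > 0, so
the gap in m never closes: there is no first time at which m₁ ≤ m₂. -/
theorem comparison (h₁ : RatioOn b n₁ m₁) (h₂ : RatioOn b n₂ m₂) (hb : 0 < b)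
    (hn : n₁ 0 = n₂ 0) (hm : m₂ 0 < m₁ 0)
    (hcase : (0 < m₁ b ∧ ∀ t ∈ Ioo 0 b, 0 ≤ n₂ t ∧ n₂ t ≤ 2 / 3) ∨
      (0 < m₂ b ∧ ∀ t ∈ Ioo 0 b, 0 ≤ n₁ t ∧ n₁ t ≤ 2 / 3)) :
    n₂ b < n₁ b ∧ m₁ 0 - m₂ 0 ≤ m₁ b - m₂ b := by
  obtain ⟨c, d, hd, hc, hder⟩ := h₁.exists_linear h₂ hcase
  have hcn := h₁.cn.sub h₂.cn
  have hcm := h₁.cm.sub h₂.cm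
  have step : ∀ t ∈ Ioc 0 b, (∀ s ∈ Ioo 0 t, 0 < m₁ s - m₂ s) →
      n₂ t < n₁ t ∧ m₁ 0 - m₂ 0 ≤ m₁ t - m₂ t := by
    intro t ht hpos
    have hlt : ∀ s ∈ Ioc 0 t, n₂ s < n₁ s := fun s hs => by
      have := pos_of_linear_strict_ineq (f := fun t => n₁ t - n₂ t) hs.1
        (hcn.mono (Icc_subset_Icc_right (hs.2.trans ht.2)))
        (hd.mono (Icc_subset_Icc_right (hs.2.trans ht.2)))
        (fun r hr => hder r ⟨hr.1, hr.2.trans_le (hs.2.trans ht.2)⟩)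
        (fun r hr => mul_pos (hc r ⟨hr.1, hr.2.trans_le (hs.2.trans ht.2)⟩)
          (hpos r ⟨hr.1, hr.2.trans_le hs.2⟩)) (by simp [hn])
      linarith
    refine ⟨hlt t ⟨ht.1, le_rfl⟩, ?_⟩
    refine le_of_hasDerivAt_nonneg (f := fun t => m₁ t - m₂ t) ht.1.le
      (hcm.mono (Icc_subset_Icc_right ht.2))
      (fun s hs => (h₁.hm s ⟨hs.1, hs.2.trans_le ht.2⟩).sub (h₂.hm s ⟨hs.1, hs.2.trans_le ht.2⟩))
      fun s hs => ?_
    have := hlt s (Ioo_subset_Ioc_self hs)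
    linarith
  refine step b ⟨hb, le_rfl⟩ ?_
  by_contra hcon
  push Not at hcon
  obtain ⟨q, hq, hq0⟩ := hcon
  have hcomp : IsCompact (Icc 0 b ∩ (fun t => m₁ t - m₂ t) ⁻¹' Iic 0) :=
    isCompact_Icc.of_isClosed_subset (hcm.preimage_isClosed_of_isClosed isClosed_Icc isClosed_Iic)
      inter_subset_left
  obtain ⟨t, ⟨ht, ht0⟩, hmin⟩ := hcomp.exists_isLeast ⟨q, Ioo_subset_Icc_self hq, hq0⟩
  have ht0 : m₁ t - m₂ t ≤ 0 := ht0
  have htpos : 0 < t := lt_of_le_of_ne ht.1 (by rintro rfl; linarith)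
  have := (step t ⟨htpos, ht.2⟩ fun s hs => by
    by_contra hcon
    exact absurd (hmin ⟨⟨hs.1.le, hs.2.le.trans ht.2⟩, not_lt.1 hcon⟩) (not_le.2 hs.2)).2
  linarith

end RatioOn

/-- The ratios of a solution with a critical point at (reversed) time `b`. -/
structure SeparatrixRatio (b : ℝ) (n m : ℝ → ℝ) : Prop extends RatioOn b n m where
  b_pos : 0 < b
  n_zero : n 0 = 0
  n_end : n b = 2 / 3
  m_end : m b = 0
  n_nonneg : ∀ t ∈ Ioo 0 b, 0 ≤ n t

namespace SeparatrixRatio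

variable {b b₁ b₂ : ℝ} {n m n₁ m₁ n₂ m₂ : ℝ → ℝ}

/-- The region n ≥ 2/3 is forward invariant and n increases strictly in it, so a trajectory that
enters it early cannot end at n = 2/3. -/
theorem n_lt (h : SeparatrixRatio b n m) : ∀ t ∈ Ico 0 b, n t < 2 / 3 := by
  intro t ht
  by_contra hcon
  push Not at hcon
  have hcn := h.cn
  have hge : ∀ s ∈ Ico t b, 0 ≤ 3 * n s - 2 := fun s hs => by
    have hsub : Icc t s ⊆ Icc 0 b := Icc_subset_Icc ht.1 hs.2.le
    have hsubn := hcn.mono hsub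
    refine nonneg_of_linear_ineq (f := fun s => 3 * n s - 2) (A := fun s => 3 * m s)
      (d := fun s => 3 * n s / m s) hs.1 (by fun_prop)
      (ContinuousOn.div (by fun_prop) (h.cm.mono hsub) fun r hr =>
        (h.m_pos r ⟨ht.1.trans hr.1, hr.2.trans_lt hs.2⟩).ne') (fun r hr => ?_) (fun r hr => ?_)
      (by linarith)
    · refine (((h.hn r ⟨ht.1.trans_lt hr.1, hr.2.trans hs.2⟩).const_mul 3).sub_const 2).congr_deriv
        ?_
      ring
    · have := h.m_pos r ⟨(ht.1.trans_lt hr.1).le, hr.2.trans hs.2⟩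
      positivity
  have hmono : StrictMonoOn n (Icc t b) := by
    refine strictMonoOn_of_deriv_pos (convex_Icc _ _) (hcn.mono (Icc_subset_Icc_left ht.1))
      fun s hs => ?_
    rw [interior_Icc] at hs
    have hs' : s ∈ Ioo 0 b := ⟨ht.1.trans_lt hs.1, hs.2⟩
    rw [(h.hn s hs').deriv]
    have h1 := h.m_pos s (Ioo_subset_Ico_self hs')
    have h2 := hge s (Ioo_subset_Ico_self hs)
    have h3 := h.n_nonneg s hs'
    positivity
  have := hmono (left_mem_Icc.2 ht.2.le) (right_mem_Icc.2 ht.2.le) ht.2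
  rw [h.n_end] at this
  linarith

theorem n_mem (h : SeparatrixRatio b n m) : ∀ t ∈ Ioo 0 b, 0 ≤ n t ∧ n t ≤ 2 / 3 := fun t ht =>
  ⟨h.n_nonneg t ht, (h.n_lt t (Ioo_subset_Ico_self ht)).le⟩

/-- If the first trajectory ends first, the persistent gap contradicts m₁(b₁) = 0. If the second
ends first, then n₁ > n₂ = 2/3 at b₂, which is excluded before the end. -/
theorem not_lt (h₁ : SeparatrixRatio b₁ n₁ m₁) (h₂ : SeparatrixRatio b₂ n₂ m₂) :
    ¬ m₂ 0 < m₁ 0 := by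
  intro hlt
  have h0 : n₁ 0 = n₂ 0 := by rw [h₁.n_zero, h₂.n_zero]
  rcases le_or_gt b₁ b₂ with hb | hb
  · have hge : ∀ t ∈ Ioo 0 b₁, m₁ 0 - m₂ 0 ≤ m₁ t := fun t ht => by
      have h3 := ((h₁.toRatioOn.mono ht.2.le).comparison (h₂.toRatioOn.mono (ht.2.le.trans hb)) ht.1
        h0 hlt (Or.inl ⟨h₁.m_pos t (Ioo_subset_Ico_self ht), fun s hs =>
          h₂.n_mem s ⟨hs.1, hs.2.trans (ht.2.trans_le hb)⟩⟩)).2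
      have h4 := h₂.m_pos t ⟨ht.1.le, ht.2.trans_le hb⟩
      linarith
    have htend : Tendsto m₁ (𝓝[<] b₁) (𝓝 (m₁ b₁)) :=
      (h₁.cm b₁ (right_mem_Icc.2 h₁.b_pos.le)).tendsto.mono_left
        (nhdsWithin_le_of_mem (Icc_mem_nhdsLT h₁.b_pos))
    have := ge_of_tendsto htend (mem_of_superset (Ioo_mem_nhdsLT h₁.b_pos) hge)
    rw [h₁.m_end] at this
    linarith
  · have := ((h₁.toRatioOn.mono hb.le).comparison h₂.toRatioOn h₂.b_pos h0 hlt
      (Or.inl ⟨h₁.m_pos b₂ ⟨h₂.b_pos.le, hb⟩, h₂.n_mem⟩)).1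
    rw [h₂.n_end] at this
    linarith [h₁.n_lt b₂ ⟨h₂.b_pos.le, hb⟩]

theorem m_zero_eq (h₁ : SeparatrixRatio b₁ n₁ m₁) (h₂ : SeparatrixRatio b₂ n₂ m₂) :
    m₁ 0 = m₂ 0 :=
  le_antisymm (_root_.not_lt.1 (h₁.not_lt h₂)) (_root_.not_lt.1 (h₂.not_lt h₁))

end SeparatrixRatio

/-! ### Zeros of x, and the ratios of a solution -/

namespace SystemOn

variable {x u w w' : ℝ → ℝ}

/-- If x stayed negative, w u² would be nondecreasing. A small u then makes w larger than -x, so u'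
≥ 0; thus u stays above a positive constant and x reaches 0 in finite time. -/
theorem exists_x_nonneg (h : SystemOn univ x u w w') {a : ℝ} (hu : ∀ t > a, 0 < u t)
    (hw : ∀ t > a, 0 < w t) : ∃ t > a, 0 ≤ x t := by
  by_contra hcon
  push Not at hcon
  set t₀ := a + 1 with ht₀
  have hgt : ∀ {t}, t₀ ≤ t → a < t := fun ht => by linarith
  have hxc := h.continuous_x
  have huc := h.continuous_u
  have hwc := h.continuous_w
  have hv : ∀ t ≥ t₀, w t₀ * u t₀ ^ 2 ≤ w t * u t ^ 2 := fun t ht =>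
    le_of_hasDerivAt_nonneg (f := fun t => w t * u t ^ 2) ht (by fun_prop)
      (fun s _ => h.hasDerivAt_v (mem_univ s)) fun s hs => by
        have h1 := hu s (hgt hs.1.le)
        have h2 := hw s (hgt hs.1.le)
        have h3 := hcon s (hgt hs.1.le)
        have := mul_pos (mul_pos (neg_pos.2 h3) h1) h2
        linarith
  have hx : ∀ t ≥ t₀, x t₀ ≤ x t := fun t ht =>
    le_of_hasDerivAt_nonneg ht hxc.continuousOn (fun s _ => h.hx s trivial) fun s hs =>
      (hu s (hgt hs.1.le)).le
  have hX : 0 < -x t₀ := neg_pos.2 (hcon t₀ (hgt le_rfl))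
  have hu₀ := hu t₀ (hgt le_rfl)
  have hv₀ : 0 < w t₀ * u t₀ ^ 2 := mul_pos (hw t₀ (hgt le_rfl)) (by positivity)
  -- For u ≤ c one has w ≥ w(t₀)u(t₀)²/c² ≥ -x(t₀) ≥ -x, hence u' = x + w ≥ 0.
  set c := min (u t₀) (Real.sqrt (w t₀ * u t₀ ^ 2 / -x t₀)) with hc
  have hcpos : 0 < c := lt_min hu₀ (Real.sqrt_pos.2 (div_pos hv₀ hX))
  have hcsq : c ^ 2 * -x t₀ ≤ w t₀ * u t₀ ^ 2 := by
    have h1 : c ^ 2 ≤ w t₀ * u t₀ ^ 2 / -x t₀ := by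
      rw [← Real.sq_sqrt (div_pos hv₀ hX).le]
      exact pow_le_pow_left₀ hcpos.le (min_le_right _ _) 2
    rwa [le_div_iff₀ hX] at h1
  have huge : ∀ t ≥ t₀, c ≤ u t := fun t ht => by
    have := le_of_deriv_nonpos_above (f := fun t => -u t) (K := -c) ht (by fun_prop)
      (fun s _ => (h.hu s trivial).fun_neg) (fun s hs hsK => ?_) (neg_le_neg (min_le_left _ _))
    · linarith
    · have h1 := hu s (hgt hs.1.le)
      have h2 := hv s hs.1.le
      have h3 : u s ^ 2 ≤ c ^ 2 := pow_le_pow_left₀ h1.le (by linarith) 2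
      have h4 : u s ^ 2 * -x t₀ ≤ u s ^ 2 * w s := by nlinarith
      have h5 := le_of_mul_le_mul_left h4 (by positivity)
      have h6 := hx s hs.1.le
      linarith
  have hT : t₀ ≤ t₀ + -x t₀ / c := by
    have := div_pos hX hcpos
    linarith
  have hfin := le_of_hasDerivAt_nonneg (f := fun t => x t - c * t) hT (by fun_prop)
    (fun s _ => (h.hx s trivial).sub ((hasDerivAt_id s).const_mul c)) fun s hs => by
      have := huge s hs.1.le
      linarith
  have h2 : c * (-x t₀ / c) = -x t₀ := by field_simp
  have h3 := hcon _ (hgt hT)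
  nlinarith

/-- If x > 0 everywhere, then backwards from 0 the quantity w u² grows while u decreases, so w ≥
w(0). Then u' ≥ w(0) drives u to 0 within time u(0)/w(0). -/
theorem exists_x_nonpos (h : SystemOn univ x u w w') (hu : ∀ t, 0 < u t)
    (hw : ∀ t, 0 < w t) : ∃ t, x t ≤ 0 := by
  by_contra hcon
  push Not at hcon
  have hxc := h.continuous_x
  have huc := h.continuous_u
  have hwc := h.continuous_w
  have hv : ∀ t ≤ 0, w 0 * u 0 ^ 2 ≤ w t * u t ^ 2 := fun t ht => by
    have := le_of_hasDerivAt_nonneg (f := fun t => -(w t * u t ^ 2)) ht (by fun_prop)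
      (fun s _ => (h.hasDerivAt_v (mem_univ s)).fun_neg) fun s hs => by
        have h1 := hu s
        have h2 := hw s
        have h3 := hcon s
        have := mul_pos (mul_pos h3 h1) h2
        linarith
    linarith
  have hule : ∀ t ≤ 0, u t ≤ u 0 := fun t ht =>
    le_of_hasDerivAt_nonneg ht huc.continuousOn (fun s _ => h.hu s trivial) fun s _ =>
      (add_pos (hcon s) (hw s)).le
  have hwge : ∀ t ≤ 0, w 0 ≤ w t := fun t ht => by
    have h1 := hv t ht
    have h2 : u t ^ 2 ≤ u 0 ^ 2 := pow_le_pow_left₀ (hu t).le (hule t ht) 2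
    have h3 : 0 < u 0 ^ 2 := pow_pos (hu 0) 2
    have h4 := hw t
    nlinarith
  have hT : -(u 0 / w 0) ≤ 0 := neg_nonpos.2 (div_pos (hu 0) (hw 0)).le
  have hfin := le_of_hasDerivAt_nonneg (f := fun t => u t - w 0 * t) hT (by fun_prop)
    (fun s _ => (h.hu s trivial).sub ((hasDerivAt_id s).const_mul (w 0))) fun s hs => by
      have := hwge s hs.2.le
      have := hcon s
      linarith
  have h2 : w 0 * (u 0 / w 0) = u 0 := by have := (hw 0).ne'; field_simp
  have h3 := hu (-(u 0 / w 0))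
  nlinarith

theorem hasDerivAt_m (h : SystemOn univ x u w w') {t : ℝ} (hw : w (-t) ≠ 0) :
    HasDerivAt (fun t => u (-t) / w (-t)) (4 * (-x (-t) / w (-t)) - 3) t := by
  have h' := h.comp_neg_univ
  refine ((h'.hu t trivial).fun_neg.div (h'.hw t trivial) hw).congr_deriv ?_ |>.congr_of_eventuallyEq
    (Eventually.of_forall fun s => by simp)
  have := h.eqn (-t) trivial
  field_simp
  linear_combination this

theorem hasDerivAt_n (h : SystemOn univ x u w w') {t : ℝ} (hw : w (-t) ≠ 0) (hu : u (-t) ≠ 0) :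
    HasDerivAt (fun t => -x (-t) / w (-t)) (u (-t) / w (-t) +
      -x (-t) / w (-t) * (3 * (-x (-t) / w (-t)) - 2) / (u (-t) / w (-t))) t := by
  have h' := h.comp_neg_univ
  refine ((h'.hx t trivial).fun_neg.div (h'.hw t trivial) hw).congr_deriv ?_
  have := h.eqn (-t) trivial
  field_simp
  linear_combination (-x (-t)) * this

theorem ratioOn (h : SystemOn univ x u w w') (hw : ∀ t, w t ≠ 0) {b : ℝ}
    (hu : ∀ t ∈ Ico 0 b, 0 < u (-t) / w (-t)) :
    RatioOn b (fun t => -x (-t) / w (-t)) (fun t => u (-t) / w (-t)) := by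
  have hxc := h.continuous_x
  have huc := h.continuous_u
  have hwc := h.continuous_w
  refine ⟨ContinuousOn.div (by fun_prop) (by fun_prop) fun t _ => hw _,
    ContinuousOn.div (by fun_prop) (by fun_prop) fun t _ => hw _, hu,
    fun t _ => h.hasDerivAt_m (hw _), fun t ht => h.hasDerivAt_n (hw _) fun h0 => ?_⟩
  have := hu t (Ioo_subset_Ico_self ht)
  simp [h0] at this

end SystemOn

/-! ### Power series with geometrically bounded coefficients -/

section PowerSeries

variable {a : ℕ → ℝ} {ρ y : ℝ}

theorem abs_lt_of_mem_ball_inv (hρ : 0 < ρ) (hy : y ∈ Metric.ball (0 : ℝ) (1 / (2 * ρ))) :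
    ρ * |y| < 1 / 2 := by
  rw [mem_ball_zero_iff, Real.norm_eq_abs, lt_div_iff₀ (by positivity)] at hy
  linarith

theorem summable_norm_mul_pow (hρ : 0 < ρ) (ha : ∀ k, |a k| ≤ ρ ^ k)
    (hy : y ∈ Metric.ball (0 : ℝ) (1 / (2 * ρ))) : Summable fun k => ‖a k * y ^ k‖ := by
  refine Summable.of_nonneg_of_le (fun _ => norm_nonneg _) (fun k => ?_)
    (summable_geometric_of_lt_one (by norm_num : (0 : ℝ) ≤ 1 / 2) (by norm_num))
  rw [Real.norm_eq_abs, abs_mul, abs_pow]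
  calc |a k| * |y| ^ k ≤ ρ ^ k * |y| ^ k := by gcongr; exact ha k
    _ = (ρ * |y|) ^ k := (mul_pow _ _ _).symm
    _ ≤ (1 / 2) ^ k := by gcongr; exact (abs_lt_of_mem_ball_inv hρ hy).le

theorem hasDerivAt_tsum_mul_pow (hρ : 0 < ρ) (ha : ∀ k, |a k| ≤ ρ ^ k)
    (hy : y ∈ Metric.ball (0 : ℝ) (1 / (2 * ρ))) :
    (Summable fun k : ℕ => a k * (k * y ^ (k - 1))) ∧
    HasDerivAt (fun z => ∑' k, a k * z ^ k) (∑' k : ℕ, a k * (k * y ^ (k - 1))) y := by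
  have hu : Summable fun k : ℕ => 2 * ρ * ((k : ℝ) ^ 1 * (1 / 2 : ℝ) ^ k) :=
    (summable_pow_mul_geometric_of_norm_lt_one (R := ℝ) 1 (r := 1 / 2)
      (by rw [Real.norm_eq_abs, abs_of_pos] <;> norm_num)).mul_left (2 * ρ)
  have hb : ∀ (k : ℕ), ∀ z ∈ Metric.ball (0 : ℝ) (1 / (2 * ρ)),
      ‖a k * (k * z ^ (k - 1))‖ ≤ 2 * ρ * ((k : ℝ) ^ 1 * (1 / 2 : ℝ) ^ k) := fun k z hz => by
    rcases k with _ | k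
    · simp
    rw [Real.norm_eq_abs, abs_mul, abs_mul, abs_pow, Nat.abs_cast, Nat.add_sub_cancel]
    have h1 : (ρ * |z|) ^ k ≤ (1 / 2) ^ k := by gcongr; exact (abs_lt_of_mem_ball_inv hρ hz).le
    calc |a (k + 1)| * (((k + 1 : ℕ) : ℝ) * |z| ^ k)
        ≤ ρ ^ (k + 1) * (((k + 1 : ℕ) : ℝ) * |z| ^ k) := by gcongr; exact ha _
      _ = ρ * (((k + 1 : ℕ) : ℝ) * (ρ * |z|) ^ k) := by rw [mul_pow]; ring
      _ ≤ ρ * (((k + 1 : ℕ) : ℝ) * (1 / 2) ^ k) := by gcongr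
      _ = _ := by rw [pow_succ]; ring
  have h0 : (0 : ℝ) ∈ Metric.ball (0 : ℝ) (1 / (2 * ρ)) := Metric.mem_ball_self (by positivity)
  have hs : Summable fun k : ℕ => a k * (k * y ^ (k - 1)) :=
    Summable.of_norm_bounded hu fun k => hb k y hy
  refine ⟨hs, ?_⟩
  exact hasDerivAt_tsum_of_isPreconnected hu Metric.isOpen_ball
    (convex_ball (0 : ℝ) _).isPreconnected (fun k z _ => (hasDerivAt_pow k z).const_mul (a k)) hb h0
    (summable_norm_mul_pow hρ ha h0).of_norm hy

theorem hasSum_mul_deriv (hρ : 0 < ρ) (ha : ∀ k, |a k| ≤ ρ ^ k)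
    (hy : y ∈ Metric.ball (0 : ℝ) (1 / (2 * ρ))) :
    HasSum (fun k : ℕ => k * a k * y ^ k) (y * deriv (fun z => ∑' k, a k * z ^ k) y) := by
  obtain ⟨hs, hd⟩ := hasDerivAt_tsum_mul_pow hρ ha hy
  rw [hd.deriv]
  have heq : (fun k : ℕ => k * a k * y ^ k) = fun k : ℕ => y * (a k * (k * y ^ (k - 1))) := by
    funext k
    rcases k with _ | k
    · simp
    · rw [Nat.add_sub_cancel, pow_succ]
      ring
  rw [heq]
  exact hs.hasSum.mul_left y

theorem contDiffAt_tsum_mul_pow (hρ : 0 < ρ) (ha : ∀ k, |a k| ≤ ρ ^ k)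
    (hy : y ∈ Metric.ball (0 : ℝ) (1 / (2 * ρ))) :
    ContDiffAt ℝ ∞ (fun z => ∑' k, a k * z ^ k) y := by
  set p := FormalMultilinearSeries.ofScalars ℝ a
  have hr : ENNReal.ofNNReal (1 / ρ).toNNReal ≤ p.radius := by
    refine p.le_radius_of_bound 1 fun n => ?_
    rw [FormalMultilinearSeries.ofScalars_norm, Real.coe_toNNReal _ (by positivity),
      Real.norm_eq_abs, one_div, inv_pow]
    exact (mul_inv_le_iff₀ (by positivity)).2 (by simpa using ha n)
  have hpos : 0 < p.radius := lt_of_lt_of_le (by simpa using hρ) hr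
  have hps := p.hasFPowerSeriesOnBall hpos
  have heq : p.sum = fun z => ∑' k, a k * z ^ k := by
    have := FormalMultilinearSeries.ofScalarsSum_eq_tsum (E := ℝ) a
    simpa [FormalMultilinearSeries.ofScalarsSum] using this
  rw [heq] at hps
  have hmem : y ∈ Metric.eball (0 : ℝ) p.radius := by
    refine Metric.eball_subset_eball hr ?_
    rw [Metric.mem_eball, edist_zero_right, ← ofReal_norm, ENNReal.ofReal]
    rw [ENNReal.coe_lt_coe, Real.toNNReal_lt_toNNReal_iff (by positivity)]
    rw [mem_ball_zero_iff] at hy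
    refine hy.trans ?_
    rw [one_div_lt_one_div (by positivity) hρ]
    linarith
  exact (hps.analyticAt_of_mem hmem).contDiffAt

end PowerSeries

/-! ### The invariant curve through the saddle point -/

/-- Taylor coefficients of the invariant curve through the saddle point at infinity. -/
noncomputable def sepCoeff : ℕ → ℝ
  | 0 => 3 / 8
  | n + 1 => -(3 * (4 * n + 5) / (2 * n + 10)) * ∑ i : Fin n.succ, sepCoeff i * sepCoeff (n - i)

theorem sepCoeff_succ (n : ℕ) : sepCoeff (n + 1) = -(3 * (4 * n + 5) / (2 * n + 10)) *
    ∑ ij ∈ Finset.HasAntidiagonal.antidiagonal n, sepCoeff ij.1 * sepCoeff ij.2 := by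
  rw [sepCoeff, Finset.Nat.sum_antidiagonal_eq_sum_range_succ (fun x y => sepCoeff x * sepCoeff y) n,
    Finset.sum_range]

/-- The factor in the recursion is at most 6, and the recursion with constant factor 6 and first
term 3/8 is solved by rescaled Catalan numbers. -/
theorem abs_sepCoeff_le_catalan (n : ℕ) :
    |sepCoeff n| ≤ 6 ^ n * (3 / 8) ^ (n + 1) * catalan n := by
  induction n using Nat.strong_induction_on with
  | _ n ih =>
    rcases n with _ | n
    · rw [sepCoeff]; norm_num [abs_of_pos]
    rw [sepCoeff_succ, catalan_succ', abs_mul, abs_neg, abs_of_nonneg (by positivity)]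
    have h1 : 3 * (4 * (n : ℝ) + 5) / (2 * n + 10) ≤ 6 := by
      rw [div_le_iff₀ (by positivity)]
      linarith
    have h2 : |∑ ij ∈ Finset.HasAntidiagonal.antidiagonal n, sepCoeff ij.1 * sepCoeff ij.2| ≤
        ∑ ij ∈ Finset.HasAntidiagonal.antidiagonal n, 6 ^ n * (3 / 8) ^ (n + 2) *
          ((catalan ij.1 : ℝ) * catalan ij.2) := by
      refine (Finset.abs_sum_le_sum_abs _ _).trans (Finset.sum_le_sum fun ij hij => ?_)
      rw [Finset.HasAntidiagonal.mem_antidiagonal] at hij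
      rw [abs_mul]
      refine (mul_le_mul (ih ij.1 (by omega)) (ih ij.2 (by omega)) (abs_nonneg _)
        (by positivity)).trans_eq ?_
      rw [← hij]
      ring
    rw [← Finset.mul_sum] at h2
    push_cast
    calc _ ≤ 6 * (6 ^ n * (3 / 8) ^ (n + 2) *
          ∑ ij ∈ Finset.HasAntidiagonal.antidiagonal n, (catalan ij.1 : ℝ) * catalan ij.2) :=
          mul_le_mul h1 h2 (abs_nonneg _) (by norm_num)
      _ = _ := by ring

theorem abs_sepCoeff_le (n : ℕ) : |sepCoeff n| ≤ 9 ^ n := by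
  have h1 : (catalan n : ℝ) ≤ 4 ^ n := by
    have h2 := succ_mul_catalan_eq_centralBinom n
    have h3 := Nat.centralBinom_le_four_pow n
    have h4 : catalan n ≤ (n + 1) * catalan n := Nat.le_mul_of_pos_left _ (by omega)
    exact_mod_cast (h4.trans_eq h2).trans h3
  calc |sepCoeff n| ≤ 6 ^ n * (3 / 8) ^ (n + 1) * catalan n := abs_sepCoeff_le_catalan n
    _ ≤ 6 ^ n * (3 / 8) ^ (n + 1) * 4 ^ n := by gcongr
    _ = 3 / 8 * (6 * (3 / 8) * 4) ^ n := by rw [mul_pow, mul_pow, pow_succ]; ring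
    _ = 3 / 8 * 9 ^ n := by norm_num
    _ ≤ 9 ^ n := by linarith [pow_nonneg (by norm_num : (0 : ℝ) ≤ 9) n]

noncomputable def sepSeries (y : ℝ) : ℝ := ∑' k, sepCoeff k * y ^ k

theorem sepSeries_zero : sepSeries 0 = 3 / 8 := by
  rw [sepSeries, tsum_eq_single 0 (fun k hk => by simp [hk])]
  simp [sepCoeff]

theorem sepSeries_contDiffAt {y : ℝ} (hy : y ∈ Metric.ball (0 : ℝ) (1 / 36)) :
    ContDiffAt ℝ ∞ sepSeries y :=
  contDiffAt_tsum_mul_pow (ρ := 9) (by norm_num) abs_sepCoeff_le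
    (Metric.ball_subset_ball (by norm_num) hy)

/-- This is the condition that n = 2/3 - m² φ(m²) be invariant under the flow of (n, m), with y =
m². The coefficient of y^(n+1) on the left is multiplied by (2n + 10)/3, which is never zero, so
there is no resonance. -/
theorem sepSeries_ode {y : ℝ} (hy : y ∈ Metric.ball (0 : ℝ) (1 / 36)) :
    2 / 3 * (y * deriv sepSeries y) + 8 / 3 * sepSeries y =
      1 - 5 * y * sepSeries y ^ 2 - 8 * y ^ 2 * sepSeries y * deriv sepSeries y := by
  set c : ℕ → ℝ := fun n => ∑ ij ∈ Finset.HasAntidiagonal.antidiagonal n, sepCoeff ij.1 * sepCoeff ij.2 with hc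
  -- The Cauchy square has n + 1 terms of size at most 9^n, and n + 1 ≤ 2^n. This costs half of the
  -- radius, hence 1/36 = 1/(2·18).
  have hbc : ∀ n, |c n| ≤ 18 ^ n := fun n => by
    calc |c n| ≤ ∑ ij ∈ Finset.HasAntidiagonal.antidiagonal n, |sepCoeff ij.1 * sepCoeff ij.2| :=
          Finset.abs_sum_le_sum_abs _ _
      _ ≤ ∑ ij ∈ Finset.HasAntidiagonal.antidiagonal n, (9 : ℝ) ^ n := Finset.sum_le_sum fun ij hij => by
          rw [Finset.HasAntidiagonal.mem_antidiagonal] at hij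
          rw [abs_mul, ← hij, pow_add]
          exact mul_le_mul (abs_sepCoeff_le _) (abs_sepCoeff_le _) (abs_nonneg _) (by positivity)
      _ = (n + 1 : ℕ) * (9 : ℝ) ^ n := by simp
      _ ≤ 2 ^ n * 9 ^ n := by
          gcongr
          exact_mod_cast Nat.lt_two_pow_self
      _ = 18 ^ n := by rw [← mul_pow]; norm_num
  have hsub : Metric.ball (0 : ℝ) (1 / 36) ⊆ Metric.ball (0 : ℝ) (1 / (2 * 9)) :=
    Metric.ball_subset_ball (by norm_num)
  have hball : Metric.ball (0 : ℝ) (1 / 36) = Metric.ball (0 : ℝ) (1 / (2 * 18)) := by norm_num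
  have hsq : ∀ z ∈ Metric.ball (0 : ℝ) (1 / 36), ∑' k, c k * z ^ k = sepSeries z ^ 2 :=
    fun z hz => by
      have hs := summable_norm_mul_pow (by norm_num) abs_sepCoeff_le (hsub hz)
      rw [sq, sepSeries, tsum_mul_tsum_eq_tsum_sum_antidiagonal_of_summable_norm hs hs]
      refine tsum_congr fun n => ?_
      rw [hc, Finset.sum_mul]
      refine Finset.sum_congr rfl fun ij hij => ?_
      rw [Finset.HasAntidiagonal.mem_antidiagonal] at hij
      rw [← hij, pow_add]
      ring
  have hdiff : HasDerivAt sepSeries (deriv sepSeries y) y :=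
    ((sepSeries_contDiffAt hy).differentiableAt (by simp)).hasDerivAt
  have hdsq : deriv (fun z => ∑' k, c k * z ^ k) y = 2 * sepSeries y * deriv sepSeries y := by
    have heq : (fun z => ∑' k, c k * z ^ k) =ᶠ[𝓝 y] fun z => sepSeries z ^ 2 :=
      mem_of_superset (Metric.isOpen_ball.mem_nhds hy) hsq
    rw [heq.deriv_eq, (hdiff.fun_pow 2).deriv]
    push_cast
    ring
  have h1 := hasSum_mul_deriv (by norm_num) abs_sepCoeff_le (hsub hy)
  have h2 := (summable_norm_mul_pow (by norm_num) abs_sepCoeff_le (hsub hy)).of_norm.hasSum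
  have h3 := hasSum_mul_deriv (by norm_num) hbc (hball ▸ hy)
  have h4 := (summable_norm_mul_pow (by norm_num) hbc (hball ▸ hy)).of_norm.hasSum
  rw [hsq y hy] at h4
  rw [hdsq] at h3
  change HasSum _ (y * deriv sepSeries y) at h1
  change HasSum _ (sepSeries y) at h2
  have hL := (h1.mul_left (2 / 3)).add (h2.mul_left (8 / 3))
  -- 8y²φφ' + 5yφ² is written as y(4·y(φ²)' + 5φ²), so that only the coefficients of φ² occur.
  have hR := ((h3.mul_left 4).add (h4.mul_left 5)).mul_left (-y)
  have hL' := (hasSum_nat_add_iff' 1).2 hL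
  have heq : ∀ n : ℕ, 2 / 3 * (((n + 1 : ℕ) : ℝ) * sepCoeff (n + 1) * y ^ (n + 1)) +
      8 / 3 * (sepCoeff (n + 1) * y ^ (n + 1)) =
      -y * (4 * (n * c n * y ^ n) + 5 * (c n * y ^ n)) := fun n => by
    rw [sepCoeff_succ, pow_succ]
    simp only [hc]
    push_cast
    field_simp
    ring
  have hR' := hR
  rw [← funext heq] at hR'
  have := hL'.unique hR'
  simp [sepCoeff] at this
  linear_combination this

/-! ### Global existence for the initial value problem -/

/-- The vector field for `p = x/u` and `r = w/u`. -/
def ratioField (z : ℝ × ℝ) : ℝ × ℝ := (1 - z.1 ^ 2 - z.1 * z.2, -z.2 * (4 * z.1 + 3 * z.2))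

/-- The vector field for `(x, u, w)`. -/
noncomputable def stateField (z : ℝ × ℝ × ℝ) : ℝ × ℝ × ℝ :=
  (z.2.1, z.1 + z.2.2, -z.2.2 * (3 * z.1 + 2 * z.2.2) / z.2.1)

theorem contDiff_ratioField : ContDiff ℝ 1 ratioField := by
  unfold ratioField
  fun_prop

theorem contDiffOn_stateField :
    ContDiffOn ℝ ∞ (fun y : ℝ × ℝ × ℝ × ℝ => stateField y.2) {y | y.2.2.1 ≠ 0} := by
  unfold stateField
  refine ContDiffOn.prodMk (by fun_prop) (ContDiffOn.prodMk (by fun_prop) ?_)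
  exact ContDiffOn.div (by fun_prop) (by fun_prop) fun y hy => hy

theorem norm_le_of_bounds {z : ℝ × ℝ} {C : ℝ} (h1 : |z.1| ≤ C) (h2 : |z.2| ≤ C) : ‖z‖ ≤ C := by
  rw [Prod.norm_def]
  exact max_le h1 h2

section Components

variable {E F : Type*} [NormedAddCommGroup E] [NormedSpace ℝ E] [NormedAddCommGroup F]
  [NormedSpace ℝ F] {f : ℝ → E × F} {f' : E × F} {t : ℝ} {s : Set ℝ}

theorem HasDerivWithinAt.fst_comp (h : HasDerivWithinAt f f' s t) :
    HasDerivWithinAt (fun t => (f t).1) f'.1 s t :=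
  (ContinuousLinearMap.fst ℝ E F).hasFDerivAt.comp_hasDerivWithinAt t h

theorem HasDerivWithinAt.snd_comp (h : HasDerivWithinAt f f' s t) :
    HasDerivWithinAt (fun t => (f t).2) f'.2 s t :=
  (ContinuousLinearMap.snd ℝ E F).hasFDerivAt.comp_hasDerivWithinAt t h

theorem HasDerivAt.fst_comp (h : HasDerivAt f f' t) : HasDerivAt (fun t => (f t).1) f'.1 t :=
  (ContinuousLinearMap.fst ℝ E F).hasFDerivAt.comp_hasDerivAt t h

theorem HasDerivAt.snd_comp (h : HasDerivAt f f' t) : HasDerivAt (fun t => (f t).2) f'.2 t :=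
  (ContinuousLinearMap.snd ℝ E F).hasFDerivAt.comp_hasDerivAt t h

end Components

theorem hasDerivWithinAt_glue {E : Type*} [NormedAddCommGroup E] [NormedSpace ℝ E]
    {f g : ℝ → E} {F : E → E} {S : Set ℝ} {c t : ℝ} (hfg : f c = g c)
    (hf : t ≤ c → HasDerivWithinAt f (F (f t)) (S ∩ Iic c) t)
    (hg : c ≤ t → HasDerivWithinAt g (F (g t)) (S ∩ Ici c) t) :
    HasDerivWithinAt (fun t => if t ≤ c then f t else g t)
      (F (if t ≤ c then f t else g t)) S t := by
  have hL : ∀ s ∈ S ∩ Iic c, (if s ≤ c then f s else g s) = f s := fun s hs => if_pos hs.2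
  have hR : ∀ s ∈ S ∩ Ici c, (if s ≤ c then f s else g s) = g s := fun s hs => by
    rcases eq_or_lt_of_le (show c ≤ s from hs.2) with h | h
    · rw [← h, if_pos le_rfl, hfg]
    · exact if_neg (not_le.2 h)
  rcases lt_trichotomy t c with h | h | h
  · rw [if_pos h.le]
    refine ((hf h.le).congr hL (if_pos h.le)).mono_of_mem_nhdsWithin ?_
    exact inter_mem self_mem_nhdsWithin (mem_nhdsWithin_of_mem_nhds (Iic_mem_nhds h))
  · subst h
    have h1 := (hf le_rfl).congr hL (if_pos le_rfl)
    have h2 := (hg le_rfl).congr hR (by rw [if_pos le_rfl, hfg])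
    rw [← hfg] at h2
    have := h1.union h2
    rw [← inter_union_distrib_left, Iic_union_Ici, inter_univ] at this
    rwa [if_pos le_rfl]
  · rw [if_neg (not_le.2 h)]
    refine ((hg h.le).congr hR (if_neg (not_le.2 h))).mono_of_mem_nhdsWithin ?_
    exact inter_mem self_mem_nhdsWithin (mem_nhdsWithin_of_mem_nhds (Ici_mem_nhds h))

theorem HasDerivWithinAt.comp_sub_const_Ici {E : Type*} [NormedAddCommGroup E] [NormedSpace ℝ E]
    {f : ℝ → E} {f' : E} {c t : ℝ} (h : HasDerivWithinAt f f' (Ici 0) (t - c)) :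
    HasDerivWithinAt (fun t => f (t - c)) f' (Ici c) t := by
  have := h.scomp (h := fun t => t - c) t ((hasDerivWithinAt_id t (Ici c)).sub_const c)
    (fun s hs => by simpa using hs)
  simpa [Function.comp_def] using this

/-- Solutions for the ratios give solutions `(x, u, w)` with `u > 0`. -/
theorem exists_state_of_ratio {f : ℝ → ℝ × ℝ} (σ : ℝ)
    (hf : ∀ t ≥ 0, HasDerivWithinAt f (σ • ratioField (f t)) (Ici 0) t) {x₀ u₀ w₀ : ℝ}
    (hu₀ : 0 < u₀) (hf0 : f 0 = (x₀ / u₀, w₀ / u₀)) :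
    ∃ z : ℝ → ℝ × ℝ × ℝ, z 0 = (x₀, u₀, w₀) ∧ (∀ t, 0 < (z t).2.1) ∧
      ∀ t ≥ 0, HasDerivWithinAt z (σ • stateField (z t)) (Ici 0) t := by
  have hfc : ContinuousOn f (Ici 0) := fun t ht => (hf t ht).continuousWithinAt
  have hc : Continuous fun t => (f (max 0 t)).1 + (f (max 0 t)).2 := by
    have : Continuous fun t => f (max 0 t) :=
      hfc.comp_continuous (by fun_prop) fun t => mem_Ici.2 (le_max_left _ _)
    exact this.fst.add this.snd
  have hL : ∀ t, HasDerivAt (fun t => ∫ s in (0 : ℝ)..t, ((f (max 0 s)).1 + (f (max 0 s)).2))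
      ((f (max 0 t)).1 + (f (max 0 t)).2) t := fun t =>
    intervalIntegral.integral_hasDerivAt_right (hc.intervalIntegrable _ _)
      (hc.stronglyMeasurableAtFilter _ _) hc.continuousAt
  set L := fun t => ∫ s in (0 : ℝ)..t, ((f (max 0 s)).1 + (f (max 0 s)).2) with hLdef
  -- Since u'/u = (x + w)/u = p + r, the ratios determine u by one quadrature. The sign σ covers
  -- both directions of time.
  set u := fun t => u₀ * Real.exp (σ * L t) with hu
  have hupos : ∀ t, 0 < u t := fun t => mul_pos hu₀ (Real.exp_pos _)
  have hu' : ∀ t ≥ 0, HasDerivWithinAt u (σ * (((f t).1 + (f t).2) * u t)) (Ici 0) t :=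
    fun t ht => by
      have := hL t
      rw [max_eq_right ht] at this
      refine (((this.const_mul σ).exp).const_mul u₀).hasDerivWithinAt.congr_deriv ?_
      simp only [hu]
      ring
  refine ⟨fun t => ((f t).1 * u t, u t, (f t).2 * u t), ?_, hupos, fun t ht => ?_⟩
  · have hL0 : u 0 = u₀ := by simp [hu, hLdef]
    simp only [hL0, hf0]
    field_simp
  · have h1 := (hf t ht).fst_comp
    have h2 := (hf t ht).snd_comp
    have h3 := (hupos t).ne'
    refine ((h1.mul (hu' t ht)).prodMk ((hu' t ht).prodMk (h2.mul (hu' t ht)))).congr_deriv ?_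
    simp only [stateField, ratioField, Prod.smul_mk, smul_eq_mul, Prod.mk.injEq]
    refine ⟨by ring, by ring, ?_⟩
    field_simp
    ring

/-- The region p ≤ 1, r > 0, 3p + 2r ≥ 0 is forward invariant, and in it r decreases because 4p + 3r
> 0. So the solution remains in a bounded set. -/
theorem exists_forward_ratio {p₀ r₀ : ℝ} (hp : p₀ ≤ 1) (hr : 0 < r₀) (hG : 0 ≤ 3 * p₀ + 2 * r₀) :
    ∃ f : ℝ → ℝ × ℝ, f 0 = (p₀, r₀) ∧
      ∀ t ≥ 0, HasDerivWithinAt f (ratioField (f t)) (Ici 0) t := by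
  refine exists_forward_solution contDiff_ratioField _ fun β _ => ⟨1 + r₀, fun b hb f hf0 hfc hf => ?_⟩
  have hcp : ContinuousOn (fun t => (f t).1) (Icc 0 b) := hfc.fst
  have hcr : ContinuousOn (fun t => (f t).2) (Icc 0 b) := hfc.snd
  have hp' : ∀ t ∈ Ioo 0 b, HasDerivAt (fun t => (f t).1)
      (1 - (f t).1 ^ 2 - (f t).1 * (f t).2) t := fun t ht => (hf t ht).fst_comp
  have hr' : ∀ t ∈ Ioo 0 b, HasDerivAt (fun t => (f t).2)
      (-(f t).2 * (4 * (f t).1 + 3 * (f t).2)) t := fun t ht => (hf t ht).snd_comp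
  have hsub : ∀ {t}, t ∈ Icc 0 b → Icc 0 t ⊆ Icc 0 b := fun ht => Icc_subset_Icc_right ht.2
  have hsubo : ∀ {t s}, t ∈ Icc 0 b → s ∈ Ioo 0 t → s ∈ Ioo 0 b := fun ht hs =>
    ⟨hs.1, hs.2.trans_le ht.2⟩
  have hrpos : ∀ t ∈ Icc 0 b, 0 < (f t).2 := fun t ht =>
    pos_of_linear_ineq (f := fun t => (f t).2) (A := fun _ => 0)
      (d := fun t => -(4 * (f t).1 + 3 * (f t).2)) ht.1 (hcr.mono (hsub ht))
      (ContinuousOn.mono (by fun_prop) (hsub ht))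
      (fun s hs => (hr' s (hsubo ht hs)).congr_deriv (by ring)) (fun _ _ => le_rfl)
      (by simpa [hf0] using hr)
  have hple : ∀ t ∈ Icc 0 b, 0 ≤ 1 - (f t).1 := fun t ht =>
    nonneg_of_linear_ineq (f := fun t => 1 - (f t).1) (A := fun t => (f t).2)
      (d := fun t => -(1 + (f t).1 + (f t).2)) ht.1 (ContinuousOn.mono (by fun_prop) (hsub ht))
      (ContinuousOn.mono (by fun_prop) (hsub ht))
      (fun s hs => ((hp' s (hsubo ht hs)).const_sub 1).congr_deriv (by ring))
      (fun s hs => (hrpos s (Ioo_subset_Icc_self (hsubo ht hs))).le) (by simpa [hf0] using hp)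
  have hGpos : ∀ t ∈ Icc 0 b, 0 ≤ 3 * (f t).1 + 2 * (f t).2 := fun t ht =>
    nonneg_of_linear_ineq (f := fun t => 3 * (f t).1 + 2 * (f t).2) (A := fun _ => 3)
      (d := fun t => -((f t).1 + 3 * (f t).2)) ht.1 (ContinuousOn.mono (by fun_prop) (hsub ht))
      (ContinuousOn.mono (by fun_prop) (hsub ht))
      (fun s hs => (((hp' s (hsubo ht hs)).const_mul 3).add
        ((hr' s (hsubo ht hs)).const_mul 2)).congr_deriv (by ring))
      (fun _ _ => by norm_num) (by simpa [hf0] using hG)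
  have hrle : (f b).2 ≤ r₀ := by
    have := le_of_hasDerivAt_nonneg (f := fun t => -(f t).2) hb.1.le (by fun_prop)
      (fun s hs => (hr' s hs).fun_neg) fun s hs => by
        have h1 := hrpos s (Ioo_subset_Icc_self hs)
        have h2 := hGpos s (Ioo_subset_Icc_self hs)
        have : 0 ≤ (f s).2 * (4 * (f s).1 + 3 * (f s).2) := mul_nonneg h1.le (by linarith)
        linarith
    simp only [hf0] at this
    linarith
  have hbm : b ∈ Icc 0 b := right_mem_Icc.2 hb.1.le
  have h1 := hrpos b hbm
  have h2 := hple b hbm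
  have h3 := hGpos b hbm
  exact norm_le_of_bounds (abs_le.2 ⟨by linarith, by linarith⟩) (abs_le.2 ⟨by linarith, by linarith⟩)

theorem exists_forward_state {x₀ u₀ w₀ : ℝ} (hu : 0 < u₀) (hw : 0 < w₀) (hx : x₀ ≤ u₀)
    (hG : 0 ≤ 3 * x₀ + 2 * w₀) :
    ∃ z : ℝ → ℝ × ℝ × ℝ, z 0 = (x₀, u₀, w₀) ∧ (∀ t, 0 < (z t).2.1) ∧
      ∀ t ≥ 0, HasDerivWithinAt z (stateField (z t)) (Ici 0) t := by
  obtain ⟨f, hf0, hf⟩ := exists_forward_ratio (p₀ := x₀ / u₀) (r₀ := w₀ / u₀)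
    ((div_le_one hu).2 hx) (div_pos hw hu) (by
      have : 3 * (x₀ / u₀) + 2 * (w₀ / u₀) = (3 * x₀ + 2 * w₀) / u₀ := by ring
      rw [this]
      positivity)
  simpa using exists_state_of_ratio 1 (by simpa using hf) hu hf0

/-- The ratios in reversed time, `P = -p` and `R = r`. -/
structure ReversedRatioOn (b : ℝ) (P R : ℝ → ℝ) : Prop where
  cP : ContinuousOn P (Icc 0 b)
  cR : ContinuousOn R (Icc 0 b)
  hP : ∀ t ∈ Ioo 0 b, HasDerivAt P (1 - P t ^ 2 + P t * R t) t
  hR : ∀ t ∈ Ioo 0 b, HasDerivAt R (R t * (3 * R t - 4 * P t)) t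
  P_zero : 0 ≤ P 0
  R_zero : 0 < R 0

namespace ReversedRatioOn

variable {b K : ℝ} {P R : ℝ → ℝ}

theorem mono (h : ReversedRatioOn b P R) {c : ℝ} (hc : c ≤ b) : ReversedRatioOn c P R :=
  ⟨h.cP.mono (Icc_subset_Icc_right hc), h.cR.mono (Icc_subset_Icc_right hc),
    fun t ht => h.hP t ⟨ht.1, ht.2.trans_le hc⟩, fun t ht => h.hR t ⟨ht.1, ht.2.trans_le hc⟩,
    h.P_zero, h.R_zero⟩

theorem P_nonneg (h : ReversedRatioOn b P R) (hb : 0 ≤ b) : 0 ≤ P b := by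
  have hP := h.cP
  have hR := h.cR
  exact nonneg_of_linear_ineq (A := fun _ => 1) (d := fun t => R t - P t) hb hP (by fun_prop)
    (fun t ht => (h.hP t ht).congr_deriv (by ring)) (fun _ _ => zero_le_one) h.P_zero

theorem R_pos (h : ReversedRatioOn b P R) (hb : 0 ≤ b) : 0 < R b := by
  have hP := h.cP
  have hR := h.cR
  exact pos_of_linear_ineq (A := fun _ => 0) (d := fun t => 3 * R t - 4 * P t) hb hR (by fun_prop)
    (fun t ht => (h.hR t ht).congr_deriv (by ring)) (fun _ _ => le_rfl) h.R_zero

theorem P_le (h : ReversedRatioOn b P R) (hb : 0 ≤ b) (hK : ∀ t ∈ Ioo 0 b, R t ≤ K)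
    (hP0 : P 0 ≤ K + 1) (hK0 : 0 ≤ K) : P b ≤ K + 1 := by
  refine le_of_deriv_nonpos_above hb h.cP h.hP (fun t ht hPt => ?_) hP0
  have := hK t ht
  nlinarith

/-- The region `3P > 2R` is invariant, and there `R` remains bounded. -/
theorem G_pos (h : ReversedRatioOn b P R) (hb : 0 ≤ b) (hG : 0 < 3 * P 0 - 2 * R 0) :
    0 < 3 * P b - 2 * R b := by
  have hP := h.cP
  have hR := h.cR
  exact pos_of_linear_ineq (f := fun t => 3 * P t - 2 * R t) (A := fun _ => 3)
    (d := fun t => 3 * R t - P t) hb (by fun_prop) (by fun_prop)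
    (fun t ht => (((h.hP t ht).const_mul 3).sub ((h.hR t ht).const_mul 2)).congr_deriv (by ring))
    (fun _ _ => by norm_num) hG

/-- With G = 3P - 2R one has G' = 3 + (3R - P)G. The exponent 7 is the one for which the remaining
linear factor is a multiple of G, so that (G/R⁷)' = (3 + 9G²)/R⁷ ≥ 0 irrespective of signs. -/
theorem G_div_mono (h : ReversedRatioOn b P R) (hb : 0 ≤ b) :
    (3 * P 0 - 2 * R 0) / R 0 ^ 7 ≤ (3 * P b - 2 * R b) / R b ^ 7 := by
  have hP := h.cP
  have hR := h.cR
  have hpos : ∀ t ∈ Icc 0 b, 0 < R t := fun t ht => (h.mono ht.2).R_pos ht.1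
  refine le_of_hasDerivAt_nonneg (f := fun t => (3 * P t - 2 * R t) / R t ^ 7)
    (f' := fun t => (3 + 9 * (3 * P t - 2 * R t) ^ 2) / R t ^ 7) hb
    (ContinuousOn.div (by fun_prop) (by fun_prop) fun t ht => (pow_pos (hpos t ht) 7).ne')
    (fun t ht => ?_) fun t ht => ?_
  · have h1 := (hpos t (Ioo_subset_Icc_self ht)).ne'
    refine ((((h.hP t ht).const_mul 3).fun_sub ((h.hR t ht).const_mul 2)).div ((h.hR t ht).fun_pow 7)
      (pow_ne_zero 7 h1)).congr_deriv ?_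
    field_simp
    push_cast
    ring
  · have h1 := hpos t (Ioo_subset_Icc_self ht)
    positivity

/-- Monotonicity gives G ≥ c R⁷. Once R is large this yields R ≤ 4G = 12P - 8R, that is, 3R - 4P ≤
0, so R' ≤ 0. -/
theorem R_le (h : ReversedRatioOn b P R) (hb : 0 ≤ b) (hG : 0 < 3 * P 0 - 2 * R 0) {c : ℝ}
    (hc : c = (3 * P 0 - 2 * R 0) / R 0 ^ 7) : R b ≤ max (R 0) (max 1 (1 / (4 * c))) := by
  have hcpos : 0 < c := hc ▸ div_pos hG (pow_pos h.R_zero 7)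
  refine le_of_deriv_nonpos_above hb h.cR h.hR (fun t ht hRt => ?_) (le_max_left _ _)
  have h1 : 1 ≤ R t := (le_max_left _ _).trans ((le_max_right _ _).trans hRt)
  have h2 : 1 / (4 * c) ≤ R t := (le_max_right _ _).trans ((le_max_right _ _).trans hRt)
  have h3 : 1 ≤ 4 * c * R t := by
    rw [div_le_iff₀ (by positivity)] at h2
    linarith
  have h4 := (h.mono ht.2.le).G_div_mono ht.1.le
  rw [← hc, le_div_iff₀ (by positivity)] at h4
  have h5 : R t ≤ R t ^ 6 := le_self_pow₀ h1 (by norm_num)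
  have h6 : 1 ≤ 4 * c * R t ^ 6 := h3.trans (by gcongr)
  have h7 : R t ≤ 4 * (c * R t ^ 7) := by
    have : 4 * (c * R t ^ 7) = (4 * c * R t ^ 6) * R t := by ring
    rw [this]
    nlinarith
  refine mul_nonpos_of_nonneg_of_nonpos (by linarith) ?_
  linarith

theorem ratioOn (h : ReversedRatioOn b P R) : RatioOn b (fun t => P t / R t) (fun t => 1 / R t) := by
  have hpos : ∀ t ∈ Icc 0 b, 0 < R t := fun t ht => (h.mono ht.2).R_pos ht.1
  refine ⟨h.cP.div h.cR fun t ht => (hpos t ht).ne',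
    continuousOn_const.div h.cR fun t ht => (hpos t ht).ne',
    fun t ht => one_div_pos.2 (hpos t (Ico_subset_Icc_self ht)), fun t ht => ?_, fun t ht => ?_⟩
  · have h1 := (hpos t (Ioo_subset_Icc_self ht)).ne'
    refine ((hasDerivAt_const t (1 : ℝ)).div (h.hR t ht) h1).congr_deriv ?_
    field_simp
    ring
  · have h1 := (hpos t (Ioo_subset_Icc_self ht)).ne'
    refine ((h.hP t ht).div (h.hR t ht) h1).congr_deriv ?_
    field_simp
    ring

theorem of_solution {f : ℝ → ℝ × ℝ} (hfc : ContinuousOn f (Icc 0 b))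
    (hf : ∀ t ∈ Ioo 0 b, HasDerivAt f (-ratioField (f t)) t) (hp : (f 0).1 ≤ 0)
    (hr : 0 < (f 0).2) : ReversedRatioOn b (fun t => -(f t).1) (fun t => (f t).2) :=
  ⟨hfc.fst.fun_neg, hfc.snd,
    fun t ht => (hf t ht).fst_comp.fun_neg.congr_deriv (by simp only [ratioField, Prod.fst_neg]; ring),
    fun t ht => (hf t ht).snd_comp.congr_deriv (by simp only [ratioField, Prod.snd_neg]; ring), by simpa using hp, hr⟩

end ReversedRatioOn

theorem exists_backward_ratio_of_G_pos {p₀ r₀ : ℝ} (hp : p₀ ≤ 0) (hr : 0 < r₀)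
    (hG : 3 * p₀ + 2 * r₀ < 0) :
    ∃ f : ℝ → ℝ × ℝ, f 0 = (p₀, r₀) ∧
      ∀ t ≥ 0, HasDerivWithinAt f (-ratioField (f t)) (Ici 0) t := by
  set c := (3 * -p₀ - 2 * r₀) / r₀ ^ 7 with hc
  set K := max r₀ (max 1 (1 / (4 * c))) with hK
  have hK1 : 1 ≤ K := (le_max_left _ _).trans (le_max_right _ _)
  refine exists_forward_solution (F := fun z => -ratioField z) contDiff_ratioField.neg _
    fun β _ => ⟨max (-p₀) K + 1, fun b hb f hf0 hfc hf => ?_⟩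
  have h := ReversedRatioOn.of_solution hfc hf (by simpa [hf0] using hp) (by simpa [hf0] using hr)
  have hR : ∀ t ∈ Icc 0 b, (f t).2 ≤ K := fun t ht => by
    have := (h.mono ht.2).R_le ht.1 (by simp only [hf0]; linarith) rfl
    simp only [hf0] at this
    exact this
  have h1 : 0 ≤ -(f b).1 := h.P_nonneg hb.1.le
  have h2 : 0 < (f b).2 := h.R_pos hb.1.le
  have h3 : -(f b).1 ≤ _ := h.P_le (K := max (-p₀) K) hb.1.le
    (fun t ht => (hR t (Ioo_subset_Icc_self ht)).trans (le_max_right _ _))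
    (by simp only [hf0]; linarith [le_max_left (-p₀) K])
    (by linarith [le_max_right (-p₀) K])
  have h4 := hR b (right_mem_Icc.2 hb.1.le)
  have h5 := le_max_right (-p₀) K
  exact norm_le_of_bounds (abs_le.2 ⟨by linarith, by linarith⟩)
    (abs_le.2 ⟨by linarith, by linarith⟩)

/-- Comparison with the separatrix keeps 1/R at least δ until time b₂, and there -p/r > 2/3. From
that point on, the invariant region 3P > 2R supplies the bound for all later times. -/
theorem exists_backward_ratio {b₂ τ : ℝ} {n₂ m₂ : ℝ → ℝ} (hS : SeparatrixRatio b₂ n₂ m₂)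
    (hτ : 0 < τ) (hlt : m₂ 0 < 1 / τ) :
    ∃ f : ℝ → ℝ × ℝ, f 0 = (0, τ) ∧
      ∀ t ≥ 0, HasDerivWithinAt f (-ratioField (f t)) (Ici 0) t := by
  set δ := 1 / τ - m₂ 0 with hδ
  have hδpos : 0 < δ := sub_pos.2 hlt
  have key : ∀ b ∈ Ioc 0 b₂, ∀ f : ℝ → ℝ × ℝ, f 0 = (0, τ) → ContinuousOn f (Icc 0 b) →
      (∀ t ∈ Ioo 0 b, HasDerivAt f (-ratioField (f t)) t) →
      n₂ b < -(f b).1 / (f b).2 ∧ δ ≤ 1 / (f b).2 - m₂ b ∧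
        ReversedRatioOn b (fun t => -(f t).1) (fun t => (f t).2) := fun b hb f hf0 hfc hf => by
    have h := ReversedRatioOn.of_solution hfc hf (by simp [hf0]) (by simpa [hf0] using hτ)
    have := h.ratioOn.comparison (hS.toRatioOn.mono hb.2) hb.1 (by simp [hf0, hS.n_zero])
      (by simpa [hf0] using hlt) (Or.inl ⟨one_div_pos.2 (h.R_pos hb.1.le), fun t ht =>
        hS.n_mem t ⟨ht.1, ht.2.trans_le hb.2⟩⟩)
    refine ⟨this.1, ?_, h⟩
    simpa [hf0, hδ] using this.2
  have hmnn : ∀ t ∈ Icc 0 b₂, 0 ≤ m₂ t := fun t ht => by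
    rcases eq_or_lt_of_le ht.2 with rfl | h
    · exact hS.m_end.ge
    · exact (hS.m_pos t ⟨ht.1, h⟩).le
  have hRle : ∀ b ∈ Ioc 0 b₂, ∀ f : ℝ → ℝ × ℝ, f 0 = (0, τ) → ContinuousOn f (Icc 0 b) →
      (∀ t ∈ Ioo 0 b, HasDerivAt f (-ratioField (f t)) t) → (f b).2 ≤ 1 / δ :=
    fun b hb f hf0 hfc hf => by
      obtain ⟨-, h1, h2⟩ := key b hb f hf0 hfc hf
      have h3 : 0 < (f b).2 := h2.R_pos hb.1.le
      rw [le_one_div h3 hδpos]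
      linarith [hmnn b ⟨hb.1.le, hb.2⟩]
  obtain ⟨f, hf0, hf⟩ := exists_solution_Icc_of_apriori_bound (F := fun z => -ratioField z)
    contDiff_ratioField.neg (0, τ) (C := 1 / δ + 1) hS.b_pos.le fun b hb f hf0 hfc hf => by
      obtain ⟨-, -, h⟩ := key b hb f hf0 hfc hf
      have h1 : 0 ≤ -(f b).1 := h.P_nonneg hb.1.le
      have h2 : 0 < (f b).2 := h.R_pos hb.1.le
      have h3 : -(f b).1 ≤ _ := h.P_le (K := 1 / δ) hb.1.le
        (fun t ht => hRle t ⟨ht.1, ht.2.le.trans hb.2⟩ f hf0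
          (hfc.mono (Icc_subset_Icc_right ht.2.le)) fun s hs => hf s ⟨hs.1, hs.2.trans ht.2⟩)
        (by simp only [hf0]; norm_num; positivity) (by positivity)
      have h4 := hRle b hb f hf0 hfc hf
      exact norm_le_of_bounds (abs_le.2 ⟨by linarith, by linarith⟩)
        (abs_le.2 ⟨by linarith, by linarith⟩)
  have hfc : ContinuousOn f (Icc 0 b₂) := fun t ht => (hf t ht).continuousWithinAt
  obtain ⟨h1, -, h3⟩ := key b₂ ⟨hS.b_pos, le_rfl⟩ f hf0 hfc fun t ht =>
    (hf t (Ioo_subset_Icc_self ht)).hasDerivAt (Icc_mem_nhds ht.1 ht.2)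
  have h4 : 0 ≤ -(f b₂).1 := h3.P_nonneg hS.b_pos.le
  have h5 : 0 < (f b₂).2 := h3.R_pos hS.b_pos.le
  rw [hS.n_end, lt_div_iff₀ h5] at h1
  obtain ⟨g, hg0, hg⟩ := exists_backward_ratio_of_G_pos (p₀ := (f b₂).1) (r₀ := (f b₂).2)
    (by linarith) h5 (by linarith)
  refine ⟨fun t => if t ≤ b₂ then f t else g (t - b₂), by simp [hS.b_pos.le, hf0], fun t ht => ?_⟩
  refine hasDerivWithinAt_glue (F := fun z => -ratioField z) (f := f) (g := fun t => g (t - b₂))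
    (by simp [hg0]) (fun htb => ?_) fun htb => ?_
  · rw [Ici_inter_Iic]
    exact hf t ⟨ht, htb⟩
  · exact (hg (t - b₂) (by linarith)).comp_sub_const_Ici.mono inter_subset_right

section State

variable {z : ℝ → ℝ × ℝ × ℝ} {S : Set ℝ}

theorem systemOn_of_state (hz : ∀ t ∈ S, HasDerivAt z (stateField (z t)) t)
    (hu : ∀ t ∈ S, (z t).2.1 ≠ 0) :
    SystemOn S (fun t => (z t).1) (fun t => (z t).2.1) (fun t => (z t).2.2)
      (fun t => (stateField (z t)).2.2) := by
  refine ⟨fun t ht => (hz t ht).fst_comp, fun t ht => (hz t ht).snd_comp.fst_comp,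
    fun t ht => (hz t ht).snd_comp.snd_comp, fun t ht => ?_⟩
  have := hu t ht
  simp only [stateField]
  field_simp

theorem contDiffOn_of_state (hS : IsOpen S) (hz : ∀ t ∈ S, HasDerivAt z (stateField (z t)) t)
    (hu : ∀ t ∈ S, (z t).2.1 ≠ 0) : ContDiffOn ℝ ∞ (fun t => (z t).1) S :=
  (contDiffOn_of_hasDerivWithinAt (F := fun y : ℝ × ℝ × ℝ × ℝ => stateField y.2) hS.uniqueDiffOn
    contDiffOn_stateField (fun t ht => hu t ht) fun t ht => (hz t ht).hasDerivWithinAt).fst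

end State

theorem solvesIVP_of_system {x u w w' : ℝ → ℝ} {τ : ℝ} (h : SystemOn univ x u w w')
    (hc : ContDiff ℝ ∞ x) (hx : x 0 = 0) (hu : u 0 = 1) (hw : w 0 = τ) : SolvesIVP τ x :=
  ⟨h.isSmoothSolution hc, hx, by rw [h.deriv_eq, hu], by rw [h.iteratedDeriv_two_eq]; simp [hx, hw]⟩

theorem exists_solvesIVP {b₂ τ : ℝ} {n₂ m₂ : ℝ → ℝ} (hS : SeparatrixRatio b₂ n₂ m₂)
    (hτ : 0 < τ) (hlt : m₂ 0 < 1 / τ) : ∃ x, SolvesIVP τ x := by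
  obtain ⟨z₁, h10, h1u, h1⟩ := exists_forward_state (x₀ := 0) (u₀ := 1) (w₀ := τ) one_pos hτ
    zero_le_one (by linarith)
  obtain ⟨f, hf0, hf⟩ := exists_backward_ratio hS hτ hlt
  obtain ⟨z₂, h20, h2u, h2⟩ := exists_state_of_ratio (f := f) (-1) (x₀ := 0) (u₀ := 1) (w₀ := τ)
    (by simpa using hf) one_pos (by simp [hf0])
  have hneg : ∀ t ≤ 0, HasDerivWithinAt (fun t => z₂ (-t)) (stateField (z₂ (-t))) (Iic 0) t :=
    fun t ht => by
      have := (h2 (-t) (by linarith)).scomp (h := fun t => -t) t (hasDerivWithinAt_neg t (Iic 0))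
        (fun s hs => by simpa using hs)
      simpa [Function.comp_def] using this
  have hz : ∀ t, HasDerivAt (fun t => if t ≤ 0 then z₂ (-t) else z₁ t)
      (stateField (if t ≤ 0 then z₂ (-t) else z₁ t)) t := fun t => by
    rw [← hasDerivWithinAt_univ]
    exact hasDerivWithinAt_glue (f := fun t => z₂ (-t)) (by simp [h10, h20])
      (fun ht => by simpa using hneg t ht) fun ht => by simpa using h1 t ht
  have hu : ∀ t, 0 < (if t ≤ 0 then z₂ (-t) else z₁ t).2.1 := fun t => by
    split_ifs
    exacts [h2u _, h1u _]
  refine ⟨_, solvesIVP_of_system (systemOn_of_state (S := univ) (fun t _ => hz t)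
    fun t _ => (hu t).ne') ?_ (by simp [h20]) (by simp [h20]) (by simp [h20])⟩
  exact contDiffOn_univ.1 (contDiffOn_of_state isOpen_univ (fun t _ => hz t) fun t _ => (hu t).ne')

/-! ### Construction of a global solution with a critical point -/

/-- `x` is smooth near `t` and satisfies the equation at `t`. -/
def SmoothSolutionAt (x : ℝ → ℝ) (t : ℝ) : Prop :=
  ContDiffAt ℝ ∞ x t ∧ deriv x t * iteratedDeriv 3 x t =
    x t * iteratedDeriv 2 x t - 2 * (iteratedDeriv 2 x t) ^ 2 + (deriv x t) ^ 2 + (x t) ^ 2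

theorem SmoothSolutionAt.congr {x y : ℝ → ℝ} {t : ℝ} (h : SmoothSolutionAt x t)
    (hxy : y =ᶠ[𝓝 t] x) : SmoothSolutionAt y t := by
  refine ⟨h.1.congr_of_eventuallyEq hxy, ?_⟩
  rw [hxy.deriv_eq, hxy.iteratedDeriv_eq, hxy.iteratedDeriv_eq, hxy.eq_of_nhds]
  exact h.2

theorem SystemOn.deriv_eventuallyEq {x u w w' : ℝ → ℝ} {S : Set ℝ} (h : SystemOn S x u w w')
    (hS : IsOpen S) {t : ℝ} (ht : t ∈ S) : deriv x =ᶠ[𝓝 t] u :=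
  mem_of_superset (hS.mem_nhds ht) fun s hs => (h.hx s hs).deriv

theorem SystemOn.iteratedDeriv_two_eventuallyEq {x u w w' : ℝ → ℝ} {S : Set ℝ}
    (h : SystemOn S x u w w') (hS : IsOpen S) {t : ℝ} (ht : t ∈ S) :
    iteratedDeriv 2 x =ᶠ[𝓝 t] fun s => x s + w s :=
  mem_of_superset (hS.mem_nhds ht) fun s hs => by
    change iteratedDeriv 2 x s = x s + w s
    rw [iteratedDeriv_succ, iteratedDeriv_one, (h.deriv_eventuallyEq hS hs).deriv_eq]
    exact (h.hu s hs).deriv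

theorem SystemOn.smoothSolutionAt {x u w w' : ℝ → ℝ} {S : Set ℝ} (h : SystemOn S x u w w')
    (hS : IsOpen S) (hc : ContDiffOn ℝ ∞ x S) {t : ℝ} (ht : t ∈ S) : SmoothSolutionAt x t := by
  refine ⟨hc.contDiffAt (hS.mem_nhds ht), ?_⟩
  have h2 := h.iteratedDeriv_two_eventuallyEq hS ht
  have h3 : iteratedDeriv 3 x t = u t + w' t := by
    rw [iteratedDeriv_succ, h2.deriv_eq]
    exact ((h.hx t ht).add (h.hw t ht)).deriv
  rw [h3, h2.eq_of_nhds, (h.hx t ht).deriv]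
  have := h.eqn t ht
  linear_combination this

/-- A local solution with `x' > 0` on the right extends to a solution on a half-line. -/
theorem SystemOn.exists_extension_right {x u w w' : ℝ → ℝ} {ε : ℝ} (hε : 0 < ε)
    (h : SystemOn (Ioo (-ε) ε) x u w w') (hu : ∀ t ∈ Ioo 0 ε, 0 < u t) (hw : 0 < w (ε / 2))
    (hx : x (ε / 2) ≤ u (ε / 2)) (hG : 0 ≤ 3 * x (ε / 2) + 2 * w (ε / 2)) :
    ∃ y : ℝ → ℝ, (∀ t > 0, SmoothSolutionAt y t) ∧ ∀ t ∈ Ioo 0 (ε / 2), y t = x t := by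
  have hm : ε / 2 ∈ Ioo 0 ε := ⟨by linarith, by linarith⟩
  obtain ⟨z, hz0, hzu, hz⟩ := exists_forward_state (hu _ hm) hw hx hG
  have hloc : ∀ t ∈ Ioo 0 ε, HasDerivAt (fun t => (x t, u t, w t)) (stateField (x t, u t, w t)) t :=
    fun t ht => by
      have ht' : t ∈ Ioo (-ε) ε := ⟨by linarith [ht.1], ht.2⟩
      refine ((h.hx t ht').prodMk ((h.hu t ht').prodMk (h.hw t ht'))).congr_deriv ?_
      simp only [stateField, Prod.mk.injEq, true_and]
      rw [h.w'_eq ht' (hu t ht).ne']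
      ring
  set Z : ℝ → ℝ × ℝ × ℝ := fun t => if t ≤ ε / 2 then (x t, u t, w t) else z (t - ε / 2) with hZ
  have hZd : ∀ t ∈ Ioi (0 : ℝ), HasDerivAt Z (stateField (Z t)) t := fun t ht => by
    have : HasDerivWithinAt Z (stateField (Z t)) (Ioi 0) t :=
      hasDerivWithinAt_glue (f := fun t => (x t, u t, w t)) (g := fun t => z (t - ε / 2))
        (by simp [hz0]) (fun htb => (hloc t ⟨ht, by linarith⟩).hasDerivWithinAt)
        fun htb => ((hz (t - ε / 2) (by linarith)).comp_sub_const_Ici).mono inter_subset_right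
    exact this.hasDerivAt (Ioi_mem_nhds ht)
  have hZu : ∀ t ∈ Ioi (0 : ℝ), (Z t).2.1 ≠ 0 := fun t ht => by
    simp only [hZ]
    split_ifs with h1
    · exact (hu t ⟨ht, by linarith⟩).ne'
    · exact (hzu _).ne'
  refine ⟨fun t => (Z t).1, fun t ht => (systemOn_of_state hZd hZu).smoothSolutionAt isOpen_Ioi
    (contDiffOn_of_state isOpen_Ioi hZd hZu) ht, fun t ht => ?_⟩
  simp only [hZ]
  rw [if_pos ht.2.le]

theorem SmoothSolutionAt.comp_neg {x : ℝ → ℝ} {t : ℝ} (h : SmoothSolutionAt x (-t)) :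
    SmoothSolutionAt (fun t => x (-t)) t := by
  refine ⟨ContDiffAt.comp t h.1 contDiff_neg.contDiffAt, ?_⟩
  rw [deriv_comp_neg, iteratedDeriv_comp_neg, iteratedDeriv_comp_neg]
  simp only [smul_eq_mul]
  linear_combination h.2

/-- The field for `(m, log w)` on the invariant curve. -/
noncomputable def sepField (z : ℝ × ℝ) : ℝ × ℝ :=
  (1 / 3 + 4 * z.1 ^ 2 * sepSeries (z.1 ^ 2), -(3 * z.1 * sepSeries (z.1 ^ 2)))

theorem exists_sepSeries_bounds : ∃ η > 0, ∀ m : ℝ, |m| < η → m ^ 2 ∈ Metric.ball (0 : ℝ) (1 / 36) ∧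
    0 < sepSeries (m ^ 2) ∧ m ^ 2 * sepSeries (m ^ 2) < 2 / 3 := by
  have hc : ContinuousAt (fun m : ℝ => sepSeries (m ^ 2)) 0 := by
    have h1 : ContinuousAt sepSeries ((0 : ℝ) ^ 2) :=
      (sepSeries_contDiffAt (by simp)).continuousAt
    exact ContinuousAt.comp (f := fun m : ℝ => m ^ 2) h1 (by fun_prop)
  have h2 : ∀ᶠ m : ℝ in 𝓝 0, m ^ 2 ∈ Metric.ball (0 : ℝ) (1 / 36) := by
    have : Tendsto (fun m : ℝ => m ^ 2) (𝓝 0) (𝓝 0) := by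
      have : ContinuousAt (fun m : ℝ => m ^ 2) 0 := by fun_prop
      simpa [ContinuousAt] using this
    exact this (Metric.ball_mem_nhds 0 (by norm_num))
  have h3 : ∀ᶠ m : ℝ in 𝓝 0, 0 < sepSeries (m ^ 2) :=
    hc.eventually_const_lt (by simp [sepSeries_zero])
  have h4 : ∀ᶠ m : ℝ in 𝓝 0, m ^ 2 * sepSeries (m ^ 2) < 2 / 3 := by
    have : ContinuousAt (fun m : ℝ => m ^ 2 * sepSeries (m ^ 2)) 0 :=
      ContinuousAt.mul (by fun_prop) hc
    exact this.eventually_lt_const (by norm_num)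
  obtain ⟨η, hη, h⟩ := Metric.eventually_nhds_iff_ball.1 (h2.and (h3.and h4))
  exact ⟨η, hη, fun m hm => h m (by simpa using hm)⟩

theorem sepField_contDiffAt {z : ℝ × ℝ} (hz : z.1 ^ 2 ∈ Metric.ball (0 : ℝ) (1 / 36)) :
    ContDiffAt ℝ ∞ sepField z := by
  have h1 : ContDiffAt ℝ ∞ (fun z : ℝ × ℝ => sepSeries (z.1 ^ 2)) z :=
    ContDiffAt.comp (f := fun z : ℝ × ℝ => z.1 ^ 2) z (sepSeries_contDiffAt hz) (by fun_prop)
  unfold sepField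
  exact ContDiffAt.prodMk (by fun_prop) (by fun_prop)

/-- Near a critical point there is a solution with `x + 2 w / 3 = 0` there. -/
theorem exists_local_separatrix : ∃ ε > 0, ∃ x u w w' : ℝ → ℝ, SystemOn (Ioo (-ε) ε) x u w w' ∧
    ContDiffOn ℝ ∞ x (Ioo (-ε) ε) ∧ x 0 = -2 / 3 ∧ u 0 = 0 ∧ w 0 = 1 ∧
    (∀ t ∈ Ioo 0 ε, 0 < u t ∧ 0 < w t ∧ x t ≤ u t ∧ 0 ≤ 3 * x t + 2 * w t) ∧
    (∀ t ∈ Ioo 0 ε, 0 < -u (-t) ∧ 0 < w (-t) ∧ x (-t) ≤ -u (-t) ∧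
      0 ≤ 3 * x (-t) + 2 * w (-t)) := by
  obtain ⟨η, hη, hbd⟩ := exists_sepSeries_bounds
  have h0 : ContDiffAt ℝ 1 sepField (0, 0) :=
    (sepField_contDiffAt (by simp)).of_le (by simp)
  obtain ⟨α, hα0, ε₁, hε₁, hα⟩ :=
    h0.exists_forall_mem_closedBall_exists_eq_forall_mem_Ioo_hasDerivAt₀ 0
  simp only [zero_sub, zero_add] at hα
  have hcont : ContinuousAt (fun t => (α t).1) 0 :=
    (hα 0 ⟨by linarith, hε₁⟩).fst_comp.continuousAt
  obtain ⟨ε₂, hε₂, hsmall⟩ := Metric.eventually_nhds_iff_ball.1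
    (hcont (Metric.ball_mem_nhds _ hη))
  simp only [hα0, mem_ball_zero_iff, Real.norm_eq_abs] at hsmall
  set ε := min ε₁ ε₂ with hε
  have hεpos : 0 < ε := lt_min hε₁ hε₂
  set m := fun t => (α t).1 with hm
  set l := fun t => (α t).2 with hl
  set φ := fun t => sepSeries (m t ^ 2) with hφ
  have hI : ∀ t ∈ Ioo (-ε) ε, t ∈ Ioo (-ε₁) ε₁ := fun t ht =>
    ⟨by linarith [ht.1, min_le_left ε₁ ε₂], by linarith [ht.2, min_le_left ε₁ ε₂]⟩
  have hmη : ∀ t ∈ Ioo (-ε) ε, |m t| < η := fun t ht =>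
    hsmall t (abs_lt.2 ⟨by linarith [ht.1, min_le_right ε₁ ε₂],
      by linarith [ht.2, min_le_right ε₁ ε₂]⟩)
  have hm' : ∀ t ∈ Ioo (-ε) ε, HasDerivAt m (1 / 3 + 4 * m t ^ 2 * φ t) t := fun t ht =>
    (hα t (hI t ht)).fst_comp
  have hl' : ∀ t ∈ Ioo (-ε) ε, HasDerivAt l (-(3 * m t * φ t)) t := fun t ht =>
    (hα t (hI t ht)).snd_comp
  have hφ' : ∀ t ∈ Ioo (-ε) ε, HasDerivAt φ
      (deriv sepSeries (m t ^ 2) * (2 * m t * (1 / 3 + 4 * m t ^ 2 * φ t))) t := fun t ht => by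
    have h1 : HasDerivAt sepSeries (deriv sepSeries (m t ^ 2)) (m t ^ 2) :=
      ((sepSeries_contDiffAt (hbd _ (hmη t ht)).1).differentiableAt (by simp)).hasDerivAt
    refine (h1.comp t ((hm' t ht).fun_pow 2)).congr_deriv ?_
    push_cast
    ring
  have hw' : ∀ t ∈ Ioo (-ε) ε, HasDerivAt (fun t => Real.exp (l t))
      (-(3 * m t * φ t) * Real.exp (l t)) t := fun t ht =>
    (hl' t ht).exp.congr_deriv (by ring)
  -- On the invariant curve 3x + 2w = 3m²φ w, so dividing by u = m w cancels the singularity: w'/w =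
  -- -3mφ is smooth through m = 0.
  have hsys : SystemOn (Ioo (-ε) ε) (fun t => (-2 / 3 + m t ^ 2 * φ t) * Real.exp (l t))
      (fun t => m t * Real.exp (l t)) (fun t => Real.exp (l t))
      (fun t => -(3 * m t * φ t) * Real.exp (l t)) := by
    refine ⟨fun t ht => ?_, fun t ht => ?_, hw', fun t _ => by ring⟩
    · refine (((((hm' t ht).fun_pow 2).fun_mul (hφ' t ht)).const_add (-2 / 3)).fun_mul
        (hw' t ht)).congr_deriv ?_
      have := sepSeries_ode (hbd _ (hmη t ht)).1
      push_cast
      simp only [hφ] at this ⊢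
      linear_combination (m t * Real.exp (l t)) * this
    · exact ((hm' t ht).fun_mul (hw' t ht)).congr_deriv (by ring)
  have hαs : ContDiffOn ℝ ∞ α (Ioo (-ε) ε) := by
    refine contDiffOn_of_hasDerivWithinAt (F := fun y : ℝ × ℝ × ℝ => sepField y.2)
      (U := {y | |y.2.1| < η}) isOpen_Ioo.uniqueDiffOn (fun y hy => ?_) (fun t ht => hmη t ht)
      fun t ht => (hα t (hI t ht)).hasDerivWithinAt
    exact ((sepField_contDiffAt (hbd _ hy).1).comp y contDiffAt_snd).contDiffWithinAt
  have hxs : ContDiffOn ℝ ∞ (fun t => (-2 / 3 + m t ^ 2 * φ t) * Real.exp (l t)) (Ioo (-ε) ε) := by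
    intro t ht
    have h1 := hαs t ht
    have h2 : ContDiffWithinAt ℝ ∞ m (Ioo (-ε) ε) t := h1.fst
    have h3 : ContDiffWithinAt ℝ ∞ l (Ioo (-ε) ε) t := h1.snd
    have h4 : ContDiffWithinAt ℝ ∞ φ (Ioo (-ε) ε) t :=
      ContDiffAt.comp_contDiffWithinAt (f := fun y => m y ^ 2) t
        (sepSeries_contDiffAt (hbd _ (hmη t ht)).1) (h2.pow 2)
    exact (contDiffWithinAt_const.add ((h2.pow 2).mul h4)).mul h3.exp
  have hm0 : m 0 = 0 := by simp [hm, hα0]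
  have hl0 : l 0 = 0 := by simp [hl, hα0]
  have hmono : StrictMonoOn m (Ioo (-ε) ε) := by
    refine strictMonoOn_of_deriv_pos (convex_Ioo _ _)
      (fun t ht => (hm' t ht).continuousAt.continuousWithinAt) fun t ht => ?_
    rw [interior_Ioo] at ht
    rw [(hm' t ht).deriv]
    have := (hbd _ (hmη t ht)).2.1
    have : 0 < φ t := this
    positivity
  have hmem0 : (0 : ℝ) ∈ Ioo (-ε) ε := ⟨by linarith, hεpos⟩
  have key : ∀ t ∈ Ioo (-ε) ε, (-2 / 3 + m t ^ 2 * φ t) * Real.exp (l t) ≤ 0 ∧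
      0 ≤ 3 * ((-2 / 3 + m t ^ 2 * φ t) * Real.exp (l t)) + 2 * Real.exp (l t) := fun t ht => by
    obtain ⟨-, h1, h2⟩ := hbd _ (hmη t ht)
    have h1 : 0 < φ t := h1
    have h2 : m t ^ 2 * φ t < 2 / 3 := h2
    refine ⟨mul_nonpos_of_nonpos_of_nonneg (by linarith) (Real.exp_pos _).le, ?_⟩
    have h3 : 3 * ((-2 / 3 + m t ^ 2 * φ t) * Real.exp (l t)) + 2 * Real.exp (l t) =
      3 * (m t ^ 2 * φ t * Real.exp (l t)) := by ring
    rw [h3]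
    positivity
  refine ⟨ε, hεpos, _, _, _, _, hsys, hxs, by simp [hm0, hl0], by simp [hm0], by simp [hl0],
    fun t ht => ?_, fun t ht => ?_⟩
  · have ht' : t ∈ Ioo (-ε) ε := ⟨by linarith [ht.1], ht.2⟩
    obtain ⟨h1, h2⟩ := key t ht'
    have h3 : 0 < m t := hm0 ▸ hmono hmem0 ht' ht.1
    have h4 : 0 < m t * Real.exp (l t) := mul_pos h3 (Real.exp_pos _)
    exact ⟨h4, Real.exp_pos _, h1.trans h4.le, h2⟩
  · have ht' : -t ∈ Ioo (-ε) ε := ⟨by linarith [ht.2], by linarith [ht.1, ht.2]⟩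
    obtain ⟨h1, h2⟩ := key (-t) ht'
    have h3 : m (-t) < 0 := hm0 ▸ hmono ht' hmem0 (by linarith [ht.1])
    have h4 : 0 < -(m (-t) * Real.exp (l (-t))) :=
      neg_pos.2 (mul_neg_of_neg_of_pos h3 (Real.exp_pos _))
    exact ⟨h4, Real.exp_pos _, h1.trans h4.le, h2⟩

/-- There is a global smooth solution with a critical point at which `x'' - x ≠ 0`. -/
theorem exists_separatrix_solution : ∃ y : ℝ → ℝ, IsSmoothSolution y ∧ y 0 = -2 / 3 ∧
    deriv y 0 = 0 ∧ iteratedDeriv 2 y 0 = 1 / 3 := by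
  obtain ⟨ε, hε, x, u, w, w', hsys, hxs, hx0, hu0, hw0, hR, hL⟩ := exists_local_separatrix
  have hmid : ε / 2 ∈ Ioo 0 ε := ⟨by linarith, by linarith⟩
  obtain ⟨y₁, hy₁, he₁⟩ := hsys.exists_extension_right hε (fun t ht => (hR t ht).1)
    (hR _ hmid).2.1 (hR _ hmid).2.2.1 (hR _ hmid).2.2.2
  have hsys' := hsys.comp_neg
  have hpre : Neg.neg ⁻¹' Ioo (-ε) ε = Ioo (-ε) ε := by
    ext t
    simp only [mem_preimage, mem_Ioo]
    constructor <;> rintro ⟨h1, h2⟩ <;> constructor <;> linarith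
  rw [hpre] at hsys'
  obtain ⟨y₂, hy₂, he₂⟩ := hsys'.exists_extension_right hε (fun t ht => (hL t ht).1)
    (hL _ hmid).2.1 (hL _ hmid).2.2.1 (hL _ hmid).2.2.2
  -- The extensions agree with the local solution up to distance ε/2, so switching at ε/4 leaves an
  -- overlap on which smoothness can be checked.
  set y : ℝ → ℝ := fun t => if ε / 4 ≤ t then y₁ t else if t ≤ -(ε / 4) then y₂ (-t) else x t
    with hy
  have hyx : ∀ t ∈ Ioo (-(ε / 2)) (ε / 2), y t = x t := fun t ht => by
    simp only [hy]
    split_ifs with h1 h2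
    · exact he₁ t ⟨by linarith, ht.2⟩
    · rw [he₂ (-t) ⟨by linarith, by linarith [ht.1]⟩, neg_neg]
    · rfl
  have hy1 : ∀ t > 0, y t = y₁ t := fun t ht => by
    simp only [hy]
    split_ifs with h1 h2
    · rfl
    · linarith
    · exact (he₁ t ⟨ht, by linarith⟩).symm
  have hy2 : ∀ t < 0, y t = y₂ (-t) := fun t ht => by
    simp only [hy]
    split_ifs with h1 h2
    · linarith
    · rfl
    · rw [he₂ (-t) ⟨by linarith, by linarith⟩, neg_neg]
  have h0 : y =ᶠ[𝓝 0] x :=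
    mem_of_superset (Ioo_mem_nhds (by linarith) (by linarith)) hyx
  have hmem : (0 : ℝ) ∈ Ioo (-ε) ε := ⟨by linarith, hε⟩
  have hsol : ∀ t, SmoothSolutionAt y t := fun t => by
    rcases lt_trichotomy t 0 with h | rfl | h
    · exact (SmoothSolutionAt.comp_neg (hy₂ (-t) (by linarith))).congr
        (mem_of_superset (Iio_mem_nhds h) hy2)
    · exact (hsys.smoothSolutionAt isOpen_Ioo hxs hmem).congr h0
    · exact (hy₁ t h).congr (mem_of_superset (Ioi_mem_nhds h) hy1)
  refine ⟨y, ⟨contDiff_iff_contDiffAt.2 fun t => (hsol t).1, fun t => (hsol t).2⟩, ?_, ?_, ?_⟩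
  · rw [h0.eq_of_nhds, hx0]
  · rw [h0.deriv_eq, (hsys.hx 0 hmem).deriv, hu0]
  · rw [h0.iteratedDeriv_eq, (hsys.iteratedDeriv_two_eventuallyEq isOpen_Ioo hmem).eq_of_nhds, hx0,
      hw0]
    norm_num

/-! ### Solutions with a critical point: normalisation, symmetry, uniqueness -/

/-- A solution with a critical point at `a` where `3x + 2w = 0`, normalised by `w > 0`. -/
structure CriticalSolution (x u w w' : ℝ → ℝ) (a : ℝ) : Prop extends SystemOn univ x u w w' where
  u_crit : u a = 0
  G_crit : 3 * x a + 2 * w a = 0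
  w_pos : ∀ t, 0 < w t
  u_pos : ∀ t > a, 0 < u t
  u_neg : ∀ t < a, u t < 0

namespace SystemOn

variable {x u w w' : ℝ → ℝ}

theorem u_pos_right (h : SystemOn univ x u w w') {a : ℝ} (hu : u a = 0)
    (hu' : 0 < x a + w a) (hx : x a ≠ 0) : ∀ t > a, 0 < u t := by
  have hne := h.u_ne_zero_right hu hx
  rcases sign_of_ne_zero ordConnected_Ioi h.continuous_u.continuousOn hne with h1 | h1
  · exact h1
  · exfalso
    have := (h.hu a trivial).hasDerivWithinAt (s := Ioi a)
    have h3 := (hasDerivWithinAt_iff_tendsto_slope' (by simp)).1 this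
    obtain ⟨t, ht1, ht2⟩ := ((h3.eventually_const_lt hu').and self_mem_nhdsWithin).exists
    rw [slope_def_field, hu, sub_zero] at ht1
    have ht2 : a < t := ht2
    exact absurd ht1 (not_lt.2 (div_nonpos_of_nonpos_of_nonneg (h1 t ht2).le (by linarith)))

/-- Since w(a) ≠ 0, the equation at a forces 3x + 2w = 0, hence u'(a) = w(a)/3 > 0, which settles
the sign of u on both sides. -/
theorem criticalSolution (h : SystemOn univ x u w w') {a : ℝ} (hu : u a = 0) (hw : 0 < w a) :
    CriticalSolution x u w w' a := by
  have hG := (h.eq_or_of_u_eq_zero hu).resolve_left hw.ne'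
  have hx : x a ≠ 0 := fun h0 => by rw [h0] at hG; linarith
  have hwne := (h.w_zero_or_ne_zero ⟨a, hx⟩).resolve_left fun h0 => hw.ne' (h0 a)
  have hwpos : ∀ t, 0 < w t := by
    rcases sign_of_ne_zero ordConnected_univ h.continuous_w.continuousOn (fun t _ => hwne t)
      with h1 | h1
    · exact fun t => h1 t trivial
    · exact absurd (h1 a trivial) (not_lt.2 hw.le)
  refine ⟨h, hu, hG, hwpos, h.u_pos_right hu (by linarith) hx, fun t ht => ?_⟩
  have := h.comp_neg_univ.u_pos_right (a := -a) (by simp [hu]) (by simp only [neg_neg]; linarith)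
    (by simpa) (-t) (by linarith)
  simpa using this

end SystemOn

namespace CriticalSolution

variable {x u w w' : ℝ → ℝ} {a : ℝ}

theorem x_crit_neg (h : CriticalSolution x u w w' a) : x a < 0 := by
  linarith [h.G_crit, h.w_pos a]

theorem exists_zero (h : CriticalSolution x u w w' a) : ∃ t > a, x t = 0 := by
  obtain ⟨t, ht, hxt⟩ := h.exists_x_nonneg h.u_pos fun t _ => h.w_pos t
  obtain ⟨s, hs, hs0⟩ := intermediate_value_Icc ht.le h.continuous_x.continuousOn
    ⟨h.x_crit_neg.le, hxt⟩
  refine ⟨s, lt_of_le_of_ne hs.1 ?_, hs0⟩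
  rintro rfl
  exact absurd hs0 h.x_crit_neg.ne

theorem lt_of_u_pos (h : CriticalSolution x u w w' a) {t : ℝ} (ht : 0 < u t) : a < t := by
  by_contra hcon
  rcases eq_or_lt_of_le (not_lt.1 hcon) with rfl | h1
  · exact ht.ne' h.u_crit
  · exact absurd ht (h.u_neg t h1).not_gt

theorem separatrixRatio (h : CriticalSolution x u w w' a) (hx : x 0 = 0) (hu : 0 < u 0) :
    SeparatrixRatio (-a) (fun t => -x (-t) / w (-t)) (fun t => u (-t) / w (-t)) where
  toRatioOn := h.ratioOn (fun t => (h.w_pos t).ne') fun t ht =>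
    div_pos (h.u_pos _ (by linarith [ht.2])) (h.w_pos _)
  b_pos := by linarith [h.lt_of_u_pos hu]
  n_zero := by simp [hx]
  n_end := by
    rw [neg_neg, div_eq_iff (h.w_pos a).ne']
    linarith [h.G_crit]
  m_end := by simp [h.u_crit]
  n_nonneg t ht := by
    refine div_nonneg ?_ (h.w_pos _).le
    have := le_of_hasDerivAt_nonneg (f := x) (a := -t) (b := 0) (by linarith [ht.1])
      h.continuous_x.continuousOn (fun s _ => h.hx s trivial)
      fun s hs => (h.u_pos s (by linarith [hs.1, ht.2])).le
    linarith

theorem comp_add (h : CriticalSolution x u w w' a) (c : ℝ) :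
    CriticalSolution (fun t => x (t + c)) (fun t => u (t + c)) (fun t => w (t + c))
      (fun t => w' (t + c)) (a - c) :=
  (h.toSystemOn.comp_add c).criticalSolution (by simp [h.u_crit]) (by simp [h.w_pos])

theorem const_mul (h : CriticalSolution x u w w' a) {c : ℝ} (hc : 0 < c) :
    CriticalSolution (fun t => c * x t) (fun t => c * u t) (fun t => c * w t)
      (fun t => c * w' t) a :=
  (h.toSystemOn.const_mul c).criticalSolution (by simp [h.u_crit]) (mul_pos hc (h.w_pos a))

theorem comp_neg (h : CriticalSolution x u w w' a) :
    CriticalSolution (fun t => x (-t)) (fun t => -u (-t)) (fun t => w (-t))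
      (fun t => -w' (-t)) (-a) :=
  h.toSystemOn.comp_neg_univ.criticalSolution (by simp [h.u_crit]) (by simp [h.w_pos])

end CriticalSolution

namespace SystemOn

variable {x u w w' x₁ u₁ w₁ w₁' x₂ u₂ w₂ w₂' : ℝ → ℝ}

theorem hasDerivAt_ratio (h : SystemOn univ x u w w') {t : ℝ} (hu : u t ≠ 0) :
    HasDerivAt (fun t => (x t / u t, w t / u t)) (ratioField (x t / u t, w t / u t)) t := by
  refine (((h.hx t trivial).div (h.hu t trivial) hu).prodMk
    ((h.hw t trivial).div (h.hu t trivial) hu)).congr_deriv ?_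
  simp only [ratioField, Prod.mk.injEq]
  refine ⟨by field_simp; ring, ?_⟩
  have := h.eqn t trivial
  field_simp
  linear_combination this

/-- The ratios agree because their vector field is polynomial. With common ratios, u₁ - u₂ solves a
homogeneous linear equation. -/
theorem eq_forward (h₁ : SystemOn univ x₁ u₁ w₁ w₁') (h₂ : SystemOn univ x₂ u₂ w₂ w₂') {b : ℝ}
    (hb : 0 ≤ b) (hu₁ : ∀ t ∈ Icc 0 b, 0 < u₁ t) (hu₂ : ∀ t ∈ Icc 0 b, 0 < u₂ t)
    (hx : x₁ 0 = x₂ 0) (hu : u₁ 0 = u₂ 0) (hw : w₁ 0 = w₂ 0) : x₁ b = x₂ b ∧ u₁ b = u₂ b := by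
  have heq := eqOn_of_hasDerivWithinAt contDiff_ratioField
    (fun t ht => (h₁.hasDerivAt_ratio (hu₁ t ht).ne').hasDerivWithinAt (s := Icc 0 b))
    (fun t ht => (h₂.hasDerivAt_ratio (hu₂ t ht).ne').hasDerivWithinAt (s := Icc 0 b))
    (by simp [hx, hu, hw])
  have hp : ∀ t ∈ Icc 0 b, x₁ t / u₁ t = x₂ t / u₂ t := fun t ht => congrArg Prod.fst (heq ht)
  have hr : ∀ t ∈ Icc 0 b, w₁ t / u₁ t = w₂ t / u₂ t := fun t ht => congrArg Prod.snd (heq ht)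
  have huc₁ := h₁.continuous_u
  have huc₂ := h₂.continuous_u
  have hxc₁ := h₁.continuous_x
  have hwc₁ := h₁.continuous_w
  have hub : u₁ b = u₂ b := by
    have := (eq_zero_iff_of_linear (f := fun t => u₁ t - u₂ t)
      (d := fun t => (x₁ t + w₁ t) / u₁ t) hb (by fun_prop)
      (ContinuousOn.div (by fun_prop) (by fun_prop) fun t ht => (hu₁ t ht).ne')
      (fun t ht => ?_)).1 (by simp [hu])
    · linarith
    · have ht' := Ioo_subset_Icc_self ht
      refine ((h₁.hu t trivial).sub (h₂.hu t trivial)).congr_deriv ?_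
      have h3 := (hu₁ t ht').ne'
      have h4 := (hu₂ t ht').ne'
      have h5 := hp t ht'
      have h6 := hr t ht'
      rw [div_eq_div_iff h3 h4] at h5 h6
      field_simp
      linear_combination h5 + h6
  refine ⟨?_, hub⟩
  have h3 := hp b (right_mem_Icc.2 hb)
  rw [hub] at h3
  exact (div_left_inj' (hu₂ b (right_mem_Icc.2 hb)).ne').1 h3

theorem comp_neg_neg (h : SystemOn univ x u w w') :
    SystemOn univ (fun t => -x (-t)) (fun t => u (-t)) (fun t => -w (-t)) (fun t => w' (-t)) := by
  simpa using h.comp_neg_univ.neg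

theorem eq_of_u_pos (h₁ : SystemOn univ x₁ u₁ w₁ w₁') (h₂ : SystemOn univ x₂ u₂ w₂ w₂') {a t : ℝ}
    (ha : a < 0) (hu₁ : ∀ t > a, 0 < u₁ t) (hu₂ : ∀ t > a, 0 < u₂ t)
    (hx : x₁ 0 = x₂ 0) (hu : u₁ 0 = u₂ 0) (hw : w₁ 0 = w₂ 0) (ht : a < t) :
    x₁ t = x₂ t ∧ u₁ t = u₂ t := by
  rcases le_total 0 t with h0 | h0
  · exact h₁.eq_forward h₂ h0 (fun s hs => hu₁ s (by linarith [hs.1]))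
      (fun s hs => hu₂ s (by linarith [hs.1])) hx hu hw
  · have := h₁.comp_neg_neg.eq_forward h₂.comp_neg_neg (b := -t) (by linarith)
      (fun s hs => hu₁ _ (by linarith [hs.2])) (fun s hs => hu₂ _ (by linarith [hs.2]))
      (by simpa using hx) (by simpa using hu) (by simpa using hw)
    simpa using this

theorem eq_at_end (h₁ : SystemOn univ x₁ u₁ w₁ w₁') (h₂ : SystemOn univ x₂ u₂ w₂ w₂') {a : ℝ}
    (ha : a < 0) (hu₁ : ∀ t > a, 0 < u₁ t) (hu₂ : ∀ t > a, 0 < u₂ t)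
    (hx : x₁ 0 = x₂ 0) (hu : u₁ 0 = u₂ 0) (hw : w₁ 0 = w₂ 0) : x₁ a = x₂ a ∧ u₁ a = u₂ a := by
  have hx' : IsClosed {t | x₁ t = x₂ t} := isClosed_eq h₁.continuous_x h₂.continuous_x
  have hu' : IsClosed {t | u₁ t = u₂ t} := isClosed_eq h₁.continuous_u h₂.continuous_u
  have hmem : a ∈ closure (Ioi a) := by simp
  exact ⟨closure_minimal (fun t ht => (h₁.eq_of_u_pos h₂ ha hu₁ hu₂ hx hu hw ht).1) hx' hmem,
    closure_minimal (fun t ht => (h₁.eq_of_u_pos h₂ ha hu₁ hu₂ hx hu hw ht).2) hu' hmem⟩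

end SystemOn

namespace CriticalSolution

variable {x u w w' x₁ u₁ w₁ w₁' x₂ u₂ w₂ w₂' : ℝ → ℝ} {a a₁ a₂ : ℝ}

theorem not_lt_of_eq (h₁ : CriticalSolution x₁ u₁ w₁ w₁' a₁) (h₂ : CriticalSolution x₂ u₂ w₂ w₂' a₂)
    (hpos : 0 < u₂ 0) (hx : x₁ 0 = x₂ 0) (hu : u₁ 0 = u₂ 0) (hw : w₁ 0 = w₂ 0) : ¬ a₁ < a₂ := by
  intro hlt
  have := (h₁.eq_at_end h₂.toSystemOn (h₂.lt_of_u_pos hpos) (fun t ht => h₁.u_pos t (hlt.trans ht))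
    h₂.u_pos hx hu hw).2
  rw [h₂.u_crit] at this
  exact (h₁.u_pos a₂ hlt).ne' this

theorem eq_right (h₁ : CriticalSolution x₁ u₁ w₁ w₁' a₁) (h₂ : CriticalSolution x₂ u₂ w₂ w₂' a₂)
    (hpos : 0 < u₂ 0) (hx : x₁ 0 = x₂ 0) (hu : u₁ 0 = u₂ 0) (hw : w₁ 0 = w₂ 0) :
    a₁ = a₂ ∧ ∀ t ≥ a₁, x₁ t = x₂ t := by
  have heq : a₁ = a₂ := le_antisymm
    (not_lt.1 (h₂.not_lt_of_eq h₁ (hu ▸ hpos) hx.symm hu.symm hw.symm))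
    (not_lt.1 (h₁.not_lt_of_eq h₂ hpos hx hu hw))
  subst heq
  refine ⟨rfl, fun t ht => ?_⟩
  rcases eq_or_lt_of_le ht with rfl | h
  · exact (h₁.eq_at_end h₂.toSystemOn (h₂.lt_of_u_pos hpos) h₁.u_pos h₂.u_pos hx hu hw).1
  · exact (h₁.eq_of_u_pos h₂.toSystemOn (h₂.lt_of_u_pos hpos) h₁.u_pos h₂.u_pos hx hu hw h).1

/-- Two normalised solutions with a critical point have the same value of `w/u` at their zeros. -/
theorem ratio_eq (h₁ : CriticalSolution x₁ u₁ w₁ w₁' a₁) (h₂ : CriticalSolution x₂ u₂ w₂ w₂' a₂)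
    {t₁ t₂ : ℝ} (hx₁ : x₁ t₁ = 0) (hx₂ : x₂ t₂ = 0) (ht₁ : a₁ < t₁) (ht₂ : a₂ < t₂) :
    u₁ t₁ / w₁ t₁ = u₂ t₂ / w₂ t₂ := by
  have h3 := ((h₁.comp_add t₁).separatrixRatio (by simpa) (by simpa using h₁.u_pos _ ht₁)).m_zero_eq
    ((h₂.comp_add t₂).separatrixRatio (by simpa) (by simpa using h₂.u_pos _ ht₂))
  simpa using h3

/-- The reflection about a is again a critical solution, so w/u at its zero t₁ to the right of a
equals w/u of x at 0. Shifted by t₁ and scaled, it has the initial data of x and coincides with x on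
the right of a. The critical points then give t₁ = 0, and the values at a give scale 1. -/
theorem reflection (h : CriticalSolution x u w w' a) (hx : x 0 = 0) (hu : 0 < u 0) (t : ℝ) :
    x (2 * a - t) = x t := by
  have ha := h.lt_of_u_pos hu
  have hz := h.comp_neg.comp_add (-(2 * a))
  obtain ⟨t₁, ht₁, hzt⟩ := hz.exists_zero
  have hrat := h.ratio_eq hz hx hzt ha ht₁
  have hu₁ := hz.u_pos t₁ ht₁
  set k := u 0 / -u (-(t₁ + -(2 * a))) with hk
  have hkpos : 0 < k := div_pos hu hu₁
  have hy := (hz.comp_add t₁).const_mul hkpos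
  have hw₀ := h.w_pos 0
  have hw₁ := h.w_pos (-(t₁ + -(2 * a)))
  obtain ⟨h1, h2⟩ := h.eq_right hy (by simpa using mul_pos hkpos hu₁)
    (by simp only [hx, zero_add, hzt, mul_zero])
    (by simp only [zero_add]; exact (div_mul_cancel₀ _ hu₁.ne').symm)
    (by
      simp only [hk, zero_add]
      rw [div_eq_div_iff hw₀.ne' hw₁.ne'] at hrat
      rw [div_mul_eq_mul_div, eq_div_iff hu₁.ne']
      linear_combination -hrat)
  have ht0 : t₁ = 0 := by linarith
  have hk1 : k = 1 := by
    have h3 := h2 a le_rfl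
    rw [ht0] at h3
    have h4 : -(a + 0 + -(2 * a)) = a := by ring
    rw [h4] at h3
    have h5 := h.x_crit_neg.ne
    have h6 : (k - 1) * x a = 0 := by linear_combination -h3
    rcases mul_eq_zero.1 h6 with h7 | h7
    · linarith
    · exact absurd h7 h5
  have key : ∀ s ≥ a, x (2 * a - s) = x s := fun s hs => by
    have h3 := h2 s hs
    rw [hk1, ht0, one_mul] at h3
    rw [h3]
    congr 1
    ring
  rcases le_total a t with h3 | h3
  · exact key t h3
  · have := key (2 * a - t) (by linarith)
    rw [← this]
    congr 1
    ring

/-- Uniqueness for the ratios stops at the critical point; the part beyond it is the mirror image of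
the part already determined. -/
theorem eq (h₁ : CriticalSolution x₁ u₁ w₁ w₁' a₁) (h₂ : CriticalSolution x₂ u₂ w₂ w₂' a₂)
    (hpos : 0 < u₂ 0) (hx₂ : x₂ 0 = 0) (hx : x₁ 0 = x₂ 0) (hu : u₁ 0 = u₂ 0) (hw : w₁ 0 = w₂ 0) :
    x₁ = x₂ := by
  obtain ⟨ha, heq⟩ := h₁.eq_right h₂ hpos hx hu hw
  funext t
  rcases le_total a₁ t with ht | ht
  · exact heq t ht
  · rw [← h₁.reflection (hx.trans hx₂) (hu ▸ hpos) t, ← h₂.reflection hx₂ hpos t, ← ha]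
    exact heq _ (by linarith)

end CriticalSolution

/-! ### The critical parameter T -/

/-- The normalised solution with a critical point: it determines the largest parameter. -/
structure IsCriticalParameter (T : ℝ) : Prop where
  pos : 0 < T
  exists_solution : ∃ y a, SolvesIVP T y ∧ ∃ u w w', CriticalSolution y u w w' a

theorem IsSmoothSolution.normalize {x : ℝ → ℝ} (h : IsSmoothSolution x) {t₁ : ℝ} (hx : x t₁ = 0)
    (hu : deriv x t₁ ≠ 0) :
    SolvesIVP ((iteratedDeriv 2 x t₁ - x t₁) / deriv x t₁)
      (fun t => (deriv x t₁)⁻¹ * x (t + t₁)) := by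
  have hs := (h.systemOn.comp_add t₁).const_mul (deriv x t₁)⁻¹
  refine solvesIVP_of_system hs (contDiff_const.mul (h.1.comp (by fun_prop))) ?_ ?_ ?_
  · simp [hx]
  · simp [hu]
  · simp only [zero_add]
    ring

theorem obtainedFrom_normalize {x : ℝ → ℝ} {t₁ c : ℝ} (hc : c ≠ 0) :
    ObtainedFrom x (fun t => c⁻¹ * x (t + t₁)) :=
  ⟨c, 1, -t₁, Or.inl rfl, fun t => by simp [hc]⟩

theorem exists_isCriticalParameter : ∃ T, IsCriticalParameter T := by
  obtain ⟨y, hy, hy0, hu0, hw0⟩ := exists_separatrix_solution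
  have hs := hy.systemOn
  have hc := hs.criticalSolution hu0 (by simp only [hw0, hy0]; norm_num)
  obtain ⟨t₁, ht₁, hyt⟩ := hc.exists_zero
  have hu := hc.u_pos t₁ ht₁
  refine ⟨_, div_pos (hc.w_pos t₁) hu, _, _, hy.normalize hyt hu.ne', _, _, _,
    (hc.comp_add t₁).const_mul (inv_pos.2 hu)⟩

theorem SolvesIVP.system {τ : ℝ} {x : ℝ → ℝ} (h : SolvesIVP τ x) :
    SystemOn univ x (deriv x) (fun t => iteratedDeriv 2 x t - x t)
      (fun t => iteratedDeriv 3 x t - deriv x t) := h.1.systemOn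

theorem SolvesIVP.w_zero {τ : ℝ} {x : ℝ → ℝ} (h : SolvesIVP τ x) :
    iteratedDeriv 2 x 0 - x 0 = τ := by
  rw [h.2.1, h.2.2.2, sub_zero]

theorem SolvesIVP.exists_ne_zero {τ : ℝ} {x : ℝ → ℝ} (h : SolvesIVP τ x) : ∃ t, x t ≠ 0 := by
  by_contra hcon
  push Not at hcon
  have h1 := h.2.2.1
  rw [show x = fun _ => 0 from funext hcon] at h1
  simp at h1

theorem SolvesIVP.w_pos {τ : ℝ} {x : ℝ → ℝ} (h : SolvesIVP τ x) (hτ : 0 < τ) :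
    ∀ t, 0 < iteratedDeriv 2 x t - x t := by
  have hne := (h.system.w_zero_or_ne_zero h.exists_ne_zero).resolve_left fun h0 =>
    hτ.ne' (h.w_zero ▸ h0 0)
  rcases SystemOn.sign_of_ne_zero ordConnected_univ h.system.continuous_w.continuousOn
    (fun t _ => hne t) with h1 | h1
  · exact fun t => h1 t trivial
  · have := h1 0 trivial
    rw [h.w_zero] at this
    exact absurd this (not_lt.2 hτ.le)

theorem SolvesIVP.pos_or_critical {τ : ℝ} {x : ℝ → ℝ} (h : SolvesIVP τ x) (hτ : 0 < τ) :
    (∀ t, 0 < deriv x t) ∨ ∃ a, CriticalSolution x (deriv x)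
      (fun t => iteratedDeriv 2 x t - x t) (fun t => iteratedDeriv 3 x t - deriv x t) a := by
  rcases h.system.critical_points h.exists_ne_zero with hu | ⟨a, ha, -, -⟩
  · left
    rcases SystemOn.sign_of_ne_zero ordConnected_univ h.system.continuous_u.continuousOn
      (fun t _ => hu t) with h1 | h1
    · exact fun t => h1 t trivial
    · have := h1 0 trivial
      rw [h.2.2.1] at this
      linarith
  · exact Or.inr ⟨a, h.system.criticalSolution ha (h.w_pos hτ a)⟩

namespace IsCriticalParameter

variable {T τ : ℝ} {x y : ℝ → ℝ}

theorem exists_separatrixRatio (hT : IsCriticalParameter T) :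
    ∃ b n m, SeparatrixRatio b n m ∧ m 0 = 1 / T := by
  obtain ⟨y, a, hy, u, w, w', hc⟩ := hT.exists_solution
  have hu : u 0 = 1 := by rw [← hc.deriv_eq]; exact hy.2.2.1
  have hw : w 0 = T := by
    have := hy.2.2.2
    rw [hc.iteratedDeriv_two_eq] at this
    simpa [hy.2.1] using this
  exact ⟨_, _, _, hc.separatrixRatio hy.2.1 (by simp [hu]), by simp [hu, hw]⟩

theorem eq_of_critical (hT : IsCriticalParameter T) (hx : SolvesIVP τ x) {a : ℝ}
    {u w w' : ℝ → ℝ} (hc : CriticalSolution x u w w' a) : τ = T := by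
  obtain ⟨b, n, m, hS, hm⟩ := hT.exists_separatrixRatio
  have hu : u 0 = 1 := by rw [← hc.deriv_eq]; exact hx.2.2.1
  have hw : w 0 = τ := by
    have := hx.2.2.2
    rw [hc.iteratedDeriv_two_eq] at this
    simpa [hx.2.1] using this
  have := (hc.separatrixRatio hx.2.1 (by simp [hu])).m_zero_eq hS
  simpa [hm, hu, hw] using this

/-- For τ = T the solution would agree with the critical one up to the zero of its u. For τ > T it
starts below the separatrix in m, so comparison makes m = u/w negative at the time when the
separatrix reaches m = 0. -/
theorem lt_of_pos (hT : IsCriticalParameter T) (hx : SolvesIVP τ x) (hτ : 0 < τ)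
    (hu : ∀ t, 0 < deriv x t) : τ < T := by
  have hw := hx.w_pos hτ
  by_contra hcon
  rcases eq_or_lt_of_le (not_lt.1 hcon) with rfl | hlt
  · obtain ⟨y, a, hy, u, w, w', hc⟩ := hT.exists_solution
    have hu0 : u 0 = 1 := by rw [← hc.deriv_eq]; exact hy.2.2.1
    have hw0 : w 0 = T := by
      have := hy.2.2.2
      rw [hc.iteratedDeriv_two_eq] at this
      simpa [hy.2.1] using this
    have := (hx.system.eq_at_end hc.toSystemOn (hc.lt_of_u_pos (by simp [hu0])) (fun t _ => hu t)
      hc.u_pos (hx.2.1.trans hy.2.1.symm) (hx.2.2.1.trans hu0.symm) (hx.w_zero.trans hw0.symm)).2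
    rw [hc.u_crit] at this
    exact (hu a).ne' this
  · obtain ⟨b, n, m, hS, hm⟩ := hT.exists_separatrixRatio
    have hR := hx.system.ratioOn (b := b) (fun t => (hw t).ne') fun t _ => div_pos (hu _) (hw _)
    have := (hS.toRatioOn.comparison hR hS.b_pos (by simp [hS.n_zero, hx.2.1])
      (by
        simp only [neg_zero, hx.w_zero, hx.2.2.1, hm]
        exact one_div_lt_one_div_of_lt hT.pos hlt)
      (Or.inr ⟨div_pos (hu _) (hw _), hS.n_mem⟩)).2
    rw [hS.m_end] at this
    simp only [neg_zero, hx.w_zero, hx.2.2.1, hm] at this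
    have h1 := one_div_lt_one_div_of_lt hT.pos hlt
    have h2 := div_pos (hu (-b)) (hw (-b))
    linarith

theorem le (hT : IsCriticalParameter T) (hx : SolvesIVP τ x) (hτ : 0 < τ) : τ ≤ T := by
  rcases hx.pos_or_critical hτ with h | ⟨a, h⟩
  · exact (hT.lt_of_pos hx hτ h).le
  · exact (hT.eq_of_critical hx h).le

theorem exists_solvesIVP (hT : IsCriticalParameter T) (hτ : 0 < τ) (hτT : τ ≤ T) :
    ∃ x, SolvesIVP τ x := by
  rcases eq_or_lt_of_le hτT with rfl | hlt
  · obtain ⟨y, -, hy, -⟩ := hT.exists_solution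
    exact ⟨y, hy⟩
  · obtain ⟨b, n, m, hS, hm⟩ := hT.exists_separatrixRatio
    exact _root_.exists_solvesIVP hS hτ (by rw [hm]; exact one_div_lt_one_div_of_lt hτ hlt)

/-- The value of τ decides whether a critical point exists, so two solutions are always of the same
type. -/
theorem unique (hT : IsCriticalParameter T) (hτ : 0 < τ) (hx : SolvesIVP τ x)
    (hy : SolvesIVP τ y) : x = y := by
  have h0 := hx.2.1.trans hy.2.1.symm
  have h1 := hx.2.2.1.trans hy.2.2.1.symm
  have h2 := hx.w_zero.trans hy.w_zero.symm
  rcases hx.pos_or_critical hτ with hux | ⟨a, hcx⟩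
  · rcases hy.pos_or_critical hτ with huy | ⟨b, hcy⟩
    · funext t
      exact (hx.system.eq_of_u_pos hy.system (a := min t 0 - 1)
        (by linarith [min_le_right t 0]) (fun s _ => hux s) (fun s _ => huy s) h0 h1 h2
        (by linarith [min_le_left t 0])).1
    · exact absurd (hT.eq_of_critical hy hcy) (hT.lt_of_pos hx hτ hux).ne
  · rcases hy.pos_or_critical hτ with huy | ⟨b, hcy⟩
    · exact absurd (hT.eq_of_critical hx hcx) (hT.lt_of_pos hy hτ huy).ne
    · exact hcx.eq hcy (by simp [hy.2.2.1]) hy.2.1 h0 h1 h2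

end IsCriticalParameter

/-! ### Expansions at infinity -/

/-- A bounded solution of a smooth equation on `(0, b)` extends smoothly to the end point `0`. -/
theorem exists_contDiffOn_update {E : Type*} [NormedAddCommGroup E] [NormedSpace ℝ E]
    [CompleteSpace E] {g : ℝ → E} {H : ℝ × E → E} {U : Set (ℝ × E)} {b M : ℝ} (hb : 0 < b)
    (hU : IsOpen U) (hH : ContDiffOn ℝ ∞ H U) (hg : ContDiffOn ℝ ∞ g (Ioi 0))
    (hd : ∀ s ∈ Ioo 0 b, HasDerivAt g (H (s, g s)) s) (hmem : ∀ s ∈ Ioo 0 b, (s, g s) ∈ U)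
    (hM : ∀ s ∈ Ioo 0 b, ‖H (s, g s)‖ ≤ M)
    (hlim : ∀ L, Tendsto g (𝓝[>] 0) (𝓝 L) → (0, L) ∈ U) :
    ∃ L, ContDiffOn ℝ ∞ (Function.update g 0 L) (Ici 0) := by
  have hnhds : Ioo 0 b ∈ 𝓝[>] (0 : ℝ) := Ioo_mem_nhdsGT hb
  -- A bounded derivative makes `g` uniformly continuous, so it has a limit at 0. The differential
  -- equation then gives a limit of the derivative and, by bootstrapping, all higher ones.
  have hlip : LipschitzOnWith M.toNNReal g (Ioo 0 b) :=
    (convex_Ioo 0 b).lipschitzOnWith_of_nnnorm_hasDerivWithin_le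
      (fun s hs => (hd s hs).hasDerivWithinAt) fun s hs => by
        rw [← NNReal.coe_le_coe, coe_nnnorm]
        exact (hM s hs).trans (Real.le_coe_toNNReal M)
  obtain ⟨L, hL⟩ := CompleteSpace.complete
    ((cauchy_nhds.mono (nhdsWithin_le_nhds (a := (0 : ℝ)) (s := Ioi 0))).map_of_le
      hlip.uniformContinuousOn (le_principal_iff.2 hnhds))
  have hL : Tendsto g (𝓝[>] 0) (𝓝 L) := hL
  have h0U := hlim L hL
  set G := Function.update g 0 L with hG
  have hG0 : G 0 = L := Function.update_self ..
  have hGs : ∀ s ≠ 0, G s = g s := fun s hs => Function.update_of_ne hs ..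
  have hev : ∀ s ∈ Ioi (0 : ℝ), G =ᶠ[𝓝 s] g := fun s hs => by
    filter_upwards [isOpen_Ioi.mem_nhds hs] with r hr using hGs r (ne_of_gt hr)
  have hGd : ∀ s ∈ Ioo 0 b, HasDerivAt G (H (s, G s)) s := fun s hs => by
    rw [hGs s hs.1.ne']
    exact (hd s hs).congr_of_eventuallyEq (hev s hs.1)
  have hGlim : Tendsto G (𝓝[>] 0) (𝓝 L) := hL.congr' (by
    filter_upwards [self_mem_nhdsWithin] with s hs using (hGs s (ne_of_gt hs)).symm)
  have hHc : ContinuousAt H (0, L) := hH.continuousOn.continuousAt (hU.mem_nhds h0U)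
  have hder0 : HasDerivWithinAt G (H (0, G 0)) (Ici 0) 0 := by
    refine hasDerivWithinAt_Ici_of_tendsto_deriv (s := Ioo 0 b)
      (fun s hs => (hGd s hs).differentiableAt.differentiableWithinAt) ?_ hnhds ?_
    · rw [ContinuousWithinAt, hG0]
      exact hGlim.mono_left (nhdsWithin_mono _ Ioo_subset_Ioi_self)
    · rw [hG0]
      have : Tendsto (fun s => H (s, G s)) (𝓝[>] 0) (𝓝 (H (0, L))) :=
        hHc.tendsto.comp ((tendsto_id.mono_left nhdsWithin_le_nhds).prodMk_nhds hGlim)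
      refine this.congr' ?_
      filter_upwards [hnhds] with s hs using (hGd s hs).deriv.symm
  have hsmooth : ContDiffOn ℝ ∞ G (Ico 0 b) := by
    refine contDiffOn_of_hasDerivWithinAt (uniqueDiffOn_Ico 0 b) hH (fun s hs => ?_) fun s hs => ?_
    · rcases eq_or_lt_of_le hs.1 with rfl | h
      · rwa [hG0]
      · rw [hGs s h.ne']
        exact hmem s ⟨h, hs.2⟩
    · rcases eq_or_lt_of_le hs.1 with rfl | h
      · exact hder0.mono Ico_subset_Ici_self
      · exact (hGd s ⟨h, hs.2⟩).hasDerivWithinAt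
  refine ⟨L, fun s hs => ?_⟩
  rcases eq_or_lt_of_le (show 0 ≤ s from hs) with rfl | h
  · exact (hsmooth 0 ⟨le_rfl, hb⟩).mono_of_mem_nhdsWithin (Ico_mem_nhdsGE hb)
  · exact ((hg.contDiffAt (isOpen_Ioi.mem_nhds h)).congr_of_eventuallyEq
      (hev s h)).contDiffWithinAt

/-- The expansions at `+∞` of `u` and `w u²`. -/
def HasAsymptotics (u w : ℝ → ℝ) : Prop :=
  ∃ ζ ν : ℝ → ℝ, SmoothOnHalfLine ζ ∧ SmoothOnHalfLine ν ∧ ∀ t : ℝ,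
    u t = Real.exp t * ζ (Real.exp (-2 * t)) ∧ w t * u t ^ 2 = Real.exp (-t) * ν (Real.exp (-2 * t))

/-- The equation in the variables `e^t (u - x)`, `e^(-t) u`, `e^t w u²`, for the time `e^(-2t)`. -/
noncomputable def endField (y : ℝ × ℝ × ℝ × ℝ) : ℝ × ℝ × ℝ :=
  (-y.2.2.2 / (2 * y.2.2.1 ^ 2), y.2.1 / 2 - y.1 * y.2.2.2 / (2 * y.2.2.1 ^ 2),
    -y.2.2.2 * y.2.1 / (2 * y.2.2.1))

theorem contDiffOn_endField : ContDiffOn ℝ ∞ endField {y | y.2.2.1 ≠ 0} := by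
  have h : ∀ y ∈ {y : ℝ × ℝ × ℝ × ℝ | y.2.2.1 ≠ 0}, 2 * y.2.2.1 ^ 2 ≠ 0 := fun y hy =>
    mul_ne_zero two_ne_zero (pow_ne_zero 2 hy)
  unfold endField
  refine ContDiffOn.prodMk (ContDiffOn.div (by fun_prop) (by fun_prop) h) (ContDiffOn.prodMk
    (ContDiffOn.sub (by fun_prop) (ContDiffOn.div (by fun_prop) (by fun_prop) h))
    (ContDiffOn.div (by fun_prop) (by fun_prop) fun y hy => mul_ne_zero two_ne_zero hy))

noncomputable def endState (x u w : ℝ → ℝ) (t : ℝ) : ℝ × ℝ × ℝ :=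
  (Real.exp t * (u t - x t), Real.exp (-t) * u t, Real.exp t * (w t * u t ^ 2))

namespace SystemOn

variable {x u w w' : ℝ → ℝ} {t₁ c C : ℝ}

/-- The scalar in front is ds/dt for s = e^(-2t); the remaining field is regular at s = 0. -/
theorem hasDerivAt_endState (h : SystemOn univ x u w w') {t : ℝ} (hu : u t ≠ 0) :
    HasDerivAt (endState x u w)
      ((-2 * Real.exp (-2 * t)) • endField (Real.exp (-2 * t), endState x u w t)) t := by
  have he := Real.hasDerivAt_exp t
  have hen := (hasDerivAt_neg t).exp
  have hx := h.hx t trivial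
  have hu' := h.hu t trivial
  have hv := h.hasDerivAt_v (t := t) trivial
  refine ((he.mul (hu'.sub hx)).prodMk ((hen.mul hu').prodMk (he.mul hv))).congr_deriv ?_
  have e1 : Real.exp (-2 * t) = (Real.exp t)⁻¹ ^ 2 := by
    rw [← Real.exp_neg, ← Real.exp_nat_mul]; congr 1; push_cast; ring
  have e2 : Real.exp (-t) = (Real.exp t)⁻¹ := Real.exp_neg t
  have e3 := (Real.exp_pos t).ne'
  simp only [endField, endState, e1, e2, Prod.smul_mk, Prod.mk.injEq, smul_eq_mul, Pi.sub_apply]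
  refine ⟨?_, ?_, ?_⟩
  · field_simp
    ring
  · field_simp
    ring
  · field_simp
    ring

end SystemOn

theorem abs_le_of_abs_deriv_le_exp {f f' : ℝ → ℝ} {t₁ K : ℝ} (hf : ∀ t, HasDerivAt f (f' t) t)
    (hK : ∀ t ≥ t₁, |f' t| ≤ K * Real.exp (-t)) {t : ℝ} (ht : t₁ ≤ t) :
    |f t| ≤ |f t₁| + K * Real.exp (-t₁) := by
  have hK0 : 0 ≤ K := nonneg_of_mul_nonneg_left ((abs_nonneg _).trans (hK t₁ le_rfl))
    (Real.exp_pos _)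
  have hfc : Continuous f := continuous_iff_continuousAt.2 fun s => (hf s).continuousAt
  have hexp : ∀ s, HasDerivAt (fun s => K * Real.exp (-s)) (K * (Real.exp (-s) * -1)) s :=
    fun s => ((hasDerivAt_neg s).exp).const_mul K
  have h1 := le_of_hasDerivAt_nonneg (f := fun s => f s - K * Real.exp (-s)) ht (by fun_prop)
    (fun s _ => (hf s).sub (hexp s)) fun s hs => by
      have := (abs_le.1 (hK s hs.1.le)).1
      linarith
  have h2 := le_of_hasDerivAt_nonneg (f := fun s => -f s - K * Real.exp (-s)) ht (by fun_prop)
    (fun s _ => (hf s).fun_neg.sub (hexp s)) fun s hs => by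
      have := (abs_le.1 (hK s hs.1.le)).2
      linarith
  have h3 : 0 ≤ K * Real.exp (-t) := mul_nonneg hK0 (Real.exp_pos _).le
  have h4 := abs_le.1 (le_refl |f t₁|)
  exact abs_le.2 ⟨by linarith, by linarith⟩

namespace SystemOn

variable {x u w w' : ℝ → ℝ} {t₁ c C : ℝ}

/-- The derivative of e^t(u - x) is e^t w, and |w| ≤ C/u² ≤ (C/c²)e^(-2t) makes it integrable. -/
theorem exists_bound_sub (h : SystemOn univ x u w w') (hc : 0 < c)
    (hu : ∀ t ≥ t₁, c * Real.exp t ≤ u t) (hv : ∀ t ≥ t₁, |w t * u t ^ 2| ≤ C) :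
    ∃ Θ, ∀ t ≥ t₁, |Real.exp t * (u t - x t)| ≤ Θ := by
  refine ⟨_, fun t ht => abs_le_of_abs_deriv_le_exp (t₁ := t₁)
    (f := fun t => Real.exp t * (u t - x t)) (f' := fun t => Real.exp t * w t)
    (K := C / c ^ 2) (fun t => ?_) (fun t ht => ?_) ht⟩
  · refine ((Real.hasDerivAt_exp t).mul ((h.hu t trivial).sub (h.hx t trivial))).congr_deriv ?_
    simp only [Pi.sub_apply]
    ring
  · have he := Real.exp_pos t
    have h1 := hu t ht
    have h2 := hv t ht
    rw [abs_mul, abs_pow] at h2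
    rw [abs_mul, abs_of_pos he, Real.exp_neg, ← div_eq_mul_inv, div_div, le_div_iff₀ (by positivity)]
    have h3 : (c * Real.exp t) ^ 2 ≤ |u t| ^ 2 :=
      pow_le_pow_left₀ (by positivity) (h1.trans (le_abs_self _)) 2
    calc Real.exp t * |w t| * (c ^ 2 * Real.exp t) = |w t| * (c * Real.exp t) ^ 2 := by ring
      _ ≤ |w t| * |u t| ^ 2 := by gcongr
      _ ≤ C := h2

/-- The logarithmic derivative of e^t w u² is (u - x)/u, which is at most (Θ/c)e^(-2t) and so has
bounded integral. -/
theorem exists_bound_v (h : SystemOn univ x u w w') (hc : 0 < c)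
    (hu : ∀ t ≥ t₁, c * Real.exp t ≤ u t) {Θ : ℝ}
    (hΘ : ∀ t ≥ t₁, |Real.exp t * (u t - x t)| ≤ Θ) :
    ∃ N, ∀ t ≥ t₁, |Real.exp t * (w t * u t ^ 2)| ≤ N := by
  set ν : ℝ → ℝ := fun t => Real.exp t * (w t * u t ^ 2) with hν
  have hνd : ∀ t ≥ t₁, HasDerivAt ν (ν t * ((u t - x t) / u t)) t := fun t ht => by
    have h0 : u t ≠ 0 := ((mul_pos hc (Real.exp_pos t)).trans_le (hu t ht)).ne'
    refine ((Real.hasDerivAt_exp t).mul (h.hasDerivAt_v (t := t) trivial)).congr_deriv ?_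
    simp only [hν]
    field_simp
    ring
  have hbound : ∀ t ≥ t₁, (u t - x t) / u t ≤ Θ / c * Real.exp (-2 * t) := fun t ht => by
    have he := Real.exp_pos t
    have h1 := hu t ht
    have h0 : 0 < u t := (mul_pos hc he).trans_le h1
    have h2 := (abs_le.1 (hΘ t ht)).2
    have hΘ0 : 0 ≤ Θ := (abs_nonneg _).trans (hΘ t ht)
    have e1 : Real.exp (-2 * t) = (Real.exp t ^ 2)⁻¹ := by
      rw [← Real.exp_nat_mul, ← Real.exp_neg]; congr 1; push_cast; ring
    rw [e1, div_le_iff₀ h0]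
    calc u t - x t = Real.exp t * (u t - x t) * (Real.exp t)⁻¹ := by field_simp
      _ ≤ Θ * (Real.exp t)⁻¹ := by gcongr
      _ = Θ / c * (Real.exp t ^ 2)⁻¹ * (c * Real.exp t) := by field_simp
      _ ≤ Θ / c * (Real.exp t ^ 2)⁻¹ * u t := by gcongr
  -- The exponential compensates the growth of ν²: its exponent has derivative -2(Θ/c)e^(-2t), so -f
  -- is nonincreasing.
  set f : ℝ → ℝ := fun t => -(ν t ^ 2 * Real.exp (Θ / c * Real.exp (-2 * t))) with hf
  have hfd : ∀ t ≥ t₁, HasDerivAt f (2 * ν t ^ 2 * Real.exp (Θ / c * Real.exp (-2 * t)) *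
      (Θ / c * Real.exp (-2 * t) - (u t - x t) / u t)) t := fun t ht => by
    have hin : HasDerivAt (fun t : ℝ => -2 * t) (-2) t := by
      simpa using (hasDerivAt_id t).const_mul (-2 : ℝ)
    refine (((hνd t ht).fun_pow 2).mul ((hin.exp.const_mul (Θ / c)).exp)).fun_neg.congr_deriv ?_
    push_cast
    ring
  have hmono : ∀ t ≥ t₁, f t₁ ≤ f t := fun t ht =>
    le_of_hasDerivAt_nonneg ht (fun s hs => (hfd s hs.1).continuousAt.continuousWithinAt)
      (fun s hs => hfd s hs.1.le) fun s hs =>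
        mul_nonneg (by positivity) (sub_nonneg.2 (hbound s hs.1.le))
  refine ⟨1 + -f t₁, fun t ht => ?_⟩
  have h1 := hmono t ht
  have hΘ0 : 0 ≤ Θ := (abs_nonneg _).trans (hΘ t ht)
  have h2 : 1 ≤ Real.exp (Θ / c * Real.exp (-2 * t)) := Real.one_le_exp (by positivity)
  have h3 : ν t ^ 2 ≤ -f t := by
    simp only [hf, neg_neg]
    nlinarith [sq_nonneg (ν t)]
  have h4 : |ν t| ≤ 1 + ν t ^ 2 := abs_le.2 ⟨by nlinarith, by nlinarith⟩
  change |ν t| ≤ _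
  linarith

theorem exists_norm_endField_le (h : SystemOn univ x u w w') (hc : 0 < c)
    (hu : ∀ t ≥ t₁, c * Real.exp t ≤ u t) (hv : ∀ t ≥ t₁, |w t * u t ^ 2| ≤ C) :
    ∃ M, ∀ t ≥ t₁, ‖endField (Real.exp (-2 * t), endState x u w t)‖ ≤ M := by
  obtain ⟨Θ, hΘ⟩ := h.exists_bound_sub hc hu hv
  obtain ⟨N, hN⟩ := h.exists_bound_v hc hu hΘ
  have hΘ0 : 0 ≤ Θ := (abs_nonneg _).trans (hΘ t₁ le_rfl)
  have hN0 : 0 ≤ N := (abs_nonneg _).trans (hN t₁ le_rfl)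
  refine ⟨N / (2 * c ^ 2) + (Θ / 2 + Real.exp (-2 * t₁) * N / (2 * c ^ 2)) + N * Θ / (2 * c),
    fun t ht => ?_⟩
  have hζ : c ≤ Real.exp (-t) * u t := by
    rw [Real.exp_neg, inv_mul_eq_div, le_div_iff₀ (Real.exp_pos t)]
    exact hu t ht
  have hs : |Real.exp (-2 * t)| ≤ Real.exp (-2 * t₁) := by
    rw [abs_of_pos (Real.exp_pos _)]
    exact Real.exp_le_exp.2 (by linarith)
  have hθ := hΘ t ht
  have hν := hN t ht
  simp only [endField, endState]
  set ζ := Real.exp (-t) * u t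
  set θ := Real.exp t * (u t - x t)
  set ν := Real.exp t * (w t * u t ^ 2)
  have hζ0 : 0 < ζ := hc.trans_le hζ
  have a1 : |-ν / (2 * ζ ^ 2)| ≤ N / (2 * c ^ 2) := by
    rw [abs_div, abs_neg, abs_of_pos (by positivity : 0 < 2 * ζ ^ 2)]
    gcongr
  have a2 : |θ / 2 - Real.exp (-2 * t) * ν / (2 * ζ ^ 2)| ≤
      Θ / 2 + Real.exp (-2 * t₁) * N / (2 * c ^ 2) := by
    refine (abs_sub _ _).trans (add_le_add ?_ ?_)
    · rw [abs_div, abs_two]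
      gcongr
    · rw [abs_div, abs_mul, abs_of_pos (by positivity : 0 < 2 * ζ ^ 2)]
      gcongr
  have a3 : |-ν * θ / (2 * ζ)| ≤ N * Θ / (2 * c) := by
    rw [abs_div, abs_mul, abs_neg, abs_of_pos (by positivity : 0 < 2 * ζ)]
    gcongr
  have b1 : 0 ≤ N / (2 * c ^ 2) := by positivity
  have b2 : 0 ≤ Θ / 2 + Real.exp (-2 * t₁) * N / (2 * c ^ 2) := by positivity
  have b3 : 0 ≤ N * Θ / (2 * c) := by positivity
  rw [Prod.norm_def, Prod.norm_def, Real.norm_eq_abs, Real.norm_eq_abs, Real.norm_eq_abs]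
  exact max_le (by linarith) (max_le (by linarith) (by linarith))

theorem hasAsymptotics (h : SystemOn univ x u w w') (hx : ContDiff ℝ ∞ x) (hc : 0 < c)
    (hu : ∀ t ≥ t₁, c * Real.exp t ≤ u t) (hv : ∀ t ≥ t₁, |w t * u t ^ 2| ≤ C) :
    HasAsymptotics u w := by
  obtain ⟨M, hM⟩ := h.exists_norm_endField_le hc hu hv
  have hux : ContDiff ℝ ∞ u := h.deriv_eq ▸ (contDiff_infty_iff_deriv.1 hx).2
  have hwx : ContDiff ℝ ∞ w := by
    have h1 : w = fun t => deriv u t - x t := funext fun t => by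
      rw [(h.hu t trivial).deriv]
      ring
    rw [h1]
    exact (contDiff_infty_iff_deriv.1 hux).2.sub hx
  have hk : ContDiff ℝ ∞ (endState x u w) := by
    have he := Real.contDiff_exp (n := ∞)
    unfold endState
    fun_prop
  have hT : ∀ s > 0, Real.exp (-2 * (-Real.log s / 2)) = s := fun s hs => by
    rw [show -2 * (-Real.log s / 2) = Real.log s by ring, Real.exp_log hs]
  have hT1 : ∀ s ∈ Ioo 0 (Real.exp (-2 * t₁)), t₁ ≤ -Real.log s / 2 := fun s hs => by
    have := Real.log_lt_log hs.1 hs.2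
    rw [Real.log_exp] at this
    linarith
  have hζ : ∀ s ∈ Ioo 0 (Real.exp (-2 * t₁)), c ≤ (endState x u w (-Real.log s / 2)).2.1 :=
    fun s hs => by
      simp only [endState]
      rw [Real.exp_neg, inv_mul_eq_div, le_div_iff₀ (Real.exp_pos _)]
      exact hu _ (hT1 s hs)
  obtain ⟨L, hL⟩ := exists_contDiffOn_update (g := fun s => endState x u w (-Real.log s / 2))
    (H := endField) (U := {y | y.2.2.1 ≠ 0}) (M := M) (Real.exp_pos (-2 * t₁))
    (isOpen_ne_fun (by fun_prop) continuous_const) contDiffOn_endField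
    (hk.comp_contDiffOn (by
      have : ContDiffOn ℝ ∞ Real.log (Ioi 0) := Real.contDiffOn_log.mono fun s hs => ne_of_gt hs
      exact this.neg.div_const 2))
    (fun s hs => by
      have hs0 := hs.1
      have hne : u (-Real.log s / 2) ≠ 0 :=
        ((mul_pos hc (Real.exp_pos _)).trans_le (hu _ (hT1 s hs))).ne'
      have hd := (h.hasDerivAt_endState hne).scomp s
        ((Real.hasDerivAt_log hs0.ne').fun_neg.div_const 2)
      refine hd.congr_deriv ?_
      rw [hT s hs0, smul_smul]
      have : -s⁻¹ / 2 * (-2 * s) = 1 := by field_simp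
      rw [this, one_smul])
    (fun s hs => (hc.trans_le (hζ s hs)).ne')
    (fun s hs => by
      have := hM _ (hT1 s hs)
      rwa [hT s hs.1] at this)
    (fun L hL => by
      refine (hc.trans_le (ge_of_tendsto (((continuous_fst.comp continuous_snd).tendsto L).comp hL)
        ?_)).ne'
      filter_upwards [Ioo_mem_nhdsGT (Real.exp_pos (-2 * t₁))] with s hs using hζ s hs)
  refine ⟨_, _, hL.snd.fst, hL.snd.snd, fun t => ?_⟩
  have e1 : -Real.log (Real.exp (-2 * t)) / 2 = t := by
    rw [Real.log_exp]
    ring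
  simp only [Function.update_of_ne (Real.exp_pos (-2 * t)).ne', e1, endState]
  rw [← mul_assoc, ← mul_assoc, ← Real.exp_add, ← Real.exp_add]
  simp

end SystemOn

namespace HasAsymptotics

variable {u w : ℝ → ℝ}

theorem const_mul (h : HasAsymptotics u w) (c d : ℝ) :
    HasAsymptotics (fun t => c * u t) (fun t => d * w t) := by
  obtain ⟨ζ, ν, hζ, hν, h⟩ := h
  refine ⟨fun z => c * ζ z, fun z => d * c ^ 2 * ν z, contDiffOn_const.mul hζ,
    contDiffOn_const.mul hν, fun t => ⟨?_, ?_⟩⟩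
  · linear_combination c * (h t).1
  · linear_combination d * c ^ 2 * (h t).2

theorem comp_add (h : HasAsymptotics u w) (c : ℝ) :
    HasAsymptotics (fun t => u (t + c)) (fun t => w (t + c)) := by
  obtain ⟨ζ, ν, hζ, hν, h⟩ := h
  have hmul : ContDiffOn ℝ ∞ (fun z => Real.exp (-2 * c) * z) (Ici 0) :=
    contDiffOn_const.mul contDiffOn_id
  have hmaps : MapsTo (fun z => Real.exp (-2 * c) * z) (Ici 0) (Ici 0) := fun z hz =>
    mul_nonneg (Real.exp_pos _).le hz
  refine ⟨fun z => Real.exp c * ζ (Real.exp (-2 * c) * z),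
    fun z => Real.exp (-c) * ν (Real.exp (-2 * c) * z), contDiffOn_const.mul (hζ.comp hmul hmaps),
    contDiffOn_const.mul (hν.comp hmul hmaps), fun t => ?_⟩
  beta_reduce
  rw [← Real.exp_add, ← mul_assoc, ← mul_assoc, ← Real.exp_add, ← Real.exp_add, (h (t + c)).2,
    (h (t + c)).1]
  refine ⟨by ring_nf, by ring_nf⟩

end HasAsymptotics

/-! ### Exponential growth of u -/

namespace SystemOn

variable {x u w w' : ℝ → ℝ}

theorem monotoneOn_x (h : SystemOn univ x u w w') {a b : ℝ} (hab : a ≤ b)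
    (hu : ∀ t ≥ a, 0 < u t) : x a ≤ x b :=
  le_of_hasDerivAt_nonneg hab h.continuous_x.continuousOn (fun t _ => h.hx t trivial)
    fun t ht => (hu t ht.1.le).le

theorem hasDerivAt_exp_neg_mul (h : SystemOn univ x u w w') (t : ℝ) :
    HasDerivAt (fun t => Real.exp (-t) * (u t + x t)) (Real.exp (-t) * w t) t := by
  refine ((hasDerivAt_neg t).exp.mul ((h.hu t trivial).add (h.hx t trivial))).congr_deriv ?_
  simp only [Pi.add_apply]
  ring

/-- Since w > 0, e^(-t)(u + x) is nondecreasing and u ≥ x, so u is at least half of e^t u(0). Since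
x ≥ 0, w u² is nonincreasing. -/
theorem hasAsymptotics_of_pos (h : SystemOn univ x u w w') (hxc : ContDiff ℝ ∞ x) (hx : x 0 = 0)
    (hu : ∀ t ≥ 0, 0 < u t) (hw : ∀ t ≥ 0, 0 < w t) : HasAsymptotics u w := by
  have hxn : ∀ t ≥ 0, 0 ≤ x t := fun t ht => hx ▸ h.monotoneOn_x ht hu
  have huc := h.continuous_u
  have hxc' := h.continuous_x
  have hwc := h.continuous_w
  refine h.hasAsymptotics hxc (t₁ := 0) (c := u 0 / 2) (C := w 0 * u 0 ^ 2)
    (half_pos (hu 0 le_rfl)) (fun t ht => ?_) fun t ht => ?_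
  · have h1 := le_of_hasDerivAt_nonneg (f := fun t => Real.exp (-t) * (u t + x t)) ht (by fun_prop)
      (fun s _ => h.hasDerivAt_exp_neg_mul s)
      fun s hs => mul_nonneg (Real.exp_pos _).le (hw s hs.1.le).le
    have h2 := nonneg_of_linear_ineq (f := fun t => u t - x t) (A := w) (d := fun _ => -1) ht
      (by fun_prop) continuousOn_const
      (fun s _ => ((h.hu s trivial).sub (h.hx s trivial)).congr_deriv (by ring))
      (fun s hs => (hw s hs.1.le).le) (by simpa [hx] using (hu 0 le_rfl).le)
    simp only [neg_zero, Real.exp_zero, one_mul, hx, add_zero] at h1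
    rw [Real.exp_neg, inv_mul_eq_div, le_div_iff₀ (Real.exp_pos t)] at h1
    linarith
  · have h1 := le_of_hasDerivAt_nonneg (f := fun t => -(w t * u t ^ 2)) ht (by fun_prop)
      (fun s _ => (h.hasDerivAt_v (t := s) trivial).fun_neg) fun s hs => by
        rw [neg_neg]
        exact mul_nonneg (mul_nonneg (hxn s hs.1.le) (hu s hs.1.le).le) (hw s hs.1.le).le
    rw [abs_of_nonneg (mul_nonneg (hw t ht).le (sq_nonneg _))]
    linarith

theorem reversedRatioOn (h : SystemOn univ x u w w') (hu : ∀ t, 0 < u t) (hw : ∀ t, w t < 0)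
    (hx : 0 ≤ x 0) (b : ℝ) : ReversedRatioOn b (fun t => x t / u t) (fun t => -w t / u t) where
  cP := h.continuous_x.continuousOn.div h.continuous_u.continuousOn fun t _ => (hu t).ne'
  cR := h.continuous_w.neg.continuousOn.div h.continuous_u.continuousOn fun t _ => (hu t).ne'
  hP t _ := (h.hasDerivAt_ratio (hu t).ne').fst_comp.congr_deriv (by simp only [ratioField]; ring)
  hR t _ := by
    have := (h.hasDerivAt_ratio (hu t).ne').snd_comp.fun_neg
    simp only [← neg_div] at this
    exact this.congr_deriv (by simp only [ratioField]; ring)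
  P_zero := div_nonneg hx (hu 0).le
  R_zero := div_pos (neg_pos.2 (hw 0)) (hu 0)

/-- Here w < 0 could erode A = e^(-t)(u + x), at relative rate at most R = -w/u. The inequality R ≤
P = x/u persists, and then q = R/P satisfies q' ≤ -R. Thus A e^(-q) is nondecreasing; together with
a bound on P this bounds u below. -/
theorem exists_exp_le_of_add_nonneg (h : SystemOn univ x u w w') (hu : ∀ t, 0 < u t)
    (hw : ∀ t, w t < 0) (hxw : 0 ≤ x 0 + w 0) {K : ℝ} (hK : ∀ t ≥ 0, -w t / u t ≤ K) :
    ∃ c > 0, ∀ t ≥ 0, c * Real.exp t ≤ u t := by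
  have hx0 : 0 ≤ x 0 := by linarith [hw 0]
  have hrat := h.reversedRatioOn hu hw hx0
  have huc := h.continuous_u
  have hxc := h.continuous_x
  have hwc := h.continuous_w
  have hxn : ∀ t ≥ 0, 0 ≤ x t := fun t ht => hx0.trans (h.monotoneOn_x ht fun t _ => hu t)
  have hK0 : 0 ≤ K := (hrat 0).R_zero.le.trans (hK 0 le_rfl)
  set P : ℝ → ℝ := fun t => x t / u t with hP
  set R : ℝ → ℝ := fun t => -w t / u t with hR
  have hRpos : ∀ t, 0 < R t := fun t => div_pos (neg_pos.2 (hw t)) (hu t)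
  have hPc : Continuous P := hxc.div huc fun t => (hu t).ne'
  have hRc : Continuous R := hwc.neg.div huc fun t => (hu t).ne'
  have hD : ∀ t ≥ 0, R t ≤ P t := fun t ht => by
    have := nonneg_of_linear_ineq (f := fun t => P t - R t) (A := fun t => 1 + R t ^ 2)
      (d := fun t => -(P t - 4 * R t)) ht (by fun_prop) (by fun_prop)
      (fun s hs => (((hrat t).hP s hs).sub ((hrat t).hR s hs)).congr_deriv (by ring))
      (fun s _ => by positivity) (by
        simp only [hP, hR]
        rw [← sub_div]
        exact div_nonneg (by linarith) (hu 0).le)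
    linarith
  set K' := max K (P 0)
  have hPle : ∀ t ≥ 0, P t ≤ K' + 1 := fun t ht =>
    (hrat t).P_le ht (fun s hs => (hK s hs.1.le).trans (le_max_left _ _))
      (by linarith [le_max_right K (P 0)]) (hK0.trans (le_max_left _ _))
  have hPpos : ∀ t ≥ 0, 0 < P t := fun t ht => (hRpos t).trans_le (hD t ht)
  have hA := fun t => h.hasDerivAt_exp_neg_mul t
  set A : ℝ → ℝ := fun t => Real.exp (-t) * (u t + x t) with hAdef
  have hq : ∀ t > 0, HasDerivAt (fun t => R t / P t)
      (R t * (2 * R t * P t - 3 * P t ^ 2 - 1) / P t ^ 2) t := fun t ht => by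
    have hmem : t ∈ Ioo 0 (t + 1) := ⟨ht, by linarith⟩
    refine (((hrat _).hR t hmem).div ((hrat _).hP t hmem) (hPpos t ht.le).ne').congr_deriv ?_
    ring
  have hAle : ∀ t ≥ 0, A 0 * Real.exp (-(R 0 / P 0)) ≤ A t * Real.exp (-(R t / P t)) :=
    fun t ht => by
    refine le_of_hasDerivAt_nonneg (f := fun t => A t * Real.exp (-(R t / P t))) ht ?_
      (fun s hs => (hA s).mul (hq s hs.1).fun_neg.exp) fun s hs => ?_
    · have hAc : Continuous A := by fun_prop
      exact hAc.continuousOn.mul (Real.continuous_exp.comp_continuousOn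
        (hRc.continuousOn.div hPc.continuousOn fun s hs => (hPpos s hs.1).ne').neg)
    · have hs0 := hs.1.le
      have hPs := hPpos s hs0
      have hRs := hRpos s
      have hq' : R s * (2 * R s * P s - 3 * P s ^ 2 - 1) / P s ^ 2 ≤ -R s := by
        rw [div_le_iff₀ (by positivity)]
        nlinarith [mul_nonneg hRs.le (mul_nonneg hPs.le (sub_nonneg.2 (hD s hs0)))]
      have hA' : -(R s * A s) ≤ Real.exp (-s) * w s := by
        have h1 : R s * u s = -w s := div_mul_cancel₀ _ (hu s).ne'
        have h2 : Real.exp (-s) * w s = -(R s * (Real.exp (-s) * u s)) := by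
          linear_combination Real.exp (-s) * h1
        rw [h2]
        have h3 := mul_nonneg hRs.le (mul_nonneg (Real.exp_pos (-s)).le (hxn s hs0))
        simp only [hAdef]
        linarith
      have hA0 : 0 ≤ A s := mul_nonneg (Real.exp_pos _).le (add_nonneg (hu s).le (hxn s hs0))
      have he := (Real.exp_pos (-(R s / P s))).le
      have key : 0 ≤ Real.exp (-s) * w s -
          A s * (R s * (2 * R s * P s - 3 * P s ^ 2 - 1) / P s ^ 2) := by
        nlinarith [mul_le_mul_of_nonneg_left hq' hA0]
      calc (0 : ℝ) ≤ Real.exp (-(R s / P s)) * (Real.exp (-s) * w s -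
          A s * (R s * (2 * R s * P s - 3 * P s ^ 2 - 1) / P s ^ 2)) := mul_nonneg he key
        _ = _ := by ring
  set c₁ := A 0 * Real.exp (-(R 0 / P 0)) with hc₁
  have hA0 : ∀ t ≥ 0, 0 < A t := fun t ht =>
    mul_pos (Real.exp_pos _) (add_pos_of_pos_of_nonneg (hu t) (hxn t ht))
  have hK1 : 0 < 2 + K' := by linarith [hK0.trans (le_max_left K (P 0))]
  refine ⟨c₁ / (2 + K'), div_pos (mul_pos (hA0 0 le_rfl) (Real.exp_pos _)) hK1, fun t ht => ?_⟩
  have h1 : c₁ ≤ A t := (hAle t ht).trans (mul_le_of_le_one_right (hA0 t ht).le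
    (Real.exp_le_one_iff.2 (neg_nonpos.2 (div_nonneg (hRpos t).le (hPpos t ht).le))))
  have h2 : x t ≤ (K' + 1) * u t := (div_le_iff₀ (hu t)).1 (hPle t ht)
  simp only [hAdef] at h1
  rw [Real.exp_neg, inv_mul_eq_div, le_div_iff₀ (Real.exp_pos t)] at h1
  rw [div_mul_eq_mul_div, div_le_iff₀ hK1]
  linarith

theorem exists_exp_le_of_shift {t₁ : ℝ}
    (h : ∃ t₂, ∃ c > 0, ∀ t ≥ t₂, c * Real.exp t ≤ u (t + t₁)) :
    ∃ t₂, ∃ c > 0, ∀ t ≥ t₂, c * Real.exp t ≤ u t := by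
  obtain ⟨t₂, c, hc, h⟩ := h
  refine ⟨t₂ + t₁, c * Real.exp (-t₁), mul_pos hc (Real.exp_pos _), fun t ht => ?_⟩
  have := h (t - t₁) (by linarith)
  rw [sub_add_cancel, sub_eq_neg_add, Real.exp_add, ← mul_assoc] at this
  exact this

/-- With R ≤ K and n > 2/3, where n = P/R, one has n' ≥ m = 1/R ≥ 1/K. So n ≥ 1 at time K, which
means x + w ≥ 0 there. -/
theorem exists_exp_le_of_G_pos (h : SystemOn univ x u w w') (hu : ∀ t, 0 < u t)
    (hw : ∀ t, w t < 0) (hx : 0 ≤ x 0) (hG : 0 < 3 * x 0 + 2 * w 0) :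
    ∃ t₂, ∃ c > 0, ∀ t ≥ t₂, c * Real.exp t ≤ u t := by
  have hrat := h.reversedRatioOn hu hw hx
  have hG' : 0 < 3 * (x 0 / u 0) - 2 * (-w 0 / u 0) := by
    have : 3 * (x 0 / u 0) - 2 * (-w 0 / u 0) = (3 * x 0 + 2 * w 0) / u 0 := by ring
    rw [this]
    exact div_pos hG (hu 0)
  obtain ⟨K, hK⟩ : ∃ K, ∀ t ≥ 0, -w t / u t ≤ K := ⟨_, fun t ht => (hrat t).R_le ht hG' rfl⟩
  have hRpos : ∀ t, 0 < -w t / u t := fun t => div_pos (neg_pos.2 (hw t)) (hu t)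
  have hK0 : 0 < K := (hRpos 0).trans_le (hK 0 le_rfl)
  have hr := (hrat K).ratioOn
  have hn := le_of_hasDerivAt_nonneg
    (f := fun t => x t / u t / (-w t / u t) - 1 / K * t) hK0.le
    (hr.cn.sub (by fun_prop))
    (fun t ht => (hr.hn t ht).sub ((hasDerivAt_id t).const_mul (1 / K))) fun t ht => by
      have h1 := hRpos t
      have h2 := one_div_le_one_div_of_le h1 (hK t ht.1.le)
      have h3 : 0 < 3 * (x t / u t) - 2 * (-w t / u t) := (hrat t).G_pos ht.1.le hG'
      have h4 : 2 < 3 * (x t / u t / (-w t / u t)) := by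
        rw [← mul_div_assoc, lt_div_iff₀ h1]
        linarith
      have h5 : 0 ≤ x t / u t / (-w t / u t) * (3 * (x t / u t / (-w t / u t)) - 2) /
          (1 / (-w t / u t)) :=
        div_nonneg (mul_nonneg (by linarith) (by linarith)) (one_div_pos.2 h1).le
      linarith
  have hn0 : 0 ≤ x 0 / u 0 / (-w 0 / u 0) := div_nonneg (div_nonneg hx (hu 0).le) (hRpos 0).le
  have h1 : 1 ≤ x K / u K / (-w K / u K) := by
    have : 1 / K * K = 1 := one_div_mul_cancel hK0.ne'
    linarith
  rw [le_div_iff₀ (hRpos K), one_mul, div_le_div_iff_of_pos_right (hu K)] at h1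
  have h2 := (h.comp_add K).exists_exp_le_of_add_nonneg (fun t => hu _) (fun t => hw _)
    (by simp only [zero_add]; linarith) (K := K) fun t ht => hK _ (by linarith)
  exact exists_exp_le_of_shift ⟨0, h2⟩

theorem exists_exp_le (h : SystemOn univ x u w w') (hu : ∀ t, 0 < u t)
    (hw : ∀ t, w t < 0) (hx : 0 ≤ x 0) :
    ∃ t₂, ∃ c > 0, ∀ t ≥ t₂, c * Real.exp t ≤ u t := by
  by_cases hG : ∃ t ≥ 0, 0 < 3 * x t + 2 * w t
  · obtain ⟨t₁, ht₁, hG⟩ := hG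
    exact exists_exp_le_of_shift ((h.comp_add t₁).exists_exp_le_of_G_pos (fun t => hu _)
      (fun t => hw _) (by simpa using hx.trans (h.monotoneOn_x ht₁ fun t _ => hu t)) (by simpa))
  · exfalso
    push Not at hG
    have hRpos : ∀ t, 0 < -w t / u t := fun t => div_pos (neg_pos.2 (hw t)) (hu t)
    -- If 3x + 2w ≤ 0 for all t ≥ 0, then n ≤ 2/3 and m' = 4n - 3 ≤ -1/3, so m would reach 0 by time
    -- 3m(0).
    set b := 3 * (1 / (-w 0 / u 0)) with hb
    have hb0 : 0 ≤ b := mul_nonneg (by norm_num) (one_div_pos.2 (hRpos 0)).le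
    have hr := (h.reversedRatioOn hu hw hx b).ratioOn
    have hm := le_of_hasDerivAt_nonneg (f := fun t => -(1 / (-w t / u t)) - 1 / 3 * t) hb0
      (hr.cm.fun_neg.sub (by fun_prop))
      (fun t ht => (hr.hm t ht).fun_neg.sub ((hasDerivAt_id t).const_mul (1 / 3))) fun t ht => by
        have h1 : x t / u t / (-w t / u t) ≤ 2 / 3 := by
          rw [div_le_iff₀ (hRpos t), ← mul_div_assoc, div_le_div_iff_of_pos_right (hu t)]
          linarith [hG t ht.1.le]
        linarith
    have h2 := one_div_pos.2 (hRpos b)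
    linarith

theorem hasAsymptotics_of_neg (h : SystemOn univ x u w w') (hxc : ContDiff ℝ ∞ x)
    (hu : ∀ t, 0 < u t) (hw : ∀ t, w t < 0) (hx : 0 ≤ x 0) : HasAsymptotics u w := by
  obtain ⟨t₁, c, hc, hle⟩ := h.exists_exp_le hu hw hx
  have huc := h.continuous_u
  have hwc := h.continuous_w
  refine h.hasAsymptotics hxc (t₁ := max 0 t₁) hc (fun t ht => hle t ((le_max_right _ _).trans ht))
    (C := -(w 0 * u 0 ^ 2)) fun t ht => ?_
  have h1 := le_of_hasDerivAt_nonneg (f := fun t => w t * u t ^ 2) ((le_max_left _ _).trans ht)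
    (by fun_prop) (fun s _ => h.hasDerivAt_v (t := s) trivial) fun s hs => by
      have h2 := hx.trans (h.monotoneOn_x hs.1.le fun t _ => hu t)
      have h3 := mul_nonneg (mul_nonneg h2 (hu s).le) (neg_nonneg.2 (hw s).le)
      linarith
  rw [abs_of_nonpos (mul_nonpos_of_nonpos_of_nonneg (hw t).le (sq_nonneg _))]
  linarith

end SystemOn

namespace CriticalSolution

variable {x u w w' : ℝ → ℝ} {a : ℝ}

theorem reflection_u_w (h : CriticalSolution x u w w' a) (hx : x 0 = 0) (hu : 0 < u 0) (t : ℝ) :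
    u (2 * a - t) = -u t ∧ w (2 * a - t) = w t := by
  have hr := h.reflection hx hu
  have hsub : ∀ t, HasDerivAt (fun t => 2 * a - t) (-1) t := fun t => by
    simpa using (hasDerivAt_id t).const_sub (2 * a)
  have h1 : ∀ t, u (2 * a - t) = -u t := fun t => by
    have h2 := (h.hx (2 * a - t) trivial).scomp t (hsub t)
    rw [show x ∘ (fun t => 2 * a - t) = x from funext hr] at h2
    have := h2.unique (h.hx t trivial)
    simp only [smul_eq_mul] at this
    linarith
  refine ⟨h1 t, ?_⟩
  have h2 := (h.hu (2 * a - t) trivial).scomp t (hsub t)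
  rw [show u ∘ (fun t => 2 * a - t) = fun t => -u t from funext h1] at h2
  have := h2.unique (h.hu t trivial).fun_neg
  simp only [smul_eq_mul, hr] at this
  linarith

theorem hasAsymptotics_comp_neg (h : CriticalSolution x u w w' a) (hx : x 0 = 0) (hu : 0 < u 0)
    (hA : HasAsymptotics u w) : HasAsymptotics (fun t => u (-t)) (fun t => w (-t)) := by
  have h1 := (hA.comp_add (2 * a)).const_mul (-1) 1
  convert h1 using 2 with t t
  · rw [neg_one_mul, ← (h.reflection_u_w hx hu (t + 2 * a)).1]
    ring_nf
  · rw [one_mul, ← (h.reflection_u_w hx hu (t + 2 * a)).2]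
    ring_nf

end CriticalSolution

/-- At -∞ there are two mechanisms. Without critical point, (t, x) ↦ (-t, -x) keeps u > 0 and turns
w negative; with one, the reflection symmetry transfers the expansion at +∞. -/
theorem SolvesIVP.hasAsymptotics {τ : ℝ} {x : ℝ → ℝ} (h : SolvesIVP τ x) (hτ : 0 < τ) :
    HasAsymptotics (deriv x) (fun t => iteratedDeriv 2 x t - x t) ∧
      HasAsymptotics (fun t => deriv x (-t)) (fun t => iteratedDeriv 2 x (-t) - x (-t)) := by
  have hw := h.w_pos hτ
  have hu0 : 0 < deriv x 0 := by simp [h.2.2.1]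
  rcases h.pos_or_critical hτ with hu | ⟨a, hc⟩
  · refine ⟨h.system.hasAsymptotics_of_pos h.1.1 h.2.1 (fun t _ => hu t) fun t _ => hw t, ?_⟩
    have := (h.system.comp_neg_neg.hasAsymptotics_of_neg (h.1.1.comp contDiff_neg).neg
      (fun t => hu _) (fun t => neg_neg_of_pos (hw _)) (by simp [h.2.1])).const_mul 1 (-1)
    simpa using this
  · have ha := hc.lt_of_u_pos hu0
    have hA := h.system.hasAsymptotics_of_pos h.1.1 h.2.1
      (fun t ht => hc.u_pos t (ha.trans_le ht)) fun t _ => hw t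
    exact ⟨hA, hc.hasAsymptotics_comp_neg h.2.1 hu0 hA⟩

/-! ### Solutions with w = 0 -/

theorem obtainedFrom_exp_or_cosh_or_sinh {x : ℝ → ℝ} {A B : ℝ}
    (h : ∀ t, x t = A * Real.exp t + B * Real.exp (-t)) :
    ObtainedFrom x Real.exp ∨ ObtainedFrom x Real.cosh ∨ ObtainedFrom x Real.sinh := by
  have hexp : ∀ {k : ℝ}, 0 < k → Real.exp (Real.log k / 2) * Real.exp (Real.log k / 2) = k :=
    fun hk => by rw [← Real.exp_add, add_halves, Real.exp_log hk]
  have hinv : ∀ k : ℝ, Real.exp (Real.log k / 2) * Real.exp (-(Real.log k / 2)) = 1 := fun k => by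
    rw [← Real.exp_add, add_neg_cancel, Real.exp_zero]
  rcases lt_trichotomy (A * B) 0 with hAB | hAB | hAB
  · right; right
    have hB : B ≠ 0 := by rintro rfl; simp at hAB
    have hk : 0 < -(A / B) := by
      rw [neg_pos, div_neg_iff]
      rcases mul_neg_iff.1 hAB with h1 | h1
      · exact Or.inl h1
      · exact Or.inr h1
    refine ⟨-(2 * B * Real.exp (Real.log (-(A / B)) / 2)), 1, Real.log (-(A / B)) / 2, Or.inl rfl,
      fun t => ?_⟩
    have h1 := hexp hk
    have h2 := hinv (-(A / B))
    rw [h t, Real.sinh_eq, one_mul, neg_add, Real.exp_add, Real.exp_add]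
    have h3 : B * (A / B) = A := mul_div_cancel₀ A hB
    linear_combination -Real.exp t * h3 + B * Real.exp t * h1 - B * Real.exp (-t) * h2
  · left
    rcases mul_eq_zero.1 hAB with rfl | rfl
    · exact ⟨B, -1, 0, Or.inr rfl, fun t => by rw [h t]; simp⟩
    · exact ⟨A, 1, 0, Or.inl rfl, fun t => by rw [h t]; simp⟩
  · right; left
    have hB : B ≠ 0 := by rintro rfl; simp at hAB
    have hk : 0 < A / B := by
      rw [div_pos_iff]
      exact mul_pos_iff.1 hAB
    refine ⟨2 * B * Real.exp (Real.log (A / B) / 2), 1, Real.log (A / B) / 2, Or.inl rfl,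
      fun t => ?_⟩
    have h1 := hexp hk
    have h2 := hinv (A / B)
    rw [h t, Real.cosh_eq, one_mul, neg_add, Real.exp_add, Real.exp_add]
    have h3 : B * (A / B) = A := mul_div_cancel₀ A hB
    linear_combination -Real.exp t * h3 - B * Real.exp t * h1 - B * Real.exp (-t) * h2

/-- Both e^(-t)(u + x) and e^t(x - u) are constant when w = 0. -/
theorem SystemOn.eq_exp_add_exp_neg {x u w w' : ℝ → ℝ} (h : SystemOn univ x u w w')
    (hw : ∀ t, w t = 0) (t : ℝ) :
    x t = (u 0 + x 0) / 2 * Real.exp t + (x 0 - u 0) / 2 * Real.exp (-t) := by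
  have h1 : ∀ t, HasDerivAt (fun t => Real.exp (-t) * (u t + x t)) 0 t := fun t => by
    simpa [hw t] using h.hasDerivAt_exp_neg_mul t
  have h2 : ∀ t, HasDerivAt (fun t => Real.exp t * (x t - u t)) 0 t := fun t => by
    refine ((Real.hasDerivAt_exp t).mul ((h.hx t trivial).sub (h.hu t trivial))).congr_deriv ?_
    simp only [Pi.sub_apply, hw t]
    ring
  have h3 := is_const_of_deriv_eq_zero (fun t => (h1 t).differentiableAt) (fun t => (h1 t).deriv) t 0
  have h4 := is_const_of_deriv_eq_zero (fun t => (h2 t).differentiableAt) (fun t => (h2 t).deriv) t 0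
  simp only [neg_zero, Real.exp_zero, one_mul] at h3 h4
  have h5 : Real.exp t * Real.exp (-t) = 1 := by rw [← Real.exp_add, add_neg_cancel, Real.exp_zero]
  linear_combination -x t * h5 + Real.exp t / 2 * h3 + Real.exp (-t) / 2 * h4

theorem systemOn_sinh : SystemOn univ Real.sinh Real.cosh (fun _ => 0) (fun _ => 0) where
  hx t _ := Real.hasDerivAt_sinh t
  hu t _ := by simpa using Real.hasDerivAt_cosh t
  hw t _ := hasDerivAt_const t 0
  eqn t _ := by simp

theorem solvesIVP_sinh : SolvesIVP 0 Real.sinh :=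
  solvesIVP_of_system systemOn_sinh Real.contDiff_sinh Real.sinh_zero Real.cosh_zero rfl

theorem SolvesIVP.eq_sinh {x : ℝ → ℝ} (h : SolvesIVP 0 x) : x = Real.sinh := by
  have hw : ∀ t, iteratedDeriv 2 x t - x t = 0 :=
    (h.system.w_zero_or_ne_zero h.exists_ne_zero).resolve_right fun h0 => h0 0 h.w_zero
  funext t
  rw [h.system.eq_exp_add_exp_neg hw t, h.2.1, h.2.2.1, Real.sinh_eq]
  ring

theorem hasAsymptotics_cosh : HasAsymptotics Real.cosh (fun _ => 0) := by
  refine ⟨fun z => (1 + z) / 2, fun _ => 0, ?_, contDiffOn_const, fun t => ⟨?_, by simp⟩⟩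
  · exact ContDiff.contDiffOn (by fun_prop)
  · beta_reduce
    have h1 : Real.exp t * Real.exp (-2 * t) = Real.exp (-t) := by
      rw [← Real.exp_add]
      ring_nf
    rw [Real.cosh_eq]
    linear_combination -h1 / 2

theorem SolvesIVP.hasAsymptotics_of_nonneg {τ : ℝ} {x : ℝ → ℝ} (h : SolvesIVP τ x) (hτ : 0 ≤ τ) :
    HasAsymptotics (deriv x) (fun t => iteratedDeriv 2 x t - x t) ∧
      HasAsymptotics (fun t => deriv x (-t)) (fun t => iteratedDeriv 2 x (-t) - x (-t)) := by
  rcases eq_or_lt_of_le hτ with rfl | hτ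
  · obtain rfl := h.eq_sinh
    rw [systemOn_sinh.deriv_eq, systemOn_sinh.iteratedDeriv_two_eq]
    simp only [Real.cosh_neg, add_zero, sub_self]
    exact ⟨hasAsymptotics_cosh, hasAsymptotics_cosh⟩
  · exact h.hasAsymptotics hτ

/-! ### Classification and the main theorem -/

/-- The solutions obtained from one of the solutions of the initial value problem. -/
def IsReducible (T : ℝ) (x : ℝ → ℝ) : Prop :=
  ∃ τ ∈ Icc 0 T, ∃ y : ℝ → ℝ, SolvesIVP τ y ∧ ObtainedFrom x y

theorem IsReducible.of_symm {T σ δ : ℝ} {x : ℝ → ℝ} (hσ : σ = 1 ∨ σ = -1) (hδ : δ = 1 ∨ δ = -1)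
    (h : IsReducible T fun t => σ * x (δ * t)) : IsReducible T x := by
  obtain ⟨τ, hτ, y, hy, α, ε, t₀, hε, h⟩ := h
  have hσ2 : σ * σ = 1 := by rcases hσ with rfl | rfl <;> norm_num
  have hδ2 : δ * δ = 1 := by rcases hδ with rfl | rfl <;> norm_num
  refine ⟨τ, hτ, y, hy, σ * α, ε * δ, t₀, ?_, fun t => ?_⟩
  · rcases hε with rfl | rfl <;> rcases hδ with rfl | rfl <;> norm_num
  · have h1 := h (δ * t)
    beta_reduce at h1
    rw [← mul_assoc δ, hδ2, one_mul, ← mul_assoc ε] at h1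
    rw [mul_assoc σ, ← h1, ← mul_assoc, hσ2, one_mul]

namespace IsCriticalParameter

variable {T : ℝ} {x u w w' : ℝ → ℝ}

theorem isReducible_of_zero (hT : IsCriticalParameter T) (h : SystemOn univ x u w w')
    (hxc : ContDiff ℝ ∞ x) {t₁ : ℝ} (hx : x t₁ = 0) (hu : 0 < u t₁) (hw : 0 < w t₁) :
    IsReducible T x := by
  have hne : deriv x t₁ ≠ 0 := by
    rw [h.deriv_eq]
    exact hu.ne'
  have hn := (h.isSmoothSolution hxc).normalize hx hne
  have hpos : 0 < (iteratedDeriv 2 x t₁ - x t₁) / deriv x t₁ := by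
    rw [h.deriv_eq, h.iteratedDeriv_two_eq]
    simpa using div_pos hw hu
  exact ⟨_, ⟨hpos.le, hT.le hn hpos⟩, _, hn, obtainedFrom_normalize hne⟩

theorem isReducible_of_pos (hT : IsCriticalParameter T) (h : SystemOn univ x u w w')
    (hxc : ContDiff ℝ ∞ x) (hu : ∀ t, 0 < u t) (hw : ∀ t, 0 < w t) : IsReducible T x := by
  obtain ⟨a, ha⟩ := h.exists_x_nonpos hu hw
  obtain ⟨b, hab, hb⟩ := h.exists_x_nonneg (a := a) (fun t _ => hu t) fun t _ => hw t
  obtain ⟨t₁, -, ht₁⟩ := intermediate_value_Icc hab.le h.continuous_x.continuousOn ⟨ha, hb⟩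
  exact hT.isReducible_of_zero h hxc ht₁ (hu t₁) (hw t₁)

/-- The sign changes of x and t act on the pair of signs of (u, w) by all four combinations, so u, w
> 0 may be assumed. -/
theorem isReducible_of_ne_zero (hT : IsCriticalParameter T) (h : SystemOn univ x u w w')
    (hxc : ContDiff ℝ ∞ x) (hu : ∀ t, u t ≠ 0) (hw : ∀ t, w t ≠ 0) : IsReducible T x := by
  have hneg : ContDiff ℝ ∞ fun t => x (-t) := hxc.comp contDiff_neg
  rcases SystemOn.sign_of_ne_zero ordConnected_univ h.continuous_u.continuousOn fun t _ => hu t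
    with h1 | h1 <;>
  rcases SystemOn.sign_of_ne_zero ordConnected_univ h.continuous_w.continuousOn fun t _ => hw t
    with h2 | h2
  · exact hT.isReducible_of_pos h hxc (fun t => h1 t trivial) fun t => h2 t trivial
  · refine IsReducible.of_symm (Or.inr rfl) (Or.inr rfl) ?_
    simp only [neg_one_mul]
    exact hT.isReducible_of_pos h.comp_neg_neg hneg.neg (fun t => h1 _ trivial)
      fun t => neg_pos.2 (h2 _ trivial)
  · refine IsReducible.of_symm (Or.inl rfl) (Or.inr rfl) ?_
    simp only [neg_one_mul, one_mul]
    exact hT.isReducible_of_pos h.comp_neg_univ hneg (fun t => neg_pos.2 (h1 _ trivial))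
      fun t => h2 _ trivial
  · refine IsReducible.of_symm (Or.inr rfl) (Or.inl rfl) ?_
    simp only [neg_one_mul, one_mul]
    exact hT.isReducible_of_pos h.neg hxc.neg (fun t => neg_pos.2 (h1 _ trivial))
      fun t => neg_pos.2 (h2 _ trivial)

theorem isReducible_of_critical (hT : IsCriticalParameter T) (h : SystemOn univ x u w w')
    (hxc : ContDiff ℝ ∞ x) {a : ℝ} (hu : u a = 0) (hw : w a ≠ 0) : IsReducible T x := by
  have key : ∀ {x u w w' : ℝ → ℝ}, SystemOn univ x u w w' → ContDiff ℝ ∞ x → u a = 0 → 0 < w a →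
      IsReducible T x := fun h hxc hu hw => by
    have hc := h.criticalSolution hu hw
    obtain ⟨t₁, ht₁, hx⟩ := hc.exists_zero
    exact hT.isReducible_of_zero h hxc hx (hc.u_pos t₁ ht₁) (hc.w_pos t₁)
  rcases hw.lt_or_gt with hw | hw
  · refine IsReducible.of_symm (Or.inr rfl) (Or.inl rfl) ?_
    simp only [neg_one_mul, one_mul]
    exact key h.neg hxc.neg (by simp [hu]) (neg_pos.2 hw)
  · exact key h hxc hu hw

theorem classification (hT : IsCriticalParameter T) (h : IsSmoothSolution x) :
    ObtainedFrom x Real.exp ∨ ObtainedFrom x Real.cosh ∨ IsReducible T x := by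
  have hs := h.systemOn
  have hlin : (∀ t, iteratedDeriv 2 x t - x t = 0) →
      ObtainedFrom x Real.exp ∨ ObtainedFrom x Real.cosh ∨ IsReducible T x := fun hw => by
    rcases obtainedFrom_exp_or_cosh_or_sinh (hs.eq_exp_add_exp_neg hw) with h1 | h1 | h1
    · exact Or.inl h1
    · exact Or.inr (Or.inl h1)
    · exact Or.inr (Or.inr ⟨0, ⟨le_rfl, hT.pos.le⟩, _, solvesIVP_sinh, h1⟩)
  by_cases hx : ∃ t, x t ≠ 0
  · rcases hs.w_zero_or_ne_zero hx with hw | hw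
    · exact hlin hw
    · refine Or.inr (Or.inr ?_)
      rcases hs.critical_points hx with hu | ⟨a, ha, -, -⟩
      · exact hT.isReducible_of_ne_zero hs h.1 hu hw
      · exact hT.isReducible_of_critical hs h.1 ha (hw a)
  · push Not at hx
    exact Or.inl ⟨0, 1, 0, Or.inl rfl, fun t => by simp [hx t]⟩

theorem existsUnique (hT : IsCriticalParameter T) {τ : ℝ} (hτ : τ ∈ Icc 0 T) :
    ∃! x : ℝ → ℝ, SolvesIVP τ x := by
  rcases eq_or_lt_of_le hτ.1 with rfl | h0
  · exact ⟨_, solvesIVP_sinh, fun y hy => hy.eq_sinh⟩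
  · obtain ⟨x, hx⟩ := hT.exists_solvesIVP h0 hτ.2
    exact ⟨x, hx, fun y hy => hT.unique h0 hy hx⟩

theorem deriv_pos_iff (hT : IsCriticalParameter T) {τ : ℝ} (hτ : 0 ≤ τ) (h : SolvesIVP τ x) :
    (∀ t, 0 < deriv x t) ↔ τ < T := by
  rcases eq_or_lt_of_le hτ with rfl | h0
  · obtain rfl := h.eq_sinh
    rw [systemOn_sinh.deriv_eq]
    exact iff_of_true Real.cosh_pos hT.pos
  · refine ⟨hT.lt_of_pos h h0, fun hlt => (h.pos_or_critical h0).resolve_right ?_⟩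
    rintro ⟨a, hc⟩
    exact hlt.ne (hT.eq_of_critical h hc)

theorem existsUnique_deriv_eq_zero (hT : IsCriticalParameter T) (h : SolvesIVP T x) :
    ∃! t₀ : ℝ, deriv x t₀ = 0 := by
  rcases h.pos_or_critical hT.pos with hu | ⟨a, hc⟩
  · exact absurd (hT.lt_of_pos h hT.pos hu) (lt_irrefl T)
  · refine ⟨a, hc.u_crit, fun t ht => ?_⟩
    rcases lt_trichotomy t a with h1 | h1 | h1
    · exact absurd ht (hc.u_neg t h1).ne
    · exact h1
    · exact absurd ht (hc.u_pos t h1).ne'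

end IsCriticalParameter

theorem mainTheorem3 :
    ∃ T : ℝ, 0 < T ∧
      -- for `τ ∈ [0, T]` the initial value problem has exactly one smooth solution on `ℝ`
      (∀ τ ∈ Set.Icc 0 T, ∃! x : ℝ → ℝ, SolvesIVP τ x) ∧
      -- every smooth solution on `ℝ` comes from `exp`, `cosh` or one of these
      (∀ x : ℝ → ℝ, IsSmoothSolution x →
        ObtainedFrom x Real.exp ∨ ObtainedFrom x Real.cosh ∨
          ∃ τ ∈ Set.Icc 0 T, ∃ y : ℝ → ℝ, SolvesIVP τ y ∧ ObtainedFrom x y) ∧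
      (∀ τ ∈ Set.Icc 0 T, ∀ x : ℝ → ℝ, SolvesIVP τ x →
        (∃ ξ ζ μ ν : ℝ → ℝ,
          SmoothOnHalfLine ξ ∧ SmoothOnHalfLine ζ ∧ SmoothOnHalfLine μ ∧ SmoothOnHalfLine ν ∧
          ∀ t : ℝ,
            deriv x t = Real.exp (-t) * ξ (Real.exp (2 * t)) ∧
            deriv x t = Real.exp t * ζ (Real.exp (-2 * t)) ∧
            (iteratedDeriv 2 x t - x t) * (deriv x t) ^ 2 =
              Real.exp t * μ (Real.exp (2 * t)) ∧
            (iteratedDeriv 2 x t - x t) * (deriv x t) ^ 2 =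
              Real.exp (-t) * ν (Real.exp (-2 * t))) ∧
        ((∀ t : ℝ, 0 < deriv x t) ↔ τ < T)) ∧
      (∀ x : ℝ → ℝ, SolvesIVP T x → ∃! t₀ : ℝ, deriv x t₀ = 0) := by
  obtain ⟨T, hT⟩ := exists_isCriticalParameter
  refine ⟨T, hT.pos, fun τ hτ => hT.existsUnique hτ, fun x hx => hT.classification hx,
    fun τ hτ x hx => ⟨?_, hT.deriv_pos_iff hτ.1 hx⟩, fun x hx => hT.existsUnique_deriv_eq_zero hx⟩
  -- The expansions at -∞ are those of the time-reversed functions, evaluated at -t.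
  obtain ⟨⟨ζ, ν, hζ, hν, h₁⟩, ⟨ξ, μ, hξ, hμ, h₂⟩⟩ := hx.hasAsymptotics_of_nonneg hτ.1
  refine ⟨ξ, ζ, μ, ν, hξ, hζ, hμ, hν, fun t => ⟨?_, (h₁ t).1, ?_, (h₁ t).2⟩⟩
  · simpa using (h₂ (-t)).1
  · simpa using (h₂ (-t)).2
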